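/- Let $M$ be a regular closed curve in the plane, given by a smooth $T$-periodic immersion $f:\mathbb{R}\to\mathbb{R}^2$; its points are identified with the parameters in $S^1=\mathbb{R}/T\mathbb{Z}$. Assume that $M$ is generic in the following sense: (a) self-intersections are transverse; (b) at every zero of the signed curvature $\kappa$ one has $\kappa'\neq 0$ (all inflexion points are ordinary); (c) the tangent lines at two different inflexion points are never parallel. Let $\lambda\in\mathbb{R}\setminus\{0,1\}$. *Equidistant and branches.* Parameters $s,t$ form a parallel pair if $f(s)\ne f(t)$ and the tangent lines at $s$ and $t$ are parallel. Put $\pi_\lambda(s,t)=\lambda f(s)+(1-\lambda)f(t)$ on $S^1\times S^1$ and let ${\rm E}_\lambda(M)$ be the closure of the set of all $\pi_\lambda(s,t)$, $(s,t)$ a parallel pair. Let $\mathcal P\subset S^1\times S^1$ be the closure of the set of parallel pairs. A smooth branch of ${\rm E}_\lambda(M)$ is a set $\pi_\lambda(X)$, where $X$ is maximal (for inclusion) among the images of $C^\infty$ curves $u\mapsto(\sigma(u),\tau(u))$, $u\in\mathbb R$, with nowhere vanishing velocity and values in $\mathcal P$. *Parallel arcs.* Let $\varphi:S^1\to\mathbb{R}/\pi\mathbb{Z}$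 be the angle function, $\varphi(s)$ being the oriented angle from $f'(0)$ to $f'(s)$ modulo $\pi$, and let $\mathcal M=\{\varphi(s):\varphi'(s)=0,\ \varphi''(s)\ne0\}$ be its set of local extrema. Let $\mathcal S=\varphi^{-1}(\mathcal M)$ if $\mathcal M\neq\emptyset$ and $\mathcal S=\varphi^{-1}(\varphi(0))$ otherwise. The points of $\mathcal S$ cut $S^1$ into arcs, each between two consecutive points of $\mathcal S$. If $\mathcal M\ne\emptyset$, then for any two different $\alpha,\beta\in\mathcal M$ that are consecutive for the orientation of $\mathbb{R}/\pi\mathbb{Z}$ the corresponding set of parallel arcs consists of the arcs, directed from an end point $p$ to the other end point $q$, with $\varphi(p)=\alpha$, $\varphi(q)=\beta$ and with interior mapped by $\varphi$ onto the open interval $(\alpha,\beta)$. If $\mathcal M=\emptyset$ there is a single set of parallel arcs, consisting of all arcs, directed as the curve. *Glueing schemes.* For two different directed arcs $p_{k}\frown p_{k'}$ and $p_{l}\frown p_{l'}$ which, or both of whose reversals, belong to the same set of parallel arcs, let $\begin{array}{ccc}p_k&\frown&p_{k'}\\ \hline p_l&\frown&p_{l'}\end{array}$ be the closure in $S^1\times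 S^1$ of the set of parallel pairs $(a,b)$ with $a$ in the interior of the first arc and $b$ in the interior of the second. A glueing scheme for ${\rm E}_\lambda(M)$ is a union of such sets along a sequence of at least one step, $$\begin{array}{ccccccc}p_{k_0}&\frown&p_{k_1}&\frown&\cdots&\frown&p_{k_n}\\ \hline p_{l_0}&\frown&p_{l_1}&\frown&\cdots&\frown&p_{l_n}\end{array},\qquad n\ge 1,$$ in which no pair $(p_{k_i},p_{l_i})$ occurs twice, except that the first and the last may coincide, and in which, if $\lambda=\frac12$, an equality $(p_{k_i},p_{l_i})=(p_{l_j},p_{k_j})$ (also with $i=j$) holds only for $i,j\in\{0,n\}$. A maximal glueing scheme is a maximal element, for inclusion, of the set of all glueing schemes for ${\rm E}_\lambda(M)$. **Theorem.** (i) The image under $\pi_\lambda$ of every maximal glueing scheme for ${\rm E}_\lambda(M)$ is a smooth branch of ${\rm E}_\lambda(M)$. (ii) Every smooth branch of ${\rm E}_\lambda(M)$ is the image under $\pi_\lambda$ of a maximal glueing scheme. (iii) ${\rm E}_\lambda(M)$ is the union of its smooth branches. -/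

import Mathlib

open scoped ContDiff Affine

noncomputable section

/-- Positivity of `π`, so that `AddCircle π` (angles modulo `π`) carries its circular order. -/
instance instFactPiPos : Fact (0 < Real.pi) := ⟨Real.pi_pos⟩

/-- A regular closed parameterized curve in the plane (identified with `ℂ`): a smooth periodic map
with nowhere vanishing velocity, i.e. a smooth immersion of the circle `ℝ / Tℤ`. -/
structure RegularClosedCurve where
  toFun : ℝ → ℂ
  period : ℝ
  period_pos : 0 < period
  contDiff : ContDiff ℝ ∞ toFun
  periodic : Function.Periodic toFun period
  regular : ∀ s, deriv toFun s ≠ 0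

namespace RegularClosedCurve

variable (M : RegularClosedCurve)

/-- The circle of parameters; its elements are the points of the parameterized curve. -/
abbrev Param : Type := AddCircle M.period

/-- The curve as a map on its circle of parameters. -/
def onCircle : M.Param → ℂ := M.periodic.lift

/-- The tangent line at the parameter `s`. -/
def tangentLine (s : ℝ) : AffineSubspace ℝ ℂ :=
  AffineSubspace.mk' (M.toFun s) (Submodule.span ℝ {deriv M.toFun s})

/-- The parameters `s`, `t` give a parallel pair: two different points of the plane at which the
tangent lines are parallel (possibly equal). -/
def ParallelPair (s t : ℝ) : Prop :=
  M.toFun s ≠ M.toFun t ∧ M.tangentLine s ∥ M.tangentLine t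

/-- The signed curvature `det (f', f'') / |f'|³`. -/
def curvature (s : ℝ) : ℝ :=
  (starRingEnd ℂ (deriv M.toFun s) * deriv (deriv M.toFun) s).im / ‖deriv M.toFun s‖ ^ 3

/-- The genericity conditions: self-intersections are transverse, every zero of the curvature is an
ordinary inflexion point, and the tangent lines at two different inflexion points are never
parallel. -/
structure IsGeneric : Prop where
  transverse : ∀ s t : ℝ, (s : M.Param) ≠ (t : M.Param) → M.toFun s = M.toFun t →
    ¬ M.tangentLine s ∥ M.tangentLine t
  ordinary : ∀ s : ℝ, M.curvature s = 0 → deriv M.curvature s ≠ 0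
  inflexions : ∀ s t : ℝ, (s : M.Param) ≠ (t : M.Param) → M.curvature s = 0 → M.curvature t = 0 →
    ¬ M.tangentLine s ∥ M.tangentLine t

/-- The `λ`-point map `(a, b) ↦ λ a + (1 - λ) b`. -/
def pointMap (lam : ℝ) (p : M.Param × M.Param) : ℂ :=
  (lam : ℂ) * M.onCircle p.1 + (1 - (lam : ℂ)) * M.onCircle p.2

/-- The affine `λ`-equidistant. -/
def equidistant (lam : ℝ) : Set ℂ :=
  closure {z | ∃ s t : ℝ, M.ParallelPair s t ∧
    z = (lam : ℂ) * M.toFun s + (1 - (lam : ℂ)) * M.toFun t}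

/-! ### Smooth branches -/

/-- The closure, in the torus of pairs of parameters, of the set of parallel pairs. -/
def pairSet : Set (M.Param × M.Param) :=
  closure {p | ∃ s t : ℝ, M.ParallelPair s t ∧ p = ((s : M.Param), (t : M.Param))}

/-- `X` is traced out by a smooth family `(σ(u), τ(u))` of pairs, with nowhere vanishing velocity,
in the closure of the set of parallel pairs. -/
def IsPairTrace (X : Set (M.Param × M.Param)) : Prop :=
  ∃ σ τ : ℝ → ℝ, ContDiff ℝ ∞ σ ∧ ContDiff ℝ ∞ τ ∧
    (∀ u, (deriv σ u, deriv τ u) ≠ (0, 0)) ∧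
    (∀ u, ((σ u : M.Param), (τ u : M.Param)) ∈ M.pairSet) ∧
    X = Set.range fun u => ((σ u : M.Param), (τ u : M.Param))

/-- A smooth branch of the `λ`-equidistant: a curve with a smooth parameterization
`u ↦ λ f(σ(u)) + (1 - λ) f(τ(u))`, where `(σ(u), τ(u))` runs through a maximal smooth family of
parallel pairs (and limits of such). -/
def IsSmoothBranch (lam : ℝ) (C : Set ℂ) : Prop :=
  ∃ X, Maximal M.IsPairTrace X ∧ C = M.pointMap lam '' X

/-! ### The angle function and the sets of parallel arcs -/

/-- The angle function: the oriented angle from `f'(0)` to `f'(s)`, modulo `π`. -/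
def angle (s : ℝ) : AddCircle Real.pi :=
  ((Complex.arg (deriv M.toFun s / deriv M.toFun 0) : ℝ) : AddCircle Real.pi)

/-- The real-valued function `u ↦` oriented angle from `f'(s)` to `f'(u)`. For `u` near `s` it is a
smooth lift of `angle u - angle s`; the derivatives of the angle function at `s` are those of this
lift. -/
def angleLift (s u : ℝ) : ℝ :=
  Complex.arg (deriv M.toFun u / deriv M.toFun s)

/-- The set of local extrema (extremal values) of the angle function. -/
def localExtrema : Set (AddCircle Real.pi) :=
  {c | ∃ s : ℝ, M.angle s = c ∧ deriv (M.angleLift s) s = 0 ∧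
    iteratedDeriv 2 (M.angleLift s) s ≠ 0}

open Classical in
/-- The parallel points (as a periodic set of real parameters): the preimage of the set of local
extrema under the angle function or, if there are none, the preimage of `angle 0`. -/
def parallelPoints : Set ℝ :=
  if M.localExtrema.Nonempty then {s | M.angle s ∈ M.localExtrema}
  else {s | M.angle s = M.angle 0}

/-- `u < v` are consecutive parallel points. -/
def Consecutive (u v : ℝ) : Prop :=
  u < v ∧ u ∈ M.parallelPoints ∧ v ∈ M.parallelPoints ∧ ∀ w ∈ Set.Ioo u v, w ∉ M.parallelPoints

/-- The set of parallel arcs belonging to the interval of directions from `α` to `β`. A directed arc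
is given by its first and its last end point `(u, v)`; as a subset of the curve it is the image of
the interval between them. Arcs are recorded through all their lifts to `ℝ`. -/
def parallelArcs (α β : AddCircle Real.pi) : Set (ℝ × ℝ) :=
  {p | (M.Consecutive p.1 p.2 ∨ M.Consecutive p.2 p.1) ∧ M.angle p.1 = α ∧ M.angle p.2 = β ∧
    M.angle '' Set.uIoo p.1 p.2 = Set.cIoo α β}

open Classical in
/-- The family of all sets of parallel arcs. If there are local extrema, there is one set for each
pair of local extrema that are consecutive for the orientation of `ℝ / πℤ`; otherwise there is just
one set, consisting of all arcs between consecutive parallel points, directed as the curve. -/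
def parallelArcSets : Set (Set (ℝ × ℝ)) :=
  if M.localExtrema.Nonempty then
    {Φ | ∃ α ∈ M.localExtrema, ∃ β ∈ M.localExtrema, α ≠ β ∧
      Set.cIoo α β ∩ M.localExtrema = ∅ ∧ Φ = M.parallelArcs α β}
  else {{p | M.Consecutive p.1 p.2}}

/-! ### Glueing schemes -/

/-- The directed arcs from `u` to `v` and from `u'` to `v'` are different arcs of the curve, and
they, or both reversed arcs, belong to the same set of parallel arcs. -/
def Glueable (u v u' v' : ℝ) : Prop :=
  (∃ Φ ∈ M.parallelArcSets,
    ((u, v) ∈ Φ ∧ (u', v') ∈ Φ) ∨ ((v, u) ∈ Φ ∧ (v', u') ∈ Φ)) ∧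
  ¬ ∃ n : ℤ, u' = u + n * M.period ∧ v' = v + n * M.period

/-- The arc (a set of pairs) obtained from the arcs of the curve from `u` to `v` and from `u'`
to `v'`: the closure of the set of the parallel pairs with one point in the interior of each. -/
def glueArc (u v u' v' : ℝ) : Set (M.Param × M.Param) :=
  closure {p | ∃ s ∈ Set.uIoo u v, ∃ t ∈ Set.uIoo u' v', M.ParallelPair s t ∧
    p = ((s : M.Param), (t : M.Param))}

/-- A glueing scheme for the `λ`-equidistant, with upper row `p_{k_0} ⌢ p_{k_1} ⌢ ⋯` and lower row
`p_{l_0} ⌢ p_{l_1} ⌢ ⋯`, both followed along lifts to `ℝ`. No pair of points except the beginning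
and the end appears twice. If `λ = 1/2` and `(p_k, p_l)` appears, then `(p_l, p_k)` does not appear,
unless they are the beginning and the end (a pair `(p_k, p_k)` is therefore only possible as the
beginning or as the end). -/
structure GlueingScheme (lam : ℝ) where
  length : ℕ
  length_pos : 0 < length
  upper : Fin (length + 1) → ℝ
  lower : Fin (length + 1) → ℝ
  step : ∀ i : Fin length,
    M.Glueable (upper i.castSucc) (upper i.succ) (lower i.castSucc) (lower i.succ)
  no_repeat : ∀ i j : Fin (length + 1), i ≠ j →
    ((upper i : M.Param), (lower i : M.Param)) = ((upper j : M.Param), (lower j : M.Param)) →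
    (i = 0 ∨ i = Fin.last length) ∧ (j = 0 ∨ j = Fin.last length)
  no_swap : lam = 1 / 2 → ∀ i j : Fin (length + 1),
    ((upper i : M.Param), (lower i : M.Param)) = ((lower j : M.Param), (upper j : M.Param)) →
    (i = 0 ∨ i = Fin.last length) ∧ (j = 0 ∨ j = Fin.last length)

/-- The set of pairs of points which a glueing scheme denotes: the union of its arcs. -/
def GlueingScheme.carrier {M : RegularClosedCurve} {lam : ℝ} (S : M.GlueingScheme lam) :
    Set (M.Param × M.Param) :=
  ⋃ i : Fin S.length,
    M.glueArc (S.upper i.castSucc) (S.upper i.succ) (S.lower i.castSucc) (S.lower i.succ)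

/-- `G` is a maximal glueing scheme: a maximal element, for inclusion, of the set of all glueing
schemes for the `λ`-equidistant. -/
def IsMaximalGlueingScheme (lam : ℝ) (G : Set (M.Param × M.Param)) : Prop :=
  Maximal (fun X => ∃ S : M.GlueingScheme lam, X = S.carrier) G

end RegularClosedCurve

end

/-! The velocity of the curve has a smooth logarithm, whose imaginary part `θ` lifts the angle
function. It satisfies `θ (s + T) = θ s + rot * π` with `rot` even. Since `κ = θ' / |f'|`, ordinary
inflexions make `θ` a Morse function for which every critical point has `θ'' ≠ 0`, and condition (c)
makes the critical values at different points of the circle different modulo `π`. By transversality,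
parallel pairs are exactly the pairs off the diagonal with `θ s - θ t ∈ πℤ`. The closure `𝒫` of
their set is described in two ways.

Combinatorially, `𝒫` is a finite union of edges, one for each two different arcs that run parallel;
an edge is the graph of a monotone correspondence between the arcs. The end points of edges are
pairs of marked points, and each such vertex has exactly two neighbours
(`Vertex.exists_neighbours`): of the four choices of an arc on either side of each point, two are
admissible, because at most one of two different parallel points is critical. On the diagonal the
point is critical, and the two choices of twice the same arc drop out. So the graph consists of
doubly infinite walks without turning back, whose carriers are the connected components of `𝒫`
(`IsWalk.subset_walkCarrier`).

Analytically, `sin (θ s - θ t) = sin (π (s - t) / T) * Φ (s, t)` with `Φ` smooth. The zero set of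
`Φ` is the lift of `𝒫`, and the gradient does not vanish on it (`field_ne_zero`). Hence the orbits
of the Hamiltonian field of `Φ` are immersed curves that fill the components
(`IsWalk.exists_trace`). As every trace is connected, the maximal traces are exactly the carriers of
walks.

Glueing schemes are the finite segments of walks in which symmetries relate only the end points; the
symmetries are the lattice translations and, for `λ = 1/2`, also the exchanges of coordinates. A
maximal segment cannot be prolonged, so each of its end points is related by a symmetry to an end
point. Either a symmetry shifts the walk along itself by the length of the segment, or exchanges
reflect the walk at both ends. In both cases the images of the segment cover the walk
(`IsMaxSegment.covered`), and since `π_{1/2}` is invariant under exchange, segment and walk have the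
same image. This gives (i); (ii) follows as there are only finitely many carriers of schemes, and
(iii) from compactness of the torus. -/

/-! ### Smooth division -/

open MeasureTheory Set in
/-- Smoothness of integrals depending on a parameter. -/
theorem contDiff_intervalIntegral_param {E : Type*} [NormedAddCommGroup E] [NormedSpace ℝ E]
    {h : E → ℝ → ℝ} (hh : ContDiff ℝ ∞ (fun p : E × ℝ => h p.1 p.2)) :
    ContDiff ℝ ∞ (fun p => ∫ y in (0 : ℝ)..1, h p y) := by
  -- The integral is the value at `0` of the convolution of the indicator of `[-1, 0]` with `b * h
  -- p`. The bump is `1` on `[-1, 1]`, so it does not change the integral, and it provides the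
  -- compact support.
  let b : ContDiffBump (0 : ℝ) := ⟨1, 2, one_pos, one_lt_two⟩
  let f : ℝ → ℝ := (Icc (-1 : ℝ) 0).indicator (fun _ => 1)
  let g : E → ℝ → ℝ := fun p x => b x * h p x
  have hg : ContDiff ℝ ∞ (fun q : E × ℝ => g q.1 q.2) :=
    (b.contDiff.comp contDiff_snd).mul hh
  have hf : LocallyIntegrable f volume :=
    (locallyIntegrable_const 1).indicator measurableSet_Icc
  have key := contDiffOn_convolution_right_with_param (n := ⊤) (μ := volume)
    (ContinuousLinearMap.mul ℝ ℝ) (g := g) (s := univ) (k := Metric.closedBall 0 2) isOpen_univ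
    (isCompact_closedBall _ _) (fun p x _ hx => by
      have : b x = 0 := b.zero_of_le_dist (not_le.1 hx).le
      simp [g, this]) hf hg.contDiffOn
  rw [univ_prod_univ, contDiffOn_univ] at key
  have key2 := key.comp (contDiff_id.prodMk (contDiff_const (c := (0 : ℝ))))
  convert key2 using 2 with p
  simp only [Function.comp, convolution, id, ContinuousLinearMap.mul_apply', f, g, zero_sub]
  have : ∀ t : ℝ, (Icc (-1 : ℝ) 0).indicator (fun _ => (1 : ℝ)) t * (b (-t) * h p (-t))
      = (Icc (-1 : ℝ) 0).indicator (fun t => h p (-t)) t := by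
    intro t
    by_cases ht : t ∈ Icc (-1 : ℝ) 0
    · have : b (-t) = 1 := b.one_of_mem_closedBall (by
        rw [mem_closedBall_zero_iff, norm_neg, Real.norm_eq_abs, abs_le]
        exact ⟨ht.1, ht.2.trans zero_le_one⟩)
      simp [ht, this]
    · simp [ht]
  simp_rw [this]
  rw [integral_indicator measurableSet_Icc, integral_Icc_eq_integral_Ioc,
    ← intervalIntegral.integral_of_le (by norm_num), intervalIntegral.integral_comp_neg]
  simp

/-- Hadamard's lemma with a parameter. -/
theorem exists_contDiff_eq_mul {G : ℝ × ℝ → ℝ} (hG : ContDiff ℝ ∞ G) (h0 : ∀ t, G (0, t) = 0) :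
    ∃ A : ℝ × ℝ → ℝ, ContDiff ℝ ∞ A ∧ ∀ x t, G (x, t) = x * A (x, t) := by
  let D : ℝ × ℝ → ℝ := fun p => fderiv ℝ G p (1, 0)
  have hD : ContDiff ℝ ∞ D :=
    (hG.fderiv_right (m := ∞) (by simp)).clm_apply contDiff_const
  -- Integrate `d/dy G (x y, t) = x ∂₁G (x y, t)` over `[0, 1]`.
  refine ⟨fun p => ∫ y in (0 : ℝ)..1, D (p.1 * y, p.2),
    contDiff_intervalIntegral_param (h := fun (p : ℝ × ℝ) y => D (p.1 * y, p.2)) (hD.comp (by fun_prop)), ?_⟩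
  intro x t
  have hder : ∀ y ∈ Set.uIcc (0 : ℝ) 1,
      HasDerivAt (fun y => G (x * y, t)) (x * D (x * y, t)) y := by
    intro y _
    have h1 : HasDerivAt (fun y : ℝ => (x * y, t)) (x, 0) y := by
      simpa using ((hasDerivAt_id y).const_mul x).prodMk (hasDerivAt_const y t)
    have h2 := ((hG.differentiable (by simp)) (x * y, t)).hasFDerivAt.comp_hasDerivAt y h1
    have : (x, (0 : ℝ)) = x • ((1 : ℝ), (0 : ℝ)) := by simp
    rw [this, map_smul] at h2
    exact h2
  have := intervalIntegral.integral_eq_sub_of_hasDerivAt hder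
    (Continuous.intervalIntegrable (by have := hD.continuous; fun_prop) _ _)
  rw [intervalIntegral.integral_const_mul] at this
  simp only [mul_one, mul_zero, h0, sub_zero] at this
  exact this.symm

theorem Real.exists_contDiff_sin_eq_mul : ∃ B : ℝ → ℝ, ContDiff ℝ ∞ B ∧ B 0 ≠ 0 ∧
    ∀ x, Real.sin x = x * B x := by
  obtain ⟨A, hA, h⟩ := exists_contDiff_eq_mul (G := fun p => Real.sin p.1)
    (Real.contDiff_sin.comp contDiff_fst) (by simp)
  have hB : ContDiff ℝ ∞ (fun x => A (x, 0)) := hA.comp (by fun_prop)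
  refine ⟨fun x => A (x, 0), hB, ?_, fun x => h x 0⟩
  have h1 : HasDerivAt (fun x => x * A (x, 0)) (1 * A (0, 0) + 0 * deriv (fun x => A (x, 0)) 0) 0 :=
    (hasDerivAt_id 0).mul (hB.differentiable (by simp) 0).hasDerivAt
  have h2 : (fun x => x * A (x, 0)) = Real.sin := funext fun x => (h x 0).symm
  rw [h2] at h1
  have := h1.unique (Real.hasDerivAt_sin 0)
  simp at this
  simp [this]

/-- A smooth function `G` that is `T`-periodic in the first variable and vanishes where the first
variable does is a smooth multiple of `sin (π x / T)`. -/
theorem exists_contDiff_eq_sin_mul {G : ℝ × ℝ → ℝ} {T : ℝ} (hT : 0 < T) (hG : ContDiff ℝ ∞ G)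
    (h0 : ∀ t, G (0, t) = 0) (hper : ∀ t, Function.Periodic (fun x => G (x, t)) T) :
    ∃ Q : ℝ × ℝ → ℝ, ContDiff ℝ ∞ Q ∧ ∀ x t, G (x, t) = Real.sin (Real.pi * x / T) * Q (x, t) := by
  obtain ⟨A, hA, hGA⟩ := exists_contDiff_eq_mul hG h0
  obtain ⟨B, hB, hB0, hsB⟩ := Real.exists_contDiff_sin_eq_mul
  have hpi := Real.pi_pos
  have hper' : ∀ (j : ℤ) x t, G (x - j * T, t) = G (x, t) := fun j x t => by
    simpa using (hper t).sub_zsmul_eq j (x := x)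
  have hsin : ∀ (j : ℤ) x, Real.sin (Real.pi * x / T) =
      (-1) ^ j * Real.sin (Real.pi * (x - j * T) / T) := fun j x => by
    have : Real.pi * x / T = Real.pi * (x - j * T) / T + j * Real.pi := by field_simp; ring
    rw [this, Real.sin_add_int_mul_pi]
  have hzero : ∀ x t, Real.sin (Real.pi * x / T) = 0 → G (x, t) = 0 := by
    intro x t h
    obtain ⟨n, hn⟩ := Real.sin_eq_zero_iff.1 h
    have : x - n * T = 0 := by field_simp at hn; linarith
    rw [← hper' n, this, h0]
  classical
  -- The quotient near the zero `j T`: there `G = (x - j T) A` by periodicity and `sin (π x / T) =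
  -- (-1) ^ j * (π (x - j T) / T) * B`, with `B ≠ 0`.
  let loc : ℤ → ℝ × ℝ → ℝ := fun j p =>
    (-1) ^ j * A (p.1 - j * T, p.2) * (T / Real.pi) / B (Real.pi * (p.1 - j * T) / T)
  let Q : ℝ × ℝ → ℝ := fun p => if Real.sin (Real.pi * p.1 / T) = 0 then loc (round (p.1 / T)) p
    else G p / Real.sin (Real.pi * p.1 / T)
  refine ⟨Q, ?_, ?_⟩
  · rw [contDiff_iff_contDiffAt]
    rintro ⟨x, t⟩
    by_cases h : Real.sin (Real.pi * x / T) = 0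
    · obtain ⟨n, hn⟩ := Real.sin_eq_zero_iff.1 h
      have hx : x = n * T := by field_simp at hn; linarith
      have hBx : B (Real.pi * (x - n * T) / T) ≠ 0 := by simpa [hx] using hB0
      have hloc : ContDiffAt ℝ ∞ (loc n) (x, t) := by
        refine ContDiffAt.div (ContDiff.contDiffAt ?_) (ContDiff.contDiffAt ?_) hBx
        · exact (contDiff_const.mul (hA.comp (by fun_prop))).mul contDiff_const
        · exact hB.comp (by fun_prop)
      refine hloc.congr_of_eventuallyEq ?_
      have e1 : ∀ᶠ p : ℝ × ℝ in nhds (x, t), B (Real.pi * (p.1 - n * T) / T) ≠ 0 := by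
        have hc : Continuous fun p : ℝ × ℝ => B (Real.pi * (p.1 - n * T) / T) :=
          hB.continuous.comp (by fun_prop)
        exact hc.continuousAt.eventually_ne hBx
      have e2 : ∀ᶠ p : ℝ × ℝ in nhds (x, t), |p.1 / T - n| < 1 / 2 := by
        have hc : Continuous fun p : ℝ × ℝ => |p.1 / T - n| := by fun_prop
        refine hc.continuousAt.eventually_lt continuousAt_const ?_
        simp [hx, hT.ne']
      filter_upwards [e1, e2] with p hp1 hp2
      have hr : round (p.1 / T) = n := by
        rw [round_eq, Int.floor_eq_iff]
        rw [abs_lt] at hp2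
        constructor <;> linarith
      simp only [Q]
      split_ifs with hs
      · rw [hr]
      · have hsp := hsin n p.1
        rw [hsB (Real.pi * (p.1 - n * T) / T)] at hsp
        have hg : G p = (p.1 - n * T) * A (p.1 - n * T, p.2) := by
          rw [← hGA, hper']
        have hpos : p.1 - n * T ≠ 0 := by
          intro h; apply hs; rw [hsp, h]; simp
        simp only [loc]
        rw [hsp, hg]
        rcases Int.even_or_odd n with h | h <;> rw [h.neg_one_zpow (α := ℝ)] <;> field_simp
    · have : ContDiffAt ℝ ∞ (fun p : ℝ × ℝ => G p / Real.sin (Real.pi * p.1 / T)) (x, t) :=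
        hG.contDiffAt.div (Real.contDiff_sin.comp (by fun_prop)).contDiffAt h
      refine this.congr_of_eventuallyEq ?_
      have e1 : ∀ᶠ p : ℝ × ℝ in nhds (x, t), Real.sin (Real.pi * p.1 / T) ≠ 0 := by
        have hc : Continuous fun p : ℝ × ℝ => Real.sin (Real.pi * p.1 / T) := by fun_prop
        exact hc.continuousAt.eventually_ne h
      filter_upwards [e1] with p hp
      simp [Q, hp]
  · intro x t
    by_cases h : Real.sin (Real.pi * x / T) = 0
    · rw [h, zero_mul, hzero x t h]
    · simp only [Q, h, if_false]
      field_simp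

/-! ### Ordinary differential equations -/

open Set in
/-- A bounded Lipschitz vector field has global integral curves. -/
theorem exists_forall_hasDerivAt_of_bounded_lipschitz {E : Type*} [NormedAddCommGroup E]
    [NormedSpace ℝ E] [CompleteSpace E] {V : E → E} {K L : NNReal} (hK : LipschitzWith K V)
    (hL : ∀ x, ‖V x‖ ≤ L) (x₀ : E) :
    ∃ γ : ℝ → E, γ 0 = x₀ ∧ ∀ t, HasDerivAt γ (V (γ t)) t := by
  have h1 : ∀ n : ℕ, ∃ α : ℝ → E, α 0 = x₀ ∧
      ∀ t ∈ Ioo (-((n : ℝ) + 1)) (n + 1), HasDerivAt α (V (α t)) t := by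
    intro n
    have hn : (0 : ℝ) ∈ Icc (-((n : ℝ) + 1)) (n + 1) := by constructor <;> linarith [n.cast_nonneg (α := ℝ)]
    -- A field bounded by `L` cannot leave the ball of radius `L (n + 1)` within time `n + 1`.
    have := IsPicardLindelof.of_time_independent (f := V) (t₀ := ⟨0, hn⟩) (x₀ := x₀)
      (a := L * (n + 1)) (r := 0) (L := L) (K := K) (fun x _ => hL x) hK.lipschitzOnWith (by simp)
    obtain ⟨α, h0, hα⟩ := this.exists_eq_forall_mem_Icc_hasDerivWithinAt₀
    exact ⟨α, h0, fun t ht => (hα t (Ioo_subset_Icc_self ht)).hasDerivAt (Icc_mem_nhds ht.1 ht.2)⟩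
  choose α h0 hα using h1
  have huniq : ∀ m n : ℕ, m ≤ n → EqOn (α m) (α n) (Ioo (-((m : ℝ) + 1)) (m + 1)) := by
    intro m n hmn
    have hmn' : (m : ℝ) ≤ n := by exact_mod_cast hmn
    refine ODE_solution_unique_of_mem_Ioo (v := fun _ => V) (s := fun _ => univ) (t₀ := 0)
      (fun _ _ => hK.lipschitzOnWith) ?_ (fun t ht => ⟨hα m t ht, mem_univ _⟩)
      (fun t ht => ⟨hα n t ⟨by linarith [ht.1], by linarith [ht.2]⟩, mem_univ _⟩)
      ((h0 m).trans (h0 n).symm)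
    constructor <;> linarith [m.cast_nonneg (α := ℝ)]
  have huniq' : ∀ (m n : ℕ) (t : ℝ), |t| < m + 1 → |t| < n + 1 → α m t = α n t := by
    intro m n t hm hn
    rcases le_total m n with h | h
    · exact huniq m n h (abs_lt.1 hm)
    · exact (huniq n m h (abs_lt.1 hn)).symm
  refine ⟨fun t => α ⌈|t|⌉₊ t, h0 _, fun t => ?_⟩
  have hlt : ∀ u : ℝ, |u| < (⌈|u|⌉₊ : ℝ) + 1 := fun u => (Nat.le_ceil _).trans_lt (lt_add_one _)
  have := hα _ t (abs_lt.1 (hlt t))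
  refine this.congr_of_eventuallyEq ?_
  have e : ∀ᶠ u : ℝ in nhds t, |u| < (⌈|t|⌉₊ : ℝ) + 1 :=
    continuous_abs.continuousAt.eventually_lt continuousAt_const (hlt t)
  filter_upwards [e] with u hu
  exact huniq' _ _ u (hlt u) hu

/-- An integral curve of a smooth vector field is smooth. -/
theorem contDiff_of_forall_hasDerivAt {E : Type*} [NormedAddCommGroup E] [NormedSpace ℝ E]
    {V : E → E} (hV : ContDiff ℝ ∞ V) {γ : ℝ → E} (hγ : ∀ t, HasDerivAt γ (V (γ t)) t) :
    ContDiff ℝ ∞ γ := by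
  have hd : Differentiable ℝ γ := fun t => (hγ t).differentiableAt
  have hder : deriv γ = V ∘ γ := funext fun t => (hγ t).deriv
  rw [contDiff_infty]
  intro n
  induction n with
  | zero => exact_mod_cast contDiff_zero.2 hd.continuous
  | succ n ih =>
    rw [show ((n + 1 : ℕ) : WithTop ℕ∞) = (n : WithTop ℕ∞) + 1 by simp, contDiff_succ_iff_deriv]
    refine ⟨hd, by simp, ?_⟩
    rw [hder]
    exact (contDiff_infty.1 hV n).comp ih

open Set Filter Topology in
/-- A function on `ℝ` whose zeros are at most of second order has finitely many zeros in a compact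
interval. -/
theorem finite_zeros_of_deriv_deriv_ne_zero {h : ℝ → ℝ} (hh : ContDiff ℝ ∞ h)
    (hne : ∀ s, h s = 0 → deriv h s = 0 → deriv (deriv h) s ≠ 0) (a b : ℝ) :
    {s ∈ Icc a b | h s = 0}.Finite := by
  by_contra hinf
  obtain ⟨x, -, hx⟩ := Set.Infinite.exists_accPt_of_subset_isCompact hinf isCompact_Icc
    (fun s hs => hs.1)
  have hfr : ∃ᶠ y in 𝓝[≠] x, h y = 0 :=
    (accPt_iff_frequently_nhdsNE.1 hx).mono fun y hy => hy.2
  have hd : Differentiable ℝ h := hh.differentiable (by simp)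
  have hd2 : Differentiable ℝ (deriv h) :=
    (contDiff_infty_iff_deriv.1 hh).2.differentiable (by simp)
  have hx0 : h x = 0 := by
    have : ∃ᶠ y in 𝓝 x, h y = 0 := hfr.filter_mono nhdsWithin_le_nhds
    exact (isClosed_singleton.preimage hh.continuous).mem_of_frequently_of_tendsto this tendsto_id
  -- At an accumulation point `x` of zeros also `h' x = 0`. As `h'' x ≠ 0`, `h'` has no other zero
  -- near `x`, but Rolle's theorem gives one between `x` and a nearby zero of `h`.
  by_cases h1 : deriv h x = 0
  · have h2 := hne x hx0 h1
    have hev : ∀ᶠ y in 𝓝[≠] x, deriv h y ≠ 0 := by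
      have := (hd2 x).hasDerivAt.eventually_ne (c := 0) h2
      exact this
    rw [eventually_nhdsWithin_iff, Metric.eventually_nhds_iff_ball] at hev
    obtain ⟨ε, hε, hball⟩ := hev
    have hev2 : ∀ᶠ y in 𝓝[≠] x, y ∈ Metric.ball x ε :=
      nhdsWithin_le_nhds (Metric.ball_mem_nhds x hε)
    obtain ⟨y, hy0, hyb, hyx⟩ := (hfr.and_eventually (hev2.and self_mem_nhdsWithin)).exists
    rw [Real.ball_eq_Ioo] at *
    rcases lt_or_gt_of_ne (hyx : y ≠ x) with hlt | hlt
    · obtain ⟨c, hc, hc0⟩ := exists_deriv_eq_zero hlt hh.continuous.continuousOn (hy0.trans hx0.symm)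
      exact hball c ⟨hyb.1.trans hc.1, by linarith [hc.2]⟩ hc.2.ne hc0
    · obtain ⟨c, hc, hc0⟩ := exists_deriv_eq_zero hlt hh.continuous.continuousOn (hx0.trans hy0.symm)
      exact hball c ⟨by linarith [hc.1], hc.2.trans hyb.2⟩ hc.1.ne' hc0
  · have := (hd x).hasDerivAt.eventually_ne (c := 0) h1
    exact hfr this

/-! ### Gaps of subsets of the line -/

/-- `x` and `y` are different points of `Λ` with no point of `Λ` strictly between them. -/
def IsGap (Λ : Set ℝ) (x y : ℝ) : Prop :=
  x ∈ Λ ∧ y ∈ Λ ∧ x ≠ y ∧ ∀ z ∈ Set.uIoo x y, z ∉ Λ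

namespace IsGap

variable {Λ : Set ℝ} {x y x' y' z : ℝ}

theorem symm (h : IsGap Λ x y) : IsGap Λ y x :=
  ⟨h.2.1, h.1, h.2.2.1.symm, fun z hz => h.2.2.2 z (by rwa [Set.uIoo_comm])⟩

theorem notMem_of_lt (h : IsGap Λ x y) (h1 : x < z) (h2 : z < y) : z ∉ Λ :=
  h.2.2.2 z (by rw [Set.uIoo_of_lt (h1.trans h2)]; exact ⟨h1, h2⟩)

theorem notMem_of_gt (h : IsGap Λ x y) (h1 : z < x) (h2 : y < z) : z ∉ Λ :=
  h.symm.notMem_of_lt h2 h1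

theorem eq_of_lt (h : IsGap Λ x y) (h' : IsGap Λ x y') (hy : x < y) (hy' : x < y') : y = y' := by
  rcases lt_trichotomy y y' with h1 | h1 | h1
  · exact absurd h.2.1 (h'.notMem_of_lt hy h1)
  · exact h1
  · exact absurd h'.2.1 (h.notMem_of_lt hy' h1)

theorem eq_of_gt (h : IsGap Λ x y) (h' : IsGap Λ x y') (hy : y < x) (hy' : y' < x) : y = y' := by
  rcases lt_trichotomy y y' with h1 | h1 | h1
  · exact absurd h'.2.1 (h.notMem_of_gt hy' h1)
  · exact h1
  · exact absurd h.2.1 (h'.notMem_of_gt hy h1)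

theorem eq_of_lt_iff (h : IsGap Λ x y) (h' : IsGap Λ x y') (hd : x < y ↔ x < y') : y = y' := by
  rcases lt_or_gt_of_ne h.2.2.1 with h1 | h1
  · exact h.eq_of_lt h' h1 (hd.1 h1)
  · refine h.eq_of_gt h' h1 (lt_of_le_of_ne (not_lt.1 fun h2 => ?_) h'.2.2.1.symm)
    exact lt_asymm h1 (hd.2 h2)

theorem eq_or_eq_of_mem (h : IsGap Λ x y) (h' : IsGap Λ x' y') (hz : z ∈ Set.uIoo x y)
    (hz' : z ∈ Set.uIoo x' y') : (x' = x ∧ y' = y) ∨ (x' = y ∧ y' = x) := by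
  wlog hxy : x < y generalizing x y
  · rcases this h.symm (by rwa [Set.uIoo_comm])
      (lt_of_le_of_ne (not_lt.1 hxy) h.2.2.1.symm) with h | h
    · exact Or.inr h
    · exact Or.inl h
  wlog hxy' : x' < y' generalizing x' y'
  · rcases this h'.symm (by rwa [Set.uIoo_comm])
      (lt_of_le_of_ne (not_lt.1 hxy') h'.2.2.1.symm) with h | h
    · exact Or.inr ⟨h.2, h.1⟩
    · exact Or.inl ⟨h.2, h.1⟩
  rw [Set.uIoo_of_lt hxy] at hz
  rw [Set.uIoo_of_lt hxy'] at hz'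
  left
  constructor
  · rcases lt_trichotomy x x' with h1 | h1 | h1
    · exact absurd h'.1 (h.notMem_of_lt h1 (hz'.1.trans hz.2))
    · exact h1.symm
    · exact absurd h.1 (h'.notMem_of_lt h1 (hz.1.trans hz'.2))
  · rcases lt_trichotomy y y' with h1 | h1 | h1
    · exact absurd h.2.1 (h'.notMem_of_lt (hz'.1.trans hz.2) h1)
    · exact h1.symm
    · exact absurd h'.2.1 (h.notMem_of_lt (hz.1.trans hz'.2) h1)

theorem add (h : IsGap Λ x y) {c : ℝ} (hc : ∀ z, z + c ∈ Λ ↔ z ∈ Λ) :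
    IsGap Λ (x + c) (y + c) := by
  refine ⟨(hc _).2 h.1, (hc _).2 h.2.1, fun e => h.2.2.1 (add_right_cancel e), fun z hz => ?_⟩
  have := h.2.2.2 (z - c) ?_
  · rwa [← hc, sub_add_cancel] at this
  · rw [Set.uIoo, Set.mem_Ioo, inf_lt_iff, lt_sup_iff] at hz ⊢
    simpa only [lt_sub_iff_add_lt, sub_lt_iff_lt_add] using hz

theorem abs_sub_le (h : IsGap Λ x y) {c : ℝ} (hc0 : 0 < c) (hc : ∀ z, z + c ∈ Λ ↔ z ∈ Λ) :
    |y - x| ≤ c := by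
  rcases lt_or_gt_of_ne h.2.2.1 with h1 | h1
  · rw [abs_of_pos (sub_pos.2 h1)]
    by_contra! h2
    exact h.notMem_of_lt (z := x + c) (by linarith) (by linarith) ((hc _).2 h.1)
  · rw [abs_of_neg (sub_neg.2 h1)]
    by_contra! h2
    exact h.symm.notMem_of_lt (z := y + c) (by linarith) (by linarith) ((hc _).2 h.2.1)

end IsGap

theorem exists_isGap_lt {Λ : Set ℝ} {x c : ℝ} (hx : x ∈ Λ) (hfin : ∀ a b, (Λ ∩ Set.Icc a b).Finite)
    (hc0 : 0 < c) (hc : ∀ z, z + c ∈ Λ ↔ z ∈ Λ) : ∃ y, x < y ∧ IsGap Λ x y := by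
  have hf : (Λ ∩ Set.Ioc x (x + c)).Finite :=
    (hfin x (x + c)).subset (Set.inter_subset_inter_right _ Set.Ioc_subset_Icc_self)
  obtain ⟨y, hy, hmin⟩ := Set.exists_min_image _ id hf
    ⟨x + c, (hc x).2 hx, by constructor <;> linarith⟩
  refine ⟨y, hy.2.1, hx, hy.1, hy.2.1.ne, fun z hz hzΛ => ?_⟩
  rw [Set.uIoo_of_lt hy.2.1] at hz
  exact absurd (hmin z ⟨hzΛ, hz.1, hz.2.le.trans hy.2.2⟩) (not_le.2 hz.2)

theorem exists_isGap_gt {Λ : Set ℝ} {x c : ℝ} (hx : x ∈ Λ) (hfin : ∀ a b, (Λ ∩ Set.Icc a b).Finite)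
    (hc0 : 0 < c) (hc : ∀ z, z + c ∈ Λ ↔ z ∈ Λ) : ∃ y, y < x ∧ IsGap Λ x y := by
  have hf : (Λ ∩ Set.Ico (x - c) x).Finite :=
    (hfin (x - c) x).subset (Set.inter_subset_inter_right _ Set.Ico_subset_Icc_self)
  obtain ⟨y, hy, hmax⟩ := Set.exists_max_image _ id hf
    ⟨x - c, (hc _).1 (by simpa using hx), by constructor <;> linarith⟩
  refine ⟨y, hy.2.2, hx, hy.1, hy.2.2.ne', fun z hz hzΛ => ?_⟩
  rw [Set.uIoo_of_gt hy.2.2] at hz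
  exact absurd (hmax z ⟨hzΛ, hy.2.1.trans hz.1.le, hz.2⟩) (not_le.2 hz.1)

/-- The interval `(x, y)` around a point outside a closed discrete periodic set. -/
theorem exists_isGap_mem {Λ : Set ℝ} {z c : ℝ} (hz : z ∉ Λ) (hne : Λ.Nonempty)
    (hfin : ∀ a b, (Λ ∩ Set.Icc a b).Finite)
    (hc0 : 0 < c) (hc : ∀ z, z + c ∈ Λ ↔ z ∈ Λ) : ∃ x y, x < z ∧ z < y ∧ IsGap Λ x y := by
  obtain ⟨p, hp⟩ := hne
  have hper : ∀ (n : ℤ), p + n * c ∈ Λ := by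
    intro n
    induction n with
    | zero => simpa using hp
    | succ n ih => rw [← hc] at ih; convert ih using 1; push_cast; ring
    | pred n ih => rw [← hc]; convert ih using 1; push_cast; ring
  have hlow : ∃ q ∈ Λ, q < z := by
    obtain ⟨n, hn⟩ := exists_int_lt ((z - p) / c)
    exact ⟨_, hper n, by rw [lt_div_iff₀ hc0] at hn; linarith⟩
  obtain ⟨q, hq, hqz⟩ := hlow
  obtain ⟨x, hx, hmax⟩ := Set.exists_max_image _ id (hfin q z) ⟨q, hq, le_rfl, hqz.le⟩
  have hxz : x < z := lt_of_le_of_ne hx.2.2 fun h => hz (h ▸ hx.1)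
  obtain ⟨y, hxy, hgap⟩ := exists_isGap_lt hx.1 hfin hc0 hc
  refine ⟨x, y, hxz, ?_, hgap⟩
  by_contra! hyz
  exact absurd (hmax y ⟨hgap.2.1, hx.2.1.trans hxy.le, hyz⟩) (not_le.2 hxy)

/-! ### Angle functions -/

/-- A lift `θ` of the angle function of a generic closed curve: a Morse function with
`θ (s + T) = θ s + rot * π`, whose critical values at different critical points are different
modulo `π`. -/
structure AngleFunction (T : ℝ) where
  θ : ℝ → ℝ
  rot : ℤ
  even_rot : Even rot
  T_pos : 0 < T
  smooth : ContDiff ℝ ∞ θ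
  shift : ∀ s, θ (s + T) = θ s + rot * Real.pi
  morse : ∀ s, deriv θ s = 0 → deriv (deriv θ) s ≠ 0
  inj : ∀ s t, deriv θ s = 0 → deriv θ t = 0 → (∃ k : ℤ, θ t = θ s + k * Real.pi) →
    ∃ n : ℤ, t = s + n * T

namespace AngleFunction

variable {T : ℝ} (A : AngleFunction T)

theorem differentiable : Differentiable ℝ A.θ := A.smooth.differentiable (by simp)

theorem smooth_deriv : ContDiff ℝ ∞ (deriv A.θ) := (contDiff_infty_iff_deriv.1 A.smooth).2

theorem shift_int (n : ℤ) (s : ℝ) : A.θ (s + n * T) = A.θ s + (n * A.rot : ℤ) * Real.pi := by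
  induction n with
  | zero => simp
  | succ n ih =>
    have := A.shift (s + n * T)
    push_cast at *
    rw [show s + (n + 1) * T = s + n * T + T by ring, this, ih]; ring
  | pred n ih =>
    have := A.shift (s + (-n - 1 : ℤ) * T)
    push_cast at *
    rw [show s + (-(n : ℝ) - 1) * T + T = s + -n * T by ring, ih] at this
    linarith

theorem deriv_shift (n : ℤ) (s : ℝ) : deriv A.θ (s + n * T) = deriv A.θ s := by
  rw [← deriv_comp_add_const]
  have : (fun x => A.θ (x + n * T)) = fun x => A.θ x + (n * A.rot : ℤ) * Real.pi :=
    funext fun x => A.shift_int n x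
  rw [this, deriv_add_const]

/-- The critical values, modulo `π`. -/
def critValues : Set ℝ := {x | ∃ s, ∃ k : ℤ, deriv A.θ s = 0 ∧ x = A.θ s + k * Real.pi}

open Classical in
/-- The critical values modulo `π` or, if there are none, the multiples of `π`. -/
def marks : Set ℝ :=
  if A.critValues.Nonempty then A.critValues else {x | ∃ k : ℤ, x = A.θ 0 + k * Real.pi}

/-- The parameters with marked values. -/
def points : Set ℝ := {s | A.θ s ∈ A.marks}

theorem marks_add_int (k : ℤ) (x : ℝ) : x + k * Real.pi ∈ A.marks ↔ x ∈ A.marks := by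
  unfold marks critValues
  split_ifs
  · constructor
    · rintro ⟨s, l, hs, h⟩
      exact ⟨s, l - k, hs, by push_cast; linarith⟩
    · rintro ⟨s, l, hs, h⟩
      exact ⟨s, l + k, hs, by push_cast; linarith⟩
  · constructor
    · rintro ⟨l, h⟩
      exact ⟨l - k, by push_cast; linarith⟩
    · rintro ⟨l, h⟩
      exact ⟨l + k, by push_cast; linarith⟩

theorem marks_add (x : ℝ) : x + Real.pi ∈ A.marks ↔ x ∈ A.marks := by
  simpa using A.marks_add_int 1 x

theorem points_add_int (n : ℤ) (s : ℝ) : s + n * T ∈ A.points ↔ s ∈ A.points := by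
  unfold points
  rw [Set.mem_ofPred_eq, shift_int, marks_add_int]; rfl

theorem points_add (s : ℝ) : s + T ∈ A.points ↔ s ∈ A.points := by
  simpa using A.points_add_int 1 s

theorem mem_points_of_deriv_eq_zero {s : ℝ} (h : deriv A.θ s = 0) : s ∈ A.points := by
  have : A.θ s ∈ A.critValues := ⟨s, 0, h, by simp⟩
  unfold points marks
  rw [Set.mem_ofPred_eq, if_pos ⟨_, this⟩]
  exact this

theorem points_nonempty : A.points.Nonempty := by
  by_cases h : A.critValues.Nonempty
  · obtain ⟨x, s, k, hs, -⟩ := h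
    exact ⟨s, A.mem_points_of_deriv_eq_zero hs⟩
  · refine ⟨0, ?_⟩
    unfold points marks
    rw [Set.mem_ofPred_eq, if_neg h]
    exact ⟨0, by simp⟩

/-- The level set modulo `π` is the zero set of `sin (θ - c)`. The cosine does not vanish there, so
the Morse condition bounds the order of the zeros by two. -/
theorem finite_level (c a b : ℝ) :
    {s ∈ Set.Icc a b | ∃ k : ℤ, A.θ s = c + k * Real.pi}.Finite := by
  have hsm : ContDiff ℝ ∞ fun s => Real.sin (A.θ s - c) :=
    Real.contDiff_sin.comp (A.smooth.sub contDiff_const)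
  have hd : deriv (fun s => Real.sin (A.θ s - c)) = fun s => Real.cos (A.θ s - c) * deriv A.θ s := by
    funext s
    exact ((A.differentiable s).hasDerivAt.sub_const c).sin.deriv
  refine (finite_zeros_of_deriv_deriv_ne_zero hsm ?_ a b).subset ?_
  · intro s h0 h1
    rw [hd] at h1 ⊢
    have hcos : Real.cos (A.θ s - c) ≠ 0 := by
      intro h
      have := Real.sin_sq_add_cos_sq (A.θ s - c)
      rw [h0, h] at this
      norm_num at this
    have h1' : deriv A.θ s = 0 := (mul_eq_zero.1 h1).resolve_left hcos
    have := (((A.differentiable s).hasDerivAt.sub_const c).cos).mul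
      (A.smooth_deriv.differentiable (by simp) s).hasDerivAt
    have e := this.deriv
    change deriv (fun s => Real.cos (A.θ s - c) * deriv A.θ s) s = _ at e
    rw [e, h1']
    simpa using ⟨hcos, A.morse s h1'⟩
  · rintro s ⟨hs, k, hk⟩
    refine ⟨hs, ?_⟩
    rw [hk, add_sub_cancel_left, Real.sin_int_mul_pi]

theorem finite_crit (a b : ℝ) : {s ∈ Set.Icc a b | deriv A.θ s = 0}.Finite :=
  finite_zeros_of_deriv_deriv_ne_zero A.smooth_deriv (fun s h h' => absurd h' (A.morse s h)) a b

theorem exists_int_add_mem {T : ℝ} (A : AngleFunction T) (s : ℝ) : ∃ n : ℤ, s + n * T ∈ Set.Icc 0 T := by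
  refine ⟨-⌊s / T⌋, ?_⟩
  have h1 := Int.floor_le (s / T)
  have h2 := Int.lt_floor_add_one (s / T)
  rw [le_div_iff₀ A.T_pos] at h1
  rw [div_lt_iff₀ A.T_pos] at h2
  push_cast
  constructor <;> linarith

theorem finite_points (a b : ℝ) : (A.points ∩ Set.Icc a b).Finite := by
  by_cases h : A.critValues.Nonempty
  · refine ((A.finite_crit 0 T).biUnion fun s _ => A.finite_level (A.θ s) a b).subset ?_
    rintro t ⟨ht, hab⟩
    unfold points marks at ht
    rw [Set.mem_ofPred_eq, if_pos h] at ht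
    obtain ⟨s, k, hs, hk⟩ := ht
    obtain ⟨n, hn⟩ := A.exists_int_add_mem s
    refine Set.mem_biUnion (x := s + n * T) ⟨hn, by rwa [deriv_shift]⟩ ⟨hab, k - n * A.rot, ?_⟩
    rw [shift_int, hk]
    push_cast
    ring
  · refine (A.finite_level (A.θ 0) a b).subset ?_
    rintro t ⟨ht, hab⟩
    unfold points marks at ht
    rw [Set.mem_ofPred_eq, if_neg h] at ht
    exact ⟨hab, ht⟩

/-! ### Arcs -/

/-- `u` and `v` are consecutive marked parameters, in either order. -/
def Arc (u v : ℝ) : Prop := IsGap A.points u v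

variable {A} {u v u' v' : ℝ}

theorem Arc.symm (h : A.Arc u v) : A.Arc v u := IsGap.symm h

theorem Arc.shift (h : A.Arc u v) (n : ℤ) : A.Arc (u + n * T) (v + n * T) :=
  IsGap.add h (A.points_add_int n)

theorem Arc.deriv_ne_zero (h : A.Arc u v) {s : ℝ} (hs : s ∈ Set.uIoo u v) : deriv A.θ s ≠ 0 :=
  fun h0 => h.2.2.2 s hs (A.mem_points_of_deriv_eq_zero h0)

theorem strictMonoOn_or_strictAntiOn {a b : ℝ} (h : ∀ s ∈ Set.Ioo a b, deriv A.θ s ≠ 0) :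
    StrictMonoOn A.θ (Set.Icc a b) ∨ StrictAntiOn A.θ (Set.Icc a b) := by
  have hc := A.smooth_deriv.continuous
  have key : (∀ s ∈ Set.Ioo a b, 0 < deriv A.θ s) ∨ (∀ s ∈ Set.Ioo a b, deriv A.θ s < 0) := by
    by_contra! hcon
    obtain ⟨⟨s, hs, h1⟩, t, ht, h2⟩ := hcon
    obtain ⟨x, hx, h0⟩ := isPreconnected_Ioo.intermediate_value hs ht hc.continuousOn ⟨h1, h2⟩
    exact h x hx h0
  rcases key with h | h
  · exact Or.inl (strictMonoOn_of_deriv_pos (convex_Icc a b) A.smooth.continuous.continuousOn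
      (by rwa [interior_Icc]))
  · exact Or.inr (strictAntiOn_of_deriv_neg (convex_Icc a b) A.smooth.continuous.continuousOn
      (by rwa [interior_Icc]))

theorem Arc.injOn (h : A.Arc u v) : Set.InjOn A.θ (Set.uIcc u v) := by
  rcases strictMonoOn_or_strictAntiOn (A := A) (a := min u v) (b := max u v)
    (fun s hs => h.deriv_ne_zero hs) with h | h
  · exact h.injOn
  · exact h.injOn

theorem Arc.ne (h : A.Arc u v) : A.θ u ≠ A.θ v := fun e =>
  h.2.2.1 (h.injOn Set.left_mem_uIcc Set.right_mem_uIcc e)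

theorem Arc.image_uIoo (h : A.Arc u v) : A.θ '' Set.uIoo u v = Set.uIoo (A.θ u) (A.θ v) := by
  wlog huv : u < v generalizing u v
  · have := this h.symm (lt_of_le_of_ne (not_lt.1 huv) h.2.2.1.symm)
    rwa [Set.uIoo_comm, Set.uIoo_comm (A.θ v)] at this
  rw [Set.uIoo_of_lt huv]
  have hm := strictMonoOn_or_strictAntiOn (A := A) (a := u) (b := v)
    (fun s hs => h.deriv_ne_zero (by rwa [Set.uIoo_of_lt huv]))
  have hl : u ∈ Set.Icc u v := Set.left_mem_Icc.2 huv.le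
  have hr : v ∈ Set.Icc u v := Set.right_mem_Icc.2 huv.le
  rcases hm with hm | hm
  · rw [Set.uIoo_of_lt (hm hl hr huv)]
    refine subset_antisymm ?_ (intermediate_value_Ioo huv.le A.smooth.continuous.continuousOn)
    rintro _ ⟨s, hs, rfl⟩
    exact ⟨hm hl (Set.Ioo_subset_Icc_self hs) hs.1, hm (Set.Ioo_subset_Icc_self hs) hr hs.2⟩
  · rw [Set.uIoo_of_gt (hm hl hr huv)]
    refine subset_antisymm ?_ (intermediate_value_Ioo' huv.le A.smooth.continuous.continuousOn)
    rintro _ ⟨s, hs, rfl⟩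
    exact ⟨hm (Set.Ioo_subset_Icc_self hs) hr hs.2, hm hl (Set.Ioo_subset_Icc_self hs) hs.1⟩

/-- This reduces the comparison of arcs at different parallel points to the gaps of one set of real
numbers, which is invariant under translation by `π`. -/
theorem Arc.isGap (h : A.Arc u v) : IsGap A.marks (A.θ u) (A.θ v) := by
  refine ⟨h.1, h.2.1, h.ne, fun z hz => ?_⟩
  rw [← h.image_uIoo] at hz
  obtain ⟨s, hs, rfl⟩ := hz
  exact h.2.2.2 s hs

theorem exists_arc_lt (hu : u ∈ A.points) : ∃ v, u < v ∧ A.Arc u v :=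
  exists_isGap_lt hu A.finite_points A.T_pos A.points_add

theorem exists_arc_gt (hu : u ∈ A.points) : ∃ v, v < u ∧ A.Arc u v :=
  exists_isGap_gt hu A.finite_points A.T_pos A.points_add

theorem exists_arc_mem {s : ℝ} (hs : s ∉ A.points) : ∃ u v, u < s ∧ s < v ∧ A.Arc u v :=
  exists_isGap_mem hs A.points_nonempty A.finite_points A.T_pos A.points_add

/-- The angle function goes to different sides of its value at a marked point on the two arcs from
that point, except at the critical points. -/
theorem lt_iff_lt_iff_deriv_eq_zero (h : A.Arc u v) (h' : A.Arc u v') (hv : u < v) (hv' : v' < u) :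
    (A.θ u < A.θ v ↔ A.θ u < A.θ v') ↔ deriv A.θ u = 0 := by
  constructor
  · intro hiff
    by_contra h0
    have hm := strictMonoOn_or_strictAntiOn (A := A) (a := v') (b := v) (fun s hs => by
      rcases lt_trichotomy s u with hlt | rfl | hlt
      · exact h'.deriv_ne_zero (by rw [Set.uIoo_of_gt hv']; exact ⟨hs.1, hlt⟩)
      · exact h0
      · exact h.deriv_ne_zero (by rw [Set.uIoo_of_lt hv]; exact ⟨hlt, hs.2⟩))
    have m1 : u ∈ Set.Icc v' v := ⟨hv'.le, hv.le⟩
    have m2 : v ∈ Set.Icc v' v := ⟨(hv'.trans hv).le, le_rfl⟩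
    have m3 : v' ∈ Set.Icc v' v := ⟨le_rfl, (hv'.trans hv).le⟩
    rcases hm with hm | hm
    · exact lt_asymm (hm m3 m1 hv') (hiff.1 (hm m1 m2 hv))
    · exact lt_asymm (hm m1 m2 hv) (hiff.2 (hm m3 m1 hv'))
  · intro h0
    have hm1 := strictMonoOn_or_strictAntiOn (A := A) (a := v') (b := u) (fun s hs =>
      h'.deriv_ne_zero (by rwa [Set.uIoo_of_gt hv']))
    have hm2 := strictMonoOn_or_strictAntiOn (A := A) (a := u) (b := v) (fun s hs =>
      h.deriv_ne_zero (by rwa [Set.uIoo_of_lt hv]))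
    have l1 : v' ∈ Set.Icc v' u := ⟨le_rfl, hv'.le⟩
    have l2 : u ∈ Set.Icc v' u := ⟨hv'.le, le_rfl⟩
    have r1 : u ∈ Set.Icc u v := ⟨le_rfl, hv.le⟩
    have r2 : v ∈ Set.Icc u v := ⟨hv.le, le_rfl⟩
    rcases hm1 with hm1 | hm1 <;> rcases hm2 with hm2 | hm2
    -- If `θ` were monotone through the critical point `u`, then `u` would be an extremum of `θ'`,
    -- so `θ'' u = 0`.
    · exfalso
      have : StrictMonoOn A.θ (Set.Icc v' v) := by
        rw [← Set.Icc_union_Icc_eq_Icc hv'.le hv.le]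
        exact hm1.union hm2 ⟨l2, fun x hx => hx.2⟩ ⟨r1, fun x hx => hx.1⟩
      have hmin : IsLocalMin (deriv A.θ) u := by
        filter_upwards [Ioo_mem_nhds hv' hv] with s hs
        rw [h0]
        exact (this.monotoneOn.mono Set.Ioo_subset_Icc_self).derivWithin_nonneg.trans_eq
          (derivWithin_of_isOpen isOpen_Ioo hs)
      exact A.morse u h0 hmin.deriv_eq_zero
    · exact iff_of_false (not_lt.2 (hm2 r1 r2 hv).le) (not_lt.2 (hm1 l1 l2 hv').le)
    · exact iff_of_true (hm2 r1 r2 hv) (hm1 l1 l2 hv')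
    · exfalso
      have : StrictAntiOn A.θ (Set.Icc v' v) := by
        rw [← Set.Icc_union_Icc_eq_Icc hv'.le hv.le]
        exact hm1.union hm2 ⟨l2, fun x hx => hx.2⟩ ⟨r1, fun x hx => hx.1⟩
      have hmax : IsLocalMax (deriv A.θ) u := by
        filter_upwards [Ioo_mem_nhds hv' hv] with s hs
        rw [h0]
        exact (derivWithin_of_isOpen isOpen_Ioo hs).symm.trans_le
          (this.antitoneOn.mono Set.Ioo_subset_Icc_self).derivWithin_nonpos
      exact A.morse u h0 hmax.deriv_eq_zero

end AngleFunction

namespace AngleFunction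

variable {T : ℝ} {A : AngleFunction T} {u v u' v' : ℝ}

/-! ### The graph of pairs of marked points -/

theorem Arc.lt_iff_not_lt (h : A.Arc u v) : ¬ A.θ u < A.θ v ↔ A.θ v < A.θ u :=
  ⟨fun h' => lt_of_le_of_ne (not_lt.1 h') h.ne.symm, fun h' => not_lt.2 h'.le⟩

/-- For arcs starting at points with values equal modulo `π`, the end points have values with the
same difference iff the angle function goes in the same direction. -/
theorem Arc.add_int_iff (h : A.Arc u v) (h' : A.Arc u' v') {k : ℤ}
    (hk : A.θ u' = A.θ u + k * Real.pi) :
    A.θ v' = A.θ v + k * Real.pi ↔ (A.θ u < A.θ v ↔ A.θ u' < A.θ v') := by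
  constructor
  · intro hv
    rw [hv, hk, add_lt_add_iff_right]
  · intro hd
    have g := h.isGap.add (A.marks_add_int k)
    have g' := h'.isGap
    rw [hk] at g' hd
    exact g'.eq_of_lt_iff g (by rw [← hd, add_lt_add_iff_right])

variable (A) in
/-- The values of the angle function at the two parameters agree modulo `π`. -/
def Par (z : ℝ × ℝ) : Prop := ∃ k : ℤ, A.θ z.2 = A.θ z.1 + k * Real.pi

/-- Equality of parameters modulo the period. -/
def Same (T s t : ℝ) : Prop := ∃ n : ℤ, t = s + n * T

theorem Same.symm {s t : ℝ} : Same T s t → Same T t s := by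
  rintro ⟨n, rfl⟩
  exact ⟨-n, by push_cast; ring⟩

variable (A) in
/-- Pairs of marked points that are limits of pairs of different parallel points. -/
def Vertex (z : ℝ × ℝ) : Prop :=
  z.1 ∈ A.points ∧ A.Par z ∧ (Same T z.1 z.2 → deriv A.θ z.1 = 0)

variable (A) in
/-- Adjacency of pairs of marked points: they are the beginning and the end of two parallel arcs. -/
def Adj (z w : ℝ × ℝ) : Prop :=
  A.Arc z.1 w.1 ∧ A.Arc z.2 w.2 ∧
    (∃ k : ℤ, A.θ z.2 = A.θ z.1 + k * Real.pi ∧ A.θ w.2 = A.θ w.1 + k * Real.pi) ∧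
    ¬ ∃ n : ℤ, z.2 = z.1 + n * T ∧ w.2 = w.1 + n * T

theorem Adj.symm {z w : ℝ × ℝ} (h : A.Adj z w) : A.Adj w z := by
  obtain ⟨h1, h2, ⟨k, hk⟩, h3⟩ := h
  exact ⟨h1.symm, h2.symm, ⟨k, hk.symm⟩, fun ⟨n, hn⟩ => h3 ⟨n, hn.symm⟩⟩

theorem Adj.ne {z w : ℝ × ℝ} (h : A.Adj z w) : z ≠ w := fun e => h.1.2.2.1 (congrArg Prod.fst e)

theorem Par.mem_points {z : ℝ × ℝ} (h : A.Par z) (hz : z.1 ∈ A.points) : z.2 ∈ A.points := by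
  obtain ⟨k, hk⟩ := h
  change A.θ z.2 ∈ A.marks
  rw [hk, marks_add_int]
  exact hz

theorem Adj.iff_of_par {z w : ℝ × ℝ} (h1 : A.Arc z.1 w.1) (h2 : A.Arc z.2 w.2) (hp : A.Par z) :
    A.Adj z w ↔ (A.θ z.1 < A.θ w.1 ↔ A.θ z.2 < A.θ w.2) ∧
      ¬ ∃ n : ℤ, z.2 = z.1 + n * T ∧ w.2 = w.1 + n * T := by
  obtain ⟨k, hk⟩ := hp
  rw [← h1.add_int_iff h2 hk]
  constructor
  · rintro ⟨-, -, ⟨l, hl, hl'⟩, hn⟩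
    refine ⟨?_, hn⟩
    have : (l : ℝ) * Real.pi = k * Real.pi := by linarith
    rwa [this] at hl'
  · rintro ⟨h, hn⟩
    exact ⟨h1, h2, ⟨k, hk, h⟩, hn⟩

theorem same_of_crit {s t : ℝ} (hs : deriv A.θ s = 0) (ht : deriv A.θ t = 0) (h : A.Par (s, t)) :
    Same T s t := A.inj s t hs ht h

theorem Same.deriv_eq {s t : ℝ} (h : Same T s t) : deriv A.θ t = deriv A.θ s := by
  obtain ⟨n, rfl⟩ := h
  exact A.deriv_shift n s

/-- The counting behind degree two. Here `a`, `a'` are the far ends of the two arcs at one point and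
`P` tells whether `θ` rises towards them; `b`, `b'` and `Q` play the same role at the other point.
Equal directions on both sides mean a critical point, which the hypothesis forbids at both points
together. -/
theorem exists_two_of_directions {a a' b b' : ℝ} (haa : a ≠ a') (hbb : b ≠ b') {P Q : ℝ → Prop}
    (h : ¬ ((P a ↔ P a') ∧ (Q b ↔ Q b'))) :
    ∃ w₁ w₂ : ℝ × ℝ, w₁ ≠ w₂ ∧ ∀ c d,
      ((c = a ∨ c = a') ∧ (d = b ∨ d = b')) ∧ (P c ↔ Q d) ↔ (c, d) = w₁ ∨ (c, d) = w₂ := by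
  by_cases hP : P a ↔ P a'
  · by_cases hq : P a ↔ Q b
    · refine ⟨(a, b), (a', b), by simp [haa], fun c d => ?_⟩
      rw [Prod.mk_inj, Prod.mk_inj]
      grind
    · refine ⟨(a, b'), (a', b'), by simp [haa], fun c d => ?_⟩
      rw [Prod.mk_inj, Prod.mk_inj]
      grind
  · by_cases hQ : Q b ↔ Q b'
    · by_cases hq : P a ↔ Q b
      · refine ⟨(a, b), (a, b'), by simp [hbb], fun c d => ?_⟩
        rw [Prod.mk_inj, Prod.mk_inj]
        grind
      · refine ⟨(a', b), (a', b'), by simp [hbb], fun c d => ?_⟩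
        rw [Prod.mk_inj, Prod.mk_inj]
        grind
    · by_cases hq : P a ↔ Q b
      · refine ⟨(a, b), (a', b'), by simp [haa], fun c d => ?_⟩
        rw [Prod.mk_inj, Prod.mk_inj]
        grind
      · refine ⟨(a, b'), (a', b), by simp [haa], fun c d => ?_⟩
        rw [Prod.mk_inj, Prod.mk_inj]
        grind

/-- Every vertex has exactly two neighbours. -/
theorem Vertex.exists_neighbours {z : ℝ × ℝ} (hz : A.Vertex z) :
    ∃ w₁ w₂, w₁ ≠ w₂ ∧ ∀ w, A.Adj z w ↔ w = w₁ ∨ w = w₂ := by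
  obtain ⟨x, y⟩ := z
  obtain ⟨hx, hp, hsame⟩ := hz
  have hy : y ∈ A.points := hp.mem_points hx
  obtain ⟨a, ha, arca⟩ := exists_arc_lt hx
  obtain ⟨a', ha', arca'⟩ := exists_arc_gt hx
  obtain ⟨b, hb, arcb⟩ := exists_arc_lt hy
  obtain ⟨b', hb', arcb'⟩ := exists_arc_gt hy
  have hA : ∀ c, A.Arc x c ↔ c = a ∨ c = a' := fun c => by
    constructor
    · intro h
      rcases lt_or_gt_of_ne h.2.2.1 with h1 | h1
      · exact Or.inl (IsGap.eq_of_lt h arca h1 ha)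
      · exact Or.inr (IsGap.eq_of_gt h arca' h1 ha')
    · rintro (rfl | rfl) <;> assumption
  have hB : ∀ c, A.Arc y c ↔ c = b ∨ c = b' := fun c => by
    constructor
    · intro h
      rcases lt_or_gt_of_ne h.2.2.1 with h1 | h1
      · exact Or.inl (IsGap.eq_of_lt h arcb h1 hb)
      · exact Or.inr (IsGap.eq_of_gt h arcb' h1 hb')
    · rintro (rfl | rfl) <;> assumption
  have cx := lt_iff_lt_iff_deriv_eq_zero arca arca' ha ha'
  have cy := lt_iff_lt_iff_deriv_eq_zero arcb arcb' hb hb'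
  have hab : ∀ c d, A.Adj (x, y) (c, d) ↔ ((c = a ∨ c = a') ∧ (d = b ∨ d = b')) ∧
      (A.θ x < A.θ c ↔ A.θ y < A.θ d) ∧ ¬ ∃ n : ℤ, y = x + n * T ∧ d = c + n * T := by
    intro c d
    rw [← hA, ← hB]
    constructor
    · intro h
      exact ⟨⟨h.1, h.2.1⟩, (Adj.iff_of_par (z := (x, y)) (w := (c, d)) h.1 h.2.1 hp).1 h⟩
    · rintro ⟨⟨h1, h2⟩, h3⟩
      exact (Adj.iff_of_par (z := (x, y)) (w := (c, d)) h1 h2 hp).2 h3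
  have haa : a ≠ a' := (ha'.trans ha).ne'
  have hbb : b ≠ b' := (hb'.trans hb).ne'
  -- On the diagonal the point is critical, so all four pairs of arcs have the same direction; the
  -- two that pair an arc with its own translate are excluded.
  by_cases hs : Same T x y
  · have hx0 := hsame hs
    have hy0 : deriv A.θ y = 0 := hs.deriv_eq.trans hx0
    obtain ⟨n, hn⟩ := hs
    have hnn : ∀ m : ℤ, y = x + m * T → m = n := fun m hm => by
      have : (m : ℝ) * T = n * T := by linarith
      exact_mod_cast mul_right_cancel₀ A.T_pos.ne' this
    have eb : b = a + n * T := by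
      have h1 := arca.shift n
      rw [← hn] at h1
      exact IsGap.eq_of_lt arcb h1 hb (by rw [hn]; linarith)
    have eb' : b' = a' + n * T := by
      have h1 := arca'.shift n
      rw [← hn] at h1
      exact IsGap.eq_of_gt arcb' h1 hb' (by rw [hn]; linarith)
    have dab : A.θ x < A.θ a ↔ A.θ y < A.θ b := by
      rw [hn, eb, shift_int, shift_int, add_lt_add_iff_right]
    have key : ∀ c d, (∃ m : ℤ, y = x + m * T ∧ d = c + m * T) ↔ d = c + n * T := by
      intro c d
      constructor
      · rintro ⟨m, hm, h⟩
        rwa [hnn m hm] at h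
      · intro h
        exact ⟨n, hn, h⟩
    refine ⟨(a, b'), (a', b), by simp [haa], ?_⟩
    rintro ⟨c, d⟩
    rw [hab, key, Prod.mk_inj, Prod.mk_inj]
    have n1 : a' + n * T ≠ a + n * T := fun h => haa (add_right_cancel h).symm
    have n2 : a + n * T ≠ a' + n * T := n1.symm
    constructor
    · rintro ⟨⟨rfl | rfl, rfl | rfl⟩, -, h⟩
      · exact absurd eb h
      · simp
      · simp
      · exact absurd eb' h
    · rintro (⟨rfl, rfl⟩ | ⟨rfl, rfl⟩)
      · refine ⟨by simp, ?_, by rwa [eb']⟩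
        tauto
      · refine ⟨by simp, ?_, by rwa [eb]⟩
        tauto
  · have hn : ∀ c d, ¬ ∃ n : ℤ, y = x + n * T ∧ d = c + n * T :=
      fun c d ⟨n, h, _⟩ => hs ⟨n, h⟩
    -- Here different critical points having values that differ modulo `π` is essential.
    have hxy : ¬ (deriv A.θ x = 0 ∧ deriv A.θ y = 0) := fun h => hs (same_of_crit h.1 h.2 hp)
    have hab' : ∀ c d, A.Adj (x, y) (c, d) ↔ ((c = a ∨ c = a') ∧ (d = b ∨ d = b')) ∧
      (A.θ x < A.θ c ↔ A.θ y < A.θ d) := fun c d => by simp [hab, hn]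
    clear hab hA hB
    obtain ⟨w₁, w₂, hne, h⟩ := exists_two_of_directions haa hbb (P := fun c => A.θ x < A.θ c)
      (Q := fun d => A.θ y < A.θ d) (fun h => hxy ⟨cx.1 h.1, cy.1 h.2⟩)
    exact ⟨w₁, w₂, hne, fun ⟨c, d⟩ => (hab' c d).trans (h c d)⟩

/-- The end points of edges are vertices. -/
theorem Adj.vertex {z w : ℝ × ℝ} (h : A.Adj z w) : A.Vertex z := by
  obtain ⟨x, y⟩ := z
  obtain ⟨c, d⟩ := w
  have hp : A.Par (x, y) := by obtain ⟨-, -, ⟨k, hk, -⟩, -⟩ := h; exact ⟨k, hk⟩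
  refine ⟨h.1.1, hp, ?_⟩
  rintro ⟨n, hn⟩
  by_contra h0
  obtain ⟨hd, hno⟩ := (Adj.iff_of_par h.1 h.2.1 hp).1 h
  refine hno ⟨n, hn, ?_⟩
  have h1 : A.Arc x c := h.1
  have h2 : A.Arc y d := h.2.1
  have h3 := h1.shift n
  simp only at hn hd h0
  rw [← hn] at h3
  refine IsGap.eq_of_lt_iff h2 h3 ?_
  have hd3 : A.θ y < A.θ (c + n * T) ↔ A.θ y < A.θ d := by
    rw [← hd, hn, shift_int, shift_int, add_lt_add_iff_right]
  have hy0 : ¬ deriv A.θ y = 0 := by rwa [hn, deriv_shift]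
  -- Arcs on different sides of `y` with the same direction of `θ` would make `y` critical.
  by_contra hcon
  rcases lt_or_gt_of_ne h2.2.2.1 with g2 | g2 <;> rcases lt_or_gt_of_ne h3.2.2.1 with g3 | g3
  · exact hcon (iff_of_true g2 g3)
  · exact hy0 ((lt_iff_lt_iff_deriv_eq_zero h2 h3 g2 g3).1 hd3.symm)
  · exact hy0 ((lt_iff_lt_iff_deriv_eq_zero h3 h2 g3 g2).1 hd3)
  · exact hcon (iff_of_false g2.not_gt g3.not_gt)

end AngleFunction

namespace AngleFunction

variable {T : ℝ} {A : AngleFunction T} {u v u' v' : ℝ}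

/-! ### Symmetries -/

/-- Translation by a vector of the period lattice. -/
def lat (T : ℝ) (m n : ℤ) (z : ℝ × ℝ) : ℝ × ℝ := (z.1 + m * T, z.2 + n * T)

/-- Exchange of the coordinates followed by a translation. -/
def swp (T : ℝ) (m n : ℤ) (z : ℝ × ℝ) : ℝ × ℝ := (z.2 + m * T, z.1 + n * T)

/-- The pair of points of the circle given by a pair of parameters. -/
def torus (T : ℝ) (z : ℝ × ℝ) : AddCircle T × AddCircle T := ((z.1 : AddCircle T), (z.2 : AddCircle T))

theorem continuous_torus : Continuous (torus T) :=
  ((AddCircle.continuous_mk' T).comp continuous_fst).prodMk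
    ((AddCircle.continuous_mk' T).comp continuous_snd)

theorem coe_eq_coe_iff {s t : ℝ} : (s : AddCircle T) = t ↔ ∃ n : ℤ, t = s + n * T := by
  rw [QuotientAddGroup.eq, AddSubgroup.mem_zmultiples_iff]
  constructor
  · rintro ⟨n, hn⟩
    exact ⟨n, by rw [zsmul_eq_mul] at hn; linarith⟩
  · rintro ⟨n, hn⟩
    exact ⟨n, by rw [zsmul_eq_mul]; linarith⟩

theorem torus_eq_iff {z w : ℝ × ℝ} : torus T z = torus T w ↔ ∃ m n : ℤ, w = lat T m n z := by
  unfold torus lat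
  rw [Prod.mk_inj, coe_eq_coe_iff, coe_eq_coe_iff]
  constructor
  · rintro ⟨⟨m, hm⟩, n, hn⟩
    exact ⟨m, n, Prod.ext hm hn⟩
  · rintro ⟨m, n, h⟩
    exact ⟨⟨m, congrArg Prod.fst h⟩, n, congrArg Prod.snd h⟩

theorem torus_lat (m n : ℤ) (z : ℝ × ℝ) : torus T (lat T m n z) = torus T z :=
  (torus_eq_iff.2 ⟨m, n, rfl⟩).symm

theorem torus_swp (m n : ℤ) (z : ℝ × ℝ) : torus T (swp T m n z) = (torus T z).swap :=
  torus_lat m n z.swap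

theorem Par.translate {z : ℝ × ℝ} (h : A.Par z) (m n : ℤ) : A.Par (lat T m n z) := by
  obtain ⟨k, hk⟩ := h
  refine ⟨k + n * A.rot - m * A.rot, ?_⟩
  simp only [lat, shift_int, hk]
  push_cast
  ring

theorem Par.swap {z : ℝ × ℝ} (h : A.Par z) : A.Par z.swap := by
  obtain ⟨k, hk⟩ := h
  exact ⟨-k, by simp only [Prod.fst_swap, Prod.snd_swap, hk]; push_cast; ring⟩

theorem Adj.translate {z w : ℝ × ℝ} (h : A.Adj z w) (m n : ℤ) : A.Adj (lat T m n z) (lat T m n w) := by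
  obtain ⟨h1, h2, ⟨k, hk, hk'⟩, h3⟩ := h
  refine ⟨h1.shift m, h2.shift n, ⟨k + n * A.rot - m * A.rot, ?_, ?_⟩, ?_⟩
  · simp only [lat, shift_int, hk]
    push_cast
    ring
  · simp only [lat, shift_int, hk']
    push_cast
    ring
  · rintro ⟨j, hj, hj'⟩
    simp only [lat] at hj hj'
    refine h3 ⟨j + m - n, ?_, ?_⟩ <;> push_cast <;> linarith

theorem Adj.swap {z w : ℝ × ℝ} (h : A.Adj z w) : A.Adj z.swap w.swap := by
  obtain ⟨h1, h2, ⟨k, hk, hk'⟩, h3⟩ := h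
  refine ⟨h2, h1, ⟨-k, ?_, ?_⟩, ?_⟩
  · simp only [Prod.fst_swap, Prod.snd_swap, hk]; push_cast; ring
  · simp only [Prod.fst_swap, Prod.snd_swap, hk']; push_cast; ring
  · rintro ⟨j, hj, hj'⟩
    simp only [Prod.fst_swap, Prod.snd_swap] at hj hj'
    refine h3 ⟨-j, ?_, ?_⟩ <;> push_cast <;> linarith

theorem Adj.exchange {z w : ℝ × ℝ} (h : A.Adj z w) (m n : ℤ) : A.Adj (swp T m n z) (swp T m n w) :=
  h.swap.translate m n

/-! ### Edges -/

variable (A) in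
/-- The pairs of different parameters with parallel tangent lines. -/
def pairs : Set (ℝ × ℝ) := {z | A.Par z ∧ ¬ Same T z.1 z.2}

variable (A) in
/-- The closure of the set of pairs of different parallel points. -/
def closedPairs : Set (AddCircle T × AddCircle T) := closure (torus T '' A.pairs)

variable (A) in
/-- The pairs of parallel points with one point in the interior of each of two arcs. -/
def inner (z w : ℝ × ℝ) : Set (ℝ × ℝ) :=
  {p | p ∈ A.pairs ∧ p.1 ∈ Set.uIoo z.1 w.1 ∧ p.2 ∈ Set.uIoo z.2 w.2}

variable (A) in
/-- The closure of the set of parallel pairs between two arcs. -/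
def edge (z w : ℝ × ℝ) : Set (AddCircle T × AddCircle T) := closure (torus T '' A.inner z w)

theorem edge_comm (z w : ℝ × ℝ) : A.edge z w = A.edge w z := by
  unfold edge inner
  rw [Set.uIoo_comm, Set.uIoo_comm z.2]

theorem edge_subset_closedPairs (z w : ℝ × ℝ) : A.edge z w ⊆ A.closedPairs :=
  closure_mono (Set.image_mono fun _ h => h.1)

theorem isClosed_edge (z w : ℝ × ℝ) : IsClosed (A.edge z w) := isClosed_closure

theorem mem_uIoo_add {a b c s : ℝ} : s + c ∈ Set.uIoo (a + c) (b + c) ↔ s ∈ Set.uIoo a b := by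
  simp only [Set.uIoo, Set.mem_Ioo, inf_lt_iff, lt_sup_iff, add_lt_add_iff_right]

theorem inner_lat_subset (z w : ℝ × ℝ) (m n : ℤ) :
    torus T '' A.inner z w ⊆ torus T '' A.inner (lat T m n z) (lat T m n w) := by
  rintro _ ⟨p, ⟨⟨hp, hs⟩, h1, h2⟩, rfl⟩
  refine ⟨lat T m n p, ⟨⟨hp.translate m n, ?_⟩, mem_uIoo_add.2 h1, mem_uIoo_add.2 h2⟩, torus_lat _ _ _⟩
  rintro ⟨j, hj⟩
  simp only [lat] at hj
  exact hs ⟨j + m - n, by push_cast; linarith⟩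

theorem lat_lat_neg (m n : ℤ) (z : ℝ × ℝ) : lat T (-m) (-n) (lat T m n z) = z := by
  unfold lat
  ext <;> push_cast <;> ring

theorem edge_lat (z w : ℝ × ℝ) (m n : ℤ) : A.edge (lat T m n z) (lat T m n w) = A.edge z w := by
  refine subset_antisymm (closure_mono ?_) (closure_mono (inner_lat_subset z w m n))
  have := inner_lat_subset (A := A) (lat T m n z) (lat T m n w) (-m) (-n)
  rwa [lat_lat_neg, lat_lat_neg] at this

theorem edge_swap (z w : ℝ × ℝ) : A.edge z.swap w.swap = Prod.swap '' A.edge z w := by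
  have key : torus T '' A.inner z.swap w.swap = Prod.swap '' (torus T '' A.inner z w) := by
    rw [Set.image_image]
    ext x
    constructor
    · rintro ⟨p, ⟨⟨hp, hs⟩, h1, h2⟩, rfl⟩
      exact ⟨p.swap, ⟨⟨hp.swap, fun h => hs h.symm⟩, h2, h1⟩, rfl⟩
    · rintro ⟨p, ⟨⟨hp, hs⟩, h1, h2⟩, rfl⟩
      exact ⟨p.swap, ⟨⟨hp.swap, fun h => hs h.symm⟩, h2, h1⟩, rfl⟩
  unfold edge
  rw [key]
  exact ((Homeomorph.prodComm _ _).image_closure _).symm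

theorem edge_swp (z w : ℝ × ℝ) (m n : ℤ) :
    A.edge (swp T m n z) (swp T m n w) = Prod.swap '' A.edge z w :=
  (edge_lat z.swap w.swap m n).trans (edge_swap z w)

/-- The angle function has a continuous inverse on an arc. -/
theorem Arc.exists_inverse (h : A.Arc u v) :
    ∃ ψ : ℝ → ℝ, ContinuousOn ψ (Set.uIcc (A.θ u) (A.θ v)) ∧
      (∀ y ∈ Set.uIcc (A.θ u) (A.θ v), ψ y ∈ Set.uIcc u v ∧ A.θ (ψ y) = y) := by
  classical
  let f : Set.uIcc u v → ℝ := fun s => A.θ s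
  have : CompactSpace (Set.uIcc u v) := isCompact_iff_compactSpace.1 isCompact_uIcc
  have hemb : Topology.IsClosedEmbedding f :=
    (A.smooth.continuous.comp continuous_subtype_val).isClosedEmbedding
      fun a b hab => Subtype.ext (h.injOn a.2 b.2 hab)
  let e := hemb.isEmbedding.toHomeomorph
  have hsub : Set.uIcc (A.θ u) (A.θ v) ⊆ Set.range f := by
    intro y hy
    obtain ⟨s, hs, rfl⟩ := intermediate_value_uIcc A.smooth.continuous.continuousOn hy
    exact ⟨⟨s, hs⟩, rfl⟩
  refine ⟨fun y => if hy : y ∈ Set.range f then (e.symm ⟨y, hy⟩ : ℝ) else u, ?_, ?_⟩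
  · refine ContinuousOn.mono ?_ hsub
    rw [continuousOn_iff_continuous_domRestrict]
    have : (Set.range f).domRestrict
        (fun y => if hy : y ∈ Set.range f then (e.symm ⟨y, hy⟩ : ℝ) else u)
        = fun y => (e.symm y : ℝ) := by
      funext y
      simp only [Set.domRestrict_apply, dif_pos y.2]
    rw [this]
    exact continuous_subtype_val.comp e.symm.continuous
  · intro y hy
    have hy' := hsub hy
    simp only [dif_pos hy']
    exact ⟨(e.symm ⟨y, hy'⟩).2, congrArg Subtype.val (e.apply_symm_apply ⟨y, hy'⟩)⟩

theorem mem_uIoo_of_mem_uIcc {a b s : ℝ} (h : s ∈ Set.uIcc a b) (ha : s ≠ a) (hb : s ≠ b) :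
    s ∈ Set.uIoo a b := by
  rw [Set.uIcc, Set.mem_Icc] at h
  refine ⟨lt_of_le_of_ne h.1 fun e => ?_, lt_of_le_of_ne h.2 fun e => ?_⟩
  · rcases min_choice a b with hm | hm
    · exact ha (e.symm.trans hm)
    · exact hb (e.symm.trans hm)
  · rcases max_choice a b with hm | hm
    · exact ha (e.trans hm)
    · exact hb (e.trans hm)

theorem uIoo_subset_uIcc (a b : ℝ) : Set.uIoo a b ⊆ Set.uIcc a b := Set.Ioo_subset_Icc_self

theorem Adj.not_same {z w p : ℝ × ℝ} (h : A.Adj z w) (h1 : p.1 ∈ Set.uIoo z.1 w.1)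
    (h2 : p.2 ∈ Set.uIoo z.2 w.2) : ¬ Same T p.1 p.2 := by
  rintro ⟨n, hn⟩
  obtain ⟨a1, a2, ⟨k, hk, hk'⟩, hno⟩ := h
  have h1' := mem_uIoo_add (c := n * T) |>.2 h1
  rw [hn] at h2
  rcases IsGap.eq_or_eq_of_mem (a1.shift n) a2 h1' h2 with h | h
  · exact hno ⟨n, h⟩
  · rw [h.1, shift_int] at hk
    rw [h.2, shift_int] at hk'
    exact a1.ne (by linarith)

theorem Arc.mapsTo (h : A.Arc u v) {s : ℝ} (hs : s ∈ Set.uIoo u v) :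
    A.θ s ∈ Set.uIoo (A.θ u) (A.θ v) := h.image_uIoo ▸ Set.mem_image_of_mem _ hs

/-- On parallel pairs between two adjacent arcs the difference of the angles is the same as at the
end points. -/
theorem Adj.int_eq {z w p : ℝ × ℝ} (h : A.Adj z w) (hp : A.Par p)
    (h1 : p.1 ∈ Set.uIoo z.1 w.1) (h2 : p.2 ∈ Set.uIoo z.2 w.2) {k : ℤ}
    (hk : A.θ z.2 = A.θ z.1 + k * Real.pi) : A.θ p.2 = A.θ p.1 + k * Real.pi := by
  obtain ⟨a1, a2, ⟨l, hl, hl'⟩, -⟩ := h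
  obtain ⟨j, hj⟩ := hp
  have hkl : (l : ℝ) * Real.pi = k * Real.pi := by linarith
  rw [hkl] at hl hl'
  have m1 := a1.mapsTo h1
  have m2 := a2.mapsTo h2
  rw [hl, hl', hj, show A.θ p.1 + j * Real.pi = (A.θ p.1 + (j - k) * Real.pi) + k * Real.pi by ring,
    mem_uIoo_add] at m2
  have hlen := a1.isGap.abs_sub_le Real.pi_pos A.marks_add
  -- Both `θ p.1` and its translate by `(j - k) π` lie in the same open gap of the marks. The gap
  -- has length at most `π`, hence `|j - k| < 1`.
  have hd : |(j - k : ℝ) * Real.pi| < |A.θ w.1 - A.θ z.1| := by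
    generalize A.θ w.1 = b at *
    generalize A.θ z.1 = a at *
    generalize (j - k : ℝ) * Real.pi = d at *
    generalize A.θ p.1 = c at *
    rcases le_total a b with hab | hab
    · rw [Set.uIoo_of_le hab] at m1 m2
      rw [abs_of_nonneg (sub_nonneg.2 hab), abs_lt]
      constructor <;> linarith [m1.1, m1.2, m2.1, m2.2]
    · rw [Set.uIoo_of_ge hab] at m1 m2
      rw [abs_of_nonpos (sub_nonpos.2 hab), abs_lt]
      constructor <;> linarith [m1.1, m1.2, m2.1, m2.2]
  have hlt := hd.trans_le hlen
  rw [abs_mul, abs_of_pos Real.pi_pos] at hlt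
  have h1 : |(j - k : ℝ)| < 1 := by
    by_contra! hge
    exact absurd hlt (not_lt.2 (le_mul_of_one_le_left Real.pi_pos.le hge))
  have h2 : |j - k| < 1 := by exact_mod_cast h1
  have : j = k := by rw [Int.abs_lt_one_iff] at h2; linarith
  rw [hj, this]

/-- An edge is parameterized by the first arc. -/
theorem Adj.exists_param {z w : ℝ × ℝ} (h : A.Adj z w) :
    ∃ ρ : ℝ → ℝ, ContinuousOn ρ (Set.uIcc z.1 w.1) ∧ ρ z.1 = z.2 ∧ ρ w.1 = w.2 ∧
      (∀ s ∈ Set.uIoo z.1 w.1, (s, ρ s) ∈ A.inner z w) ∧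
      (∀ p ∈ A.inner z w, p.2 = ρ p.1) ∧
      A.edge z w = (fun s => torus T (s, ρ s)) '' Set.uIcc z.1 w.1 := by
  have h' := h
  obtain ⟨a1, a2, ⟨k, hk, hk'⟩, -⟩ := h'
  obtain ⟨ψ, hψc, hψ⟩ := a2.exists_inverse
  have hmem : ∀ s ∈ Set.uIcc z.1 w.1, A.θ s + k * Real.pi ∈ Set.uIcc (A.θ z.2) (A.θ w.2) := by
    intro s hs
    have hmap : A.θ s ∈ Set.uIcc (A.θ z.1) (A.θ w.1) := by
      by_cases e1 : s = z.1
      · rw [e1]; exact Set.left_mem_uIcc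
      by_cases e2 : s = w.1
      · rw [e2]; exact Set.right_mem_uIcc
      exact uIoo_subset_uIcc _ _ (a1.mapsTo (mem_uIoo_of_mem_uIcc hs e1 e2))
    rw [hk, hk', ← Set.image_add_const_uIcc]
    exact ⟨_, hmap, rfl⟩
  set ρ : ℝ → ℝ := fun s => ψ (A.θ s + k * Real.pi) with hρ
  have hρ1 : ∀ s ∈ Set.uIcc z.1 w.1, ρ s ∈ Set.uIcc z.2 w.2 := fun s hs => (hψ _ (hmem s hs)).1
  have hρθ : ∀ s ∈ Set.uIcc z.1 w.1, A.θ (ρ s) = A.θ s + k * Real.pi :=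
    fun s hs => (hψ _ (hmem s hs)).2
  have huniq : ∀ s ∈ Set.uIcc z.1 w.1, ∀ t ∈ Set.uIcc z.2 w.2, A.θ t = A.θ s + k * Real.pi →
      ρ s = t := fun s hs t ht e => a2.injOn (hρ1 s hs) ht ((hρθ s hs).trans e.symm)
  have hρl : ρ z.1 = z.2 := huniq _ Set.left_mem_uIcc _ Set.left_mem_uIcc hk
  have hρr : ρ w.1 = w.2 := huniq _ Set.right_mem_uIcc _ Set.right_mem_uIcc hk'
  have hcont : ContinuousOn ρ (Set.uIcc z.1 w.1) :=
    hψc.comp (A.smooth.continuous.add continuous_const).continuousOn hmem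
  have hin : ∀ s ∈ Set.uIoo z.1 w.1, (s, ρ s) ∈ A.inner z w := by
    intro s hs
    have hs' := uIoo_subset_uIcc _ _ hs
    have hI : ρ s ∈ Set.uIoo z.2 w.2 := by
      refine mem_uIoo_of_mem_uIcc (hρ1 s hs') ?_ ?_
      · intro e
        have := hρθ s hs'
        rw [e, hk] at this
        have e2 := a1.injOn Set.left_mem_uIcc hs' (add_right_cancel this)
        rw [← e2] at hs
        exact a1.2.2.2 _ hs a1.1
      · intro e
        have := hρθ s hs'
        rw [e, hk'] at this
        have e2 := a1.injOn Set.right_mem_uIcc hs' (add_right_cancel this)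
        rw [← e2] at hs
        exact a1.2.2.2 _ hs a1.2.1
    exact ⟨⟨⟨k, hρθ s hs'⟩, h.not_same (p := (s, ρ s)) hs hI⟩, hs, hI⟩
  have hun : ∀ p ∈ A.inner z w, p.2 = ρ p.1 := by
    rintro p ⟨⟨hp, -⟩, h1, h2⟩
    exact (huniq _ (uIoo_subset_uIcc _ _ h1) _ (uIoo_subset_uIcc _ _ h2)
      (h.int_eq hp h1 h2 hk)).symm
  have hc : ContinuousOn (fun s => torus T (s, ρ s)) (Set.uIcc z.1 w.1) :=
    continuous_torus.comp_continuousOn (continuousOn_id.prodMk hcont)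
  refine ⟨ρ, hcont, hρl, hρr, hin, hun, subset_antisymm ?_ ?_⟩
  · refine closure_minimal ?_ (isCompact_uIcc.image_of_continuousOn hc).isClosed
    rintro _ ⟨p, hp, rfl⟩
    refine ⟨p.1, uIoo_subset_uIcc _ _ hp.2.1, ?_⟩
    simp only [← hun p hp]
  · have hcl : closure (Set.uIoo z.1 w.1) = Set.uIcc z.1 w.1 :=
      closure_Ioo (by simpa using a1.2.2.1)
    rw [← hcl] at hc ⊢
    refine hc.image_closure.trans (closure_mono ?_)
    rintro _ ⟨s, hs, rfl⟩
    exact ⟨_, hin s hs, rfl⟩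

theorem Adj.left_mem_edge {z w : ℝ × ℝ} (h : A.Adj z w) : torus T z ∈ A.edge z w := by
  obtain ⟨ρ, -, hl, -, -, -, he⟩ := h.exists_param
  rw [he]
  exact ⟨z.1, Set.left_mem_uIcc, by simp only [hl]⟩

theorem Adj.right_mem_edge {z w : ℝ × ℝ} (h : A.Adj z w) : torus T w ∈ A.edge z w := by
  rw [edge_comm]
  exact h.symm.left_mem_edge

theorem Adj.isPreconnected_edge {z w : ℝ × ℝ} (h : A.Adj z w) : IsPreconnected (A.edge z w) := by
  obtain ⟨ρ, hc, -, -, -, -, he⟩ := h.exists_param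
  rw [he]
  exact isPreconnected_uIcc.image _ (continuous_torus.comp_continuousOn (continuousOn_id.prodMk hc))

theorem Adj.inner_nonempty {z w : ℝ × ℝ} (h : A.Adj z w) : (A.inner z w).Nonempty := by
  obtain ⟨ρ, -, -, -, hin, -, -⟩ := h.exists_param
  have : (Set.uIoo z.1 w.1).Nonempty := Set.nonempty_Ioo.2 (by simpa using h.1.2.2.1.symm)
  obtain ⟨s, hs⟩ := this
  exact ⟨_, hin s hs⟩

theorem inner_subset_edge {z w p : ℝ × ℝ} (hp : p ∈ A.inner z w) : torus T p ∈ A.edge z w :=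
  subset_closure ⟨p, hp, rfl⟩

theorem Adj.mem_edge {z w : ℝ × ℝ} (h : A.Adj z w) {x : AddCircle T × AddCircle T}
    (hx : x ∈ A.edge z w) :
    x = torus T z ∨ x = torus T w ∨ ∃ p ∈ A.inner z w, x = torus T p := by
  obtain ⟨ρ, -, hl, hr, hin, -, he⟩ := h.exists_param
  rw [he] at hx
  obtain ⟨s, hs, rfl⟩ := hx
  by_cases e1 : s = z.1
  · left; simp only [e1, hl]
  by_cases e2 : s = w.1
  · right; left; simp only [e2, hr]
  · exact Or.inr (Or.inr ⟨_, hin s (mem_uIoo_of_mem_uIcc hs e1 e2), rfl⟩)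

theorem inner_fst_notMem {z w p : ℝ × ℝ} (h : A.Adj z w) (hp : p ∈ A.inner z w) :
    p.1 ∉ A.points := h.1.2.2.2 _ hp.2.1

/-- An edge that meets the interior of another edge is equal to it. -/
theorem Adj.eq_of_mem_edge {z w z' w' p : ℝ × ℝ} (h : A.Adj z w) (h' : A.Adj z' w')
    (hp : p ∈ A.inner z w) (hp' : torus T p ∈ A.edge z' w') :
    ∃ m n : ℤ, (lat T m n z = z' ∧ lat T m n w = w') ∨ (lat T m n z = w' ∧ lat T m n w = z') := by
  have hnot := inner_fst_notMem h hp
  have hnot' : ∀ q, torus T p = torus T q → q.1 ∉ A.points := by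
    intro q hq hq1
    obtain ⟨m, n, rfl⟩ := torus_eq_iff.1 hq
    exact hnot ((A.points_add_int m _).1 hq1)
  rcases h'.mem_edge hp' with e | e | ⟨q, hq, e⟩
  · exact absurd h'.1.1 (hnot' _ e)
  · exact absurd h'.1.2.1 (hnot' _ e)
  · obtain ⟨m, n, rfl⟩ := torus_eq_iff.1 e
    refine ⟨m, n, ?_⟩
    have h2 := h.translate m n
    have g1 := IsGap.eq_or_eq_of_mem h2.1 h'.1 (mem_uIoo_add.2 hp.2.1) hq.2.1
    have g2 := IsGap.eq_or_eq_of_mem h2.2.1 h'.2.1 (mem_uIoo_add.2 hp.2.2) hq.2.2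
    obtain ⟨b1, -, ⟨k, hk1, hk2⟩, -⟩ := h2
    obtain ⟨-, -, ⟨l, hl1, hl2⟩, -⟩ := h'
    -- In the mixed cases one arc is reversed and the other is not, although `θ` has the same
    -- increment along the two arcs of an edge.
    rcases g1 with g1 | g1 <;> rcases g2 with g2 | g2
    · exact Or.inl ⟨Prod.ext g1.1.symm g2.1.symm, Prod.ext g1.2.symm g2.2.symm⟩
    · exfalso
      rw [g1.1, g2.1] at hl1
      rw [g1.2, g2.2] at hl2
      exact b1.ne (by linarith)
    · exfalso
      rw [g1.1, g2.1] at hl1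
      rw [g1.2, g2.2] at hl2
      exact b1.ne (by linarith)
    · exact Or.inr ⟨Prod.ext g1.2.symm g2.2.symm, Prod.ext g1.1.symm g2.1.symm⟩

/-- Every parallel pair lies on an edge. -/
theorem exists_adj_of_mem_pairs {p : ℝ × ℝ} (hp : p ∈ A.pairs) :
    ∃ z w, A.Adj z w ∧ torus T p ∈ A.edge z w := by
  obtain ⟨s, t⟩ := p
  obtain ⟨hpar, hs⟩ := hp
  by_cases hS : s ∈ A.points
  · have hv : A.Vertex (s, t) := ⟨hS, hpar, fun h => absurd h hs⟩
    obtain ⟨w, _, _, hw⟩ := hv.exists_neighbours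
    have := (hw w).2 (Or.inl rfl)
    exact ⟨_, w, this, this.left_mem_edge⟩
  · have hT : t ∉ A.points := fun h => hS (hpar.swap.mem_points h)
    obtain ⟨a, b, has, hsb, hab⟩ := exists_arc_mem hS
    obtain ⟨c, d, hct, htd, hcd⟩ := exists_arc_mem hT
    obtain ⟨k, hk⟩ := hpar
    have ms : s ∈ Set.uIoo a b := by rw [Set.uIoo_of_lt (has.trans hsb)]; exact ⟨has, hsb⟩
    have mt : t ∈ Set.uIoo c d := by rw [Set.uIoo_of_lt (hct.trans htd)]; exact ⟨hct, htd⟩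
    -- The arc around `t` is directed so that it runs parallel to the one around `s`.
    obtain ⟨x, y, harc, mt', e1, e2⟩ : ∃ x y, A.Arc x y ∧ t ∈ Set.uIoo x y ∧
        A.θ x = A.θ a + k * Real.pi ∧ A.θ y = A.θ b + k * Real.pi := by
      have g1 := hab.isGap.add (A.marks_add_int k)
      have m2 := hcd.mapsTo mt
      simp only at hk
      rw [hk] at m2
      rcases IsGap.eq_or_eq_of_mem g1 hcd.isGap (mem_uIoo_add.2 (hab.mapsTo ms)) m2 with h | h
      · exact ⟨c, d, hcd, mt, h⟩
      · exact ⟨d, c, hcd.symm, by rwa [Set.uIoo_comm], h.2, h.1⟩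
    have hadj : A.Adj (a, x) (b, y) := by
      refine ⟨hab, harc, ⟨k, e1, e2⟩, ?_⟩
      rintro ⟨n, h1, h2⟩
      simp only at h1 h2 hk
      apply hs
      refine ⟨n, ?_⟩
      have hr : ((n * A.rot : ℤ) : ℝ) * Real.pi = k * Real.pi := by
        rw [h1, shift_int] at e1
        linarith
      -- If the second arc were the first translated by `n T`, then `t` and `s + n T` would be
      -- points of one arc with the same value of `θ`.
      refine harc.injOn (uIoo_subset_uIcc _ _ mt') ?_ ?_
      · rw [h1, h2]
        exact uIoo_subset_uIcc _ _ (mem_uIoo_add.2 ms)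
      · simp only
        rw [shift_int, hr, hk]
    exact ⟨_, _, hadj, inner_subset_edge ⟨⟨⟨k, hk⟩, hs⟩, ms, mt'⟩⟩

end AngleFunction

namespace AngleFunction

variable {T : ℝ} {A : AngleFunction T}

/-! ### The symmetry group -/

/-- The translations by lattice vectors and, if `half` holds, also the exchanges of coordinates. -/
def IsSym (T : ℝ) (half : Prop) (g : ℝ × ℝ → ℝ × ℝ) : Prop :=
  (∃ m n, g = lat T m n) ∨ (half ∧ ∃ m n, g = swp T m n)

theorem lat_injective (m n : ℤ) : Function.Injective (lat T m n) := fun a b h => by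
  rw [← lat_lat_neg (T := T) m n a, h, lat_lat_neg]

theorem swp_injective (m n : ℤ) : Function.Injective (swp T m n) := fun _ _ h =>
  Prod.swap_injective (lat_injective m n h)

theorem IsSym.injective {half : Prop} {g : ℝ × ℝ → ℝ × ℝ} (h : IsSym T half g) :
    Function.Injective g := by
  rcases h with ⟨m, n, rfl⟩ | ⟨-, m, n, rfl⟩
  · exact lat_injective m n
  · exact swp_injective m n

theorem IsSym.adj {half : Prop} {g : ℝ × ℝ → ℝ × ℝ} (h : IsSym T half g) {z w : ℝ × ℝ}
    (hzw : A.Adj z w) : A.Adj (g z) (g w) := by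
  rcases h with ⟨m, n, rfl⟩ | ⟨-, m, n, rfl⟩
  · exact hzw.translate m n
  · exact hzw.exchange m n

theorem IsSym.comp {half : Prop} {g h : ℝ × ℝ → ℝ × ℝ} (hg : IsSym T half g) (hh : IsSym T half h) :
    IsSym T half (g ∘ h) := by
  rcases hg with ⟨m, n, rfl⟩ | ⟨hf, m, n, rfl⟩ <;> rcases hh with ⟨a, b, rfl⟩ | ⟨hf, a, b, rfl⟩
  · refine Or.inl ⟨a + m, b + n, funext fun z => ?_⟩
    simp only [lat, Function.comp]; ext <;> push_cast <;> ring
  · refine Or.inr ⟨hf, a + m, b + n, funext fun z => ?_⟩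
    simp only [lat, swp, Function.comp]; ext <;> push_cast <;> ring
  · refine Or.inr ⟨hf, b + m, a + n, funext fun z => ?_⟩
    simp only [lat, swp, Function.comp]; ext <;> push_cast <;> ring
  · refine Or.inl ⟨b + m, a + n, funext fun z => ?_⟩
    simp only [lat, swp, Function.comp]; ext <;> push_cast <;> ring

theorem swp_swp_neg (m n : ℤ) (z : ℝ × ℝ) : swp T (-n) (-m) (swp T m n z) = z := by
  unfold swp
  ext <;> push_cast <;> ring

theorem IsSym.exists_inv {half : Prop} {g : ℝ × ℝ → ℝ × ℝ} (h : IsSym T half g) :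
    ∃ g', IsSym T half g' ∧ ∀ z, g' (g z) = z := by
  rcases h with ⟨m, n, rfl⟩ | ⟨hf, m, n, rfl⟩
  · exact ⟨_, Or.inl ⟨-m, -n, rfl⟩, lat_lat_neg m n⟩
  · exact ⟨_, Or.inr ⟨hf, -n, -m, rfl⟩, swp_swp_neg m n⟩

theorem isSym_id (half : Prop) : IsSym T half id :=
  Or.inl ⟨0, 0, by funext z; simp [lat]⟩

/-- A translation whose square has a fixed point is the identity; translations are therefore never
reflections. -/
theorem eq_of_lat_lat {m n : ℤ} {z w : ℝ × ℝ} (h : lat T m n z = w)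
    (h' : lat T m n w = z) : z = w := by
  simp only [lat, Prod.ext_iff] at h h'
  have hm : (m : ℝ) * T = 0 := by linarith [h.1, h'.1]
  have hn : (n : ℝ) * T = 0 := by linarith [h.2, h'.2]
  ext
  · linarith [h.1]
  · linarith [h.2]

/-- No symmetry exchanges the end points of an edge. -/
theorem Adj.not_flip {half : Prop} {g : ℝ × ℝ → ℝ × ℝ} (hg : IsSym T half g) {z w : ℝ × ℝ}
    (h : A.Adj z w) : ¬ (g z = w ∧ g w = z) := by
  rintro ⟨h1, h2⟩
  rcases hg with ⟨m, n, rfl⟩ | ⟨-, m, n, rfl⟩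
  · exact h.ne (eq_of_lat_lat h1 h2)
  -- If an exchange flipped the edge, `θ` would have opposite increments on its two arcs.
  · obtain ⟨a1, -, ⟨k, hk, hk'⟩, -⟩ := h
    simp only [swp, Prod.ext_iff] at h1 h2
    have hb : A.θ z.2 = A.θ w.1 - (m * A.rot : ℤ) * Real.pi := by
      rw [← h1.1, shift_int]; ring
    have hd : A.θ w.2 = A.θ z.1 - (m * A.rot : ℤ) * Real.pi := by
      rw [← h2.1, shift_int]; ring
    exact a1.ne (by linarith)

/-- No exchange of coordinates fixes the end points of an edge. -/
theorem Adj.not_fixed {m n : ℤ} {z w : ℝ × ℝ} (h : A.Adj z w) :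
    ¬ (swp T m n z = z ∧ swp T m n w = w) := by
  rintro ⟨h1, h2⟩
  simp only [swp, Prod.ext_iff] at h1 h2
  exact h.2.2.2 ⟨n, h1.2.symm, h2.2.symm⟩

/-! ### Walks -/

variable (A) in
/-- A doubly infinite walk without turning back in the graph of pairs of marked points. -/
def IsWalk (z : ℤ → ℝ × ℝ) : Prop := ∀ k, A.Adj (z k) (z (k + 1)) ∧ z (k + 2) ≠ z k

theorem Adj.exists_other {z w : ℝ × ℝ} (h : A.Adj z w) :
    ∃ x, x ≠ z ∧ ∀ y, A.Adj w y ↔ y = z ∨ y = x := by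
  obtain ⟨w₁, w₂, hne, hw⟩ := h.symm.vertex.exists_neighbours
  rcases (hw z).1 h.symm with rfl | rfl
  · exact ⟨w₂, hne.symm, hw⟩
  · exact ⟨w₁, hne, fun y => (hw y).trans or_comm⟩

namespace IsWalk

variable {z z' : ℤ → ℝ × ℝ}

theorem adj (h : A.IsWalk z) (k : ℤ) : A.Adj (z k) (z (k + 1)) := (h k).1

theorem shift (h : A.IsWalk z) (j : ℤ) : A.IsWalk fun k => z (j + k) := fun k => by
  have := h (j + k)
  rwa [add_assoc, add_assoc] at this

theorem reverse (h : A.IsWalk z) (j : ℤ) : A.IsWalk fun k => z (j - k) := fun k => by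
  have h1 := (h (j - (k + 1))).1.symm
  have h2 := (h (j - (k + 2))).2.symm
  rw [show j - (k + 1) + 1 = j - k by ring] at h1
  rw [show j - (k + 2) + 2 = j - k by ring] at h2
  exact ⟨h1, h2⟩

theorem map (h : A.IsWalk z) {half : Prop} {g : ℝ × ℝ → ℝ × ℝ} (hg : IsSym T half g) :
    A.IsWalk fun k => g (z k) :=
  fun k => ⟨hg.adj (h k).1, fun e => (h k).2 (hg.injective e)⟩

theorem eq_or_eq (h : A.IsWalk z) {k : ℤ} {w : ℝ × ℝ} (hw : A.Adj (z k) w) :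
    w = z (k + 1) ∨ w = z (k - 1) := by
  have h1 := (h (k - 1)).1
  rw [sub_add_cancel] at h1
  have h2 := (h (k - 1)).2
  rw [show k - 1 + 2 = k + 1 by ring] at h2
  obtain ⟨x, -, hx⟩ := h1.exists_other
  have e : x = z (k + 1) := ((hx _).1 (h k).1).elim (fun e => absurd e h2) Eq.symm
  rcases (hx w).1 hw with e' | e'
  · exact Or.inr e'
  · exact Or.inl (e'.trans e)

theorem eq_of_eq_nat (h : A.IsWalk z) (h' : A.IsWalk z') (h0 : z 0 = z' 0) (h1 : z 1 = z' 1)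
    (n : ℕ) : z n = z' n ∧ z (n + 1) = z' (n + 1) := by
  induction n with
  | zero => exact ⟨by simpa using h0, by simpa using h1⟩
  | succ n ih =>
    refine ⟨by exact_mod_cast ih.2, ?_⟩
    have ha : A.Adj (z' (n + 1)) (z (n + 2)) := by
      rw [← ih.2]
      have := (h (n + 1)).1
      rwa [add_assoc] at this
    have hne : z (n + 2) ≠ z' n := by
      rw [← ih.1]
      exact (h n).2
    have := (h'.eq_or_eq ha).resolve_right (by rwa [add_sub_cancel_right])
    push_cast
    rw [show (n : ℤ) + 1 + 1 = n + 2 by ring] at this ⊢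
    exact this

theorem ext (h : A.IsWalk z) (h' : A.IsWalk z') (h0 : z 0 = z' 0) (h1 : z 1 = z' 1) (k : ℤ) :
    z k = z' k := by
  obtain ⟨n, rfl | rfl⟩ := k.eq_nat_or_neg
  · exact (h.eq_of_eq_nat h' h0 h1 n).1
  · have := ((h.reverse 1).eq_of_eq_nat (h'.reverse 1) (by simpa using h1) (by simpa using h0) n).2
    simpa using this

/-- All vertices have degree two, so one point determines a walk up to its direction. Applied to a
walk and its image under a symmetry, this turns one coincidence into a shift or a reflection of the
whole walk. -/
theorem eq_shift_or_eq_reverse (h : A.IsWalk z) (h' : A.IsWalk z') {i j : ℤ} (hij : z i = z' j) :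
    (∀ m, z (i + m) = z' (j + m)) ∨ (∀ m, z (i - m) = z' (j + m)) := by
  have ha := (h' j).1
  rw [← hij] at ha
  rcases h.eq_or_eq ha with e | e
  · exact Or.inl ((h.shift i).ext (h'.shift j) (by simpa using hij) e.symm)
  · exact Or.inr ((h.reverse i).ext (h'.shift j) (by simpa using hij) e.symm)

/-- No lattice translation reverses a walk. -/
theorem not_lat_reverse (h : A.IsWalk z) {m n i j : ℤ} :
    ¬ ∀ k, lat T m n (z (i - k)) = z (j + k) := by
  intro hk
  -- The translation interchanges `z a` and `z b`, so they are equal. Around the middle of the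
  -- reflection of `ℤ` this yields either a turn back or an edge with equal ends.
  have key : ∀ a b, a + b = i + j → z a = z b := fun a b hab => by
    have h1 := hk (i - a)
    have h2 := hk (i - b)
    rw [sub_sub_cancel, show j + (i - a) = b by linarith] at h1
    rw [sub_sub_cancel, show j + (i - b) = a by linarith] at h2
    exact eq_of_lat_lat h1 h2
  obtain ⟨c, hc | hc⟩ := Int.even_or_odd' (i + j)
  · have := key (c - 1 + 2) (c - 1) (by linarith)
    exact (h (c - 1)).2 this
  · exact (h c).1.ne (key c (c + 1) (by linarith))

end IsWalk

theorem Adj.exists_walk {v w : ℝ × ℝ} (h : A.Adj v w) :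
    ∃ z, A.IsWalk z ∧ z 0 = v ∧ z 1 = w := by
  classical
  let D := {p : (ℝ × ℝ) × (ℝ × ℝ) // A.Adj p.1 p.2}
  choose other hne hother using fun p : D => p.2.exists_other
  let next : D → D := fun p => ⟨(p.1.2, other p), (hother p _).2 (Or.inr rfl)⟩
  -- Stepping to the next directed edge is invertible, the inverse being the step along reversed
  -- edges. Its integer powers give the walk in both directions.
  have hbij : Function.Bijective next := by
    constructor
    · rintro ⟨⟨a, b⟩, hp⟩ ⟨⟨a', b'⟩, hp'⟩ e
      have e1 : b = b' := congrArg (fun p : D => p.1.1) e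
      have e2 : other ⟨(a, b), hp⟩ = other ⟨(a', b'), hp'⟩ := congrArg (fun p : D => p.1.2) e
      subst e1
      have h1 := (hother ⟨(a', b), hp'⟩ a).1 hp.symm
      rw [← e2] at h1
      have h2 : a = a' := h1.resolve_right (hne ⟨(a, b), hp⟩).symm
      subst h2
      rfl
    · rintro ⟨⟨a, b⟩, hp⟩
      let q : D := ⟨(b, a), hp.symm⟩
      have hc : A.Adj (other q) a := ((hother q _).2 (Or.inr rfl)).symm
      refine ⟨⟨(other q, a), hc⟩, ?_⟩
      have := (hother ⟨(other q, a), hc⟩ b).1 hp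
      have e : b = other ⟨(other q, a), hc⟩ := this.resolve_left (hne q).symm
      exact Subtype.ext (Prod.ext rfl e.symm)
  let e : Equiv.Perm D := Equiv.ofBijective next hbij
  let d : D := ⟨(v, w), h⟩
  have hstep : ∀ k : ℤ, (e ^ (k + 1)) d = next ((e ^ k) d) := fun k => by
    rw [add_comm, zpow_add, zpow_one]; rfl
  have hsnd : ∀ k : ℤ, ((e ^ (k + 1)) d).1.1 = ((e ^ k) d).1.2 := fun k => by rw [hstep]
  refine ⟨fun k => ((e ^ k) d).1.1, fun k => ⟨?_, ?_⟩, by simp [d], ?_⟩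
  · change A.Adj ((e ^ k) d).1.1 ((e ^ (k + 1)) d).1.1
    rw [hsnd]
    exact ((e ^ k) d).2
  · have : k + 2 = k + 1 + 1 := by ring
    change ((e ^ (k + 2)) d).1.1 ≠ ((e ^ k) d).1.1
    rw [this, hsnd, hstep]
    exact hne _
  · have := hsnd 0
    simpa [d] using this

/-! ### Segments of walks -/

/-- `g` is a symmetry that is not the identity by its form, if applied to the `i`-th point of a walk
to get the `j`-th. -/
def Nontriv (T : ℝ) (half : Prop) (i j : ℤ) (g : ℝ × ℝ → ℝ × ℝ) : Prop :=
  ((∃ m n, g = lat T m n) ∧ i ≠ j) ∨ (half ∧ ∃ m n, g = swp T m n)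

theorem Nontriv.isSym {half : Prop} {i j : ℤ} {g : ℝ × ℝ → ℝ × ℝ} (h : Nontriv T half i j g) :
    IsSym T half g := h.imp And.left id

theorem Nontriv.exists_inv {half : Prop} {i j : ℤ} {g : ℝ × ℝ → ℝ × ℝ}
    (h : Nontriv T half i j g) : ∃ g', Nontriv T half j i g' ∧ ∀ z, g' (g z) = z := by
  rcases h with ⟨⟨m, n, rfl⟩, hij⟩ | ⟨hf, m, n, rfl⟩
  · exact ⟨_, Or.inl ⟨⟨-m, -n, rfl⟩, hij.symm⟩, lat_lat_neg m n⟩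
  · exact ⟨_, Or.inr ⟨hf, -n, -m, rfl⟩, swp_swp_neg m n⟩

/-- The points `z 0, …, z n` of a walk satisfy the condition for glueing schemes: symmetries relate
only the end points. -/
def IsSegment (T : ℝ) (half : Prop) (z : ℤ → ℝ × ℝ) (n : ℤ) : Prop :=
  0 < n ∧ ∀ i j, 0 ≤ i → i ≤ n → 0 ≤ j → j ≤ n → ∀ g, Nontriv T half i j g → g (z i) = z j →
    (i = 0 ∨ i = n) ∧ (j = 0 ∨ j = n)

variable (A) in
/-- The union of the edges of a segment of a walk. -/
def segmentCarrier (z : ℤ → ℝ × ℝ) (n : ℤ) : Set (AddCircle T × AddCircle T) :=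
  ⋃ i ∈ Set.Ico 0 n, A.edge (z i) (z (i + 1))

theorem edge_subset_segmentCarrier {z : ℤ → ℝ × ℝ} {n i : ℤ} (h0 : 0 ≤ i) (hn : i < n) :
    A.edge (z i) (z (i + 1)) ⊆ A.segmentCarrier z n :=
  Set.subset_biUnion_of_mem (u := fun i => A.edge (z i) (z (i + 1))) (show i ∈ Set.Ico 0 n from ⟨h0, hn⟩)

theorem segmentCarrier_reverse (z : ℤ → ℝ × ℝ) (n : ℤ) :
    A.segmentCarrier (fun k => z (n - k)) n = A.segmentCarrier z n := by
  have key : ∀ z : ℤ → ℝ × ℝ,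
      A.segmentCarrier (fun k => z (n - k)) n ⊆ A.segmentCarrier z n := by
    intro z
    refine Set.iUnion₂_subset fun i hi => ?_
    rw [edge_comm]
    have := edge_subset_segmentCarrier (A := A) (z := z) (n := n) (i := n - (i + 1))
      (by linarith [hi.2]) (by linarith [hi.1])
    rwa [show n - (i + 1) + 1 = n - i by ring] at this
  refine subset_antisymm (key z) ?_
  have := key fun k => z (n - k)
  simpa using this

theorem IsSegment.reverse {half : Prop} {z : ℤ → ℝ × ℝ} {n : ℤ} (h : IsSegment T half z n) :
    IsSegment T half (fun k => z (n - k)) n := by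
  refine ⟨h.1, fun i j hi hi' hj hj' g hg e => ?_⟩
  have hg' : Nontriv T half (n - i) (n - j) g :=
    hg.imp (fun h => ⟨h.1, fun e => h.2 (by linarith)⟩) id
  obtain ⟨h1, h2⟩ := h.2 (n - i) (n - j) (by linarith) (by linarith) (by linarith) (by linarith)
    g hg' e
  constructor <;> omega

variable (A) in
/-- The carrier of the segment is maximal among those of all segments. -/
def IsMaxSegment (half : Prop) (z : ℤ → ℝ × ℝ) (n : ℤ) : Prop :=
  A.IsWalk z ∧ IsSegment T half z n ∧ ∀ z' n', A.IsWalk z' → IsSegment T half z' n' →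
    A.segmentCarrier z n ⊆ A.segmentCarrier z' n' → A.segmentCarrier z' n' ⊆ A.segmentCarrier z n

theorem IsMaxSegment.reverse {half : Prop} {z : ℤ → ℝ × ℝ} {n : ℤ} (h : A.IsMaxSegment half z n) :
    A.IsMaxSegment half (fun k => z (n - k)) n := by
  refine ⟨h.1.reverse n, h.2.1.reverse, ?_⟩
  rw [segmentCarrier_reverse]
  exact h.2.2

/-- An edge in a segment is a translate of one of its edges. -/
theorem Adj.exists_lat_of_subset {z : ℤ → ℝ × ℝ} {n : ℤ} (hz : A.IsWalk z) {v w : ℝ × ℝ}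
    (h : A.Adj v w) (hsub : A.edge v w ⊆ A.segmentCarrier z n) :
    ∃ i, 0 ≤ i ∧ i < n ∧ ∃ a b : ℤ, (lat T a b (z i) = v ∧ lat T a b (z (i + 1)) = w) ∨
      (lat T a b (z i) = w ∧ lat T a b (z (i + 1)) = v) := by
  obtain ⟨p, hp⟩ := h.inner_nonempty
  obtain ⟨i, hi, hpi⟩ := Set.mem_iUnion₂.1 (hsub (inner_subset_edge hp))
  refine ⟨i, hi.1, hi.2, ?_⟩
  obtain ⟨a, b, hab⟩ := h.eq_of_mem_edge (hz.adj i) hp hpi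
  refine ⟨-a, -b, ?_⟩
  rcases hab with ⟨h1, h2⟩ | ⟨h1, h2⟩
  · left; rw [← h1, ← h2, lat_lat_neg, lat_lat_neg]; exact ⟨rfl, rfl⟩
  · right; rw [← h1, ← h2, lat_lat_neg, lat_lat_neg]; exact ⟨rfl, rfl⟩

/-- The last point of a maximal segment is related by a symmetry to one of the two end points. -/
theorem IsMaxSegment.exists_last {half : Prop} {z : ℤ → ℝ × ℝ} {n : ℤ}
    (h : A.IsMaxSegment half z n) :
    ∃ i g, (i = 0 ∨ i = n) ∧ Nontriv T half i n g ∧ g (z i) = z n := by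
  obtain ⟨hz, hseg, hmax⟩ := h
  have hn := hseg.1
  by_contra! hcon
  have hno : ∀ i g, 0 ≤ i → i ≤ n → Nontriv T half i n g → g (z i) ≠ z n :=
    fun i g h0 h1 hg e => hcon i g (hseg.2 i n h0 h1 hn.le le_rfl g hg e).1 hg e
  -- If `z n` were related to no end point, prolonging the segment by one edge would keep it a
  -- segment.
  have hseg' : IsSegment T half z (n + 1) := by
    refine ⟨by omega, ?_⟩
    have main : ∀ i j, 0 ≤ i → i ≤ j → j ≤ n + 1 → ∀ g, Nontriv T half i j g → g (z i) = z j →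
        (i = 0 ∨ i = n + 1) ∧ (j = 0 ∨ j = n + 1) := by
      intro i j h0 hij hj g hg e
      rcases eq_or_lt_of_le hj with rfl | hj
      · refine ⟨?_, Or.inr rfl⟩
        by_contra! hi
        have hi1 : 1 ≤ i := by omega
        have hin : i ≤ n := by omega
        -- A relation between `z i` and the new point `z (n + 1)` moves one step along the walk to a
        -- relation between `z n` and `z (i - 1)` or `z (i + 1)`. The exception is `i = n` in the
        -- reflected case, where an edge would be flipped.
        rcases (hz.map hg.isSym).eq_shift_or_eq_reverse hz e with hs | hs
        · have := hs (-1)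
          rw [show n + 1 + -1 = n by ring] at this
          exact hno (i + -1) g (by omega) (by omega)
            (hg.imp (fun h => ⟨h.1, by omega⟩) id) this
        · have h1 := hs (-1)
          rw [show n + 1 + -1 = n by ring, sub_neg_eq_add] at h1
          rcases hg with ⟨⟨a, b, rfl⟩, -⟩ | hg
          · exact hz.not_lat_reverse hs
          · rcases eq_or_lt_of_le hin with rfl | hin
            · exact (hz.adj i).not_flip (Or.inr hg) ⟨e, h1⟩
            · exact hno (i + 1) g (by omega) (by omega) (Or.inr hg) h1
      · obtain ⟨h1, h2⟩ := hseg.2 i j h0 (by omega) (by omega) (by omega) g hg e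
        rcases h2 with rfl | rfl
        · exact ⟨Or.inl (by omega), Or.inl rfl⟩
        · exact absurd e (hno i g h0 hij hg)
    intro i j h0 hi hj0 hj g hg e
    rcases le_total i j with hij | hij
    · exact main i j h0 hij hj g hg e
    · obtain ⟨g', hg', hinv⟩ := hg.exists_inv
      have := main j i hj0 hij hi g' hg' (by rw [← e, hinv])
      exact this.symm
  have hsub : A.segmentCarrier z n ⊆ A.segmentCarrier z (n + 1) :=
    Set.biUnion_subset_biUnion_left fun i hi => ⟨hi.1, by linarith [hi.2]⟩
  -- By maximality the new edge is already in the carrier, so it is a translate of an old edge; this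
  -- relates `z n` to an earlier point after all.
  have hedge := (edge_subset_segmentCarrier (A := A) (z := z) hn.le (lt_add_one n)).trans
    (hmax z (n + 1) hz hseg' hsub)
  obtain ⟨i, h0, hi, a, b, hab⟩ := (hz.adj n).exists_lat_of_subset hz hedge
  rcases hab with ⟨h1, -⟩ | ⟨h1, h2⟩
  · exact hno i _ h0 hi.le (Or.inl ⟨⟨a, b, rfl⟩, hi.ne⟩) h1
  -- If the new edge is the last one reversed, the translation fixes `z n`, so it is the identity
  -- and the walk turns back.
  · by_cases hin : i + 1 = n
    · have e : i = n - 1 := by omega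
      have e' : z n = z (i + 1) := by rw [hin]
      rw [← e'] at h2
      have := hz (n - 1)
      rw [show n - 1 + 2 = n + 1 by ring, ← h1, ← e] at this
      have ha : lat T a b = id := by
        simp only [lat, Prod.ext_iff] at h2
        funext x
        simp only [lat, id]
        ext <;> simp only <;> linarith [h2.1, h2.2]
      exact this.2 (by rw [ha, id])
    · exact hno (i + 1) _ (by omega) (by omega) (Or.inl ⟨⟨a, b, rfl⟩, hin⟩) h2

/-- The edge from `z k` to `z (k + 1)` is the image by a symmetry of an edge of the segment. -/
def Covered (T : ℝ) (half : Prop) (z : ℤ → ℝ × ℝ) (n k : ℤ) : Prop :=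
  ∃ i, 0 ≤ i ∧ i < n ∧ ∃ g, IsSym T half g ∧ ((g (z i) = z k ∧ g (z (i + 1)) = z (k + 1)) ∨
    (g (z i) = z (k + 1) ∧ g (z (i + 1)) = z k))

theorem Covered.map {half : Prop} {z : ℤ → ℝ × ℝ} {n k l : ℤ} (h : Covered T half z n k)
    {g : ℝ × ℝ → ℝ × ℝ} (hg : IsSym T half g)
    (hgk : (g (z k) = z l ∧ g (z (k + 1)) = z (l + 1)) ∨ (g (z k) = z (l + 1) ∧ g (z (k + 1)) = z l)) :
    Covered T half z n l := by
  obtain ⟨i, h0, hi, g', hg', h⟩ := h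
  refine ⟨i, h0, hi, g ∘ g', hg.comp hg', ?_⟩
  simp only [Function.comp]
  rcases h with ⟨h1, h2⟩ | ⟨h1, h2⟩ <;> rw [h1, h2] <;> tauto

theorem covered_of_periodic {P : ℤ → Prop} {p : ℤ} (hp : 0 < p) (hP : ∀ k, P k ↔ P (k + p))
    (h : ∀ k, 0 ≤ k → k < p → P k) (k : ℤ) : P k := by
  have key : ∀ q k : ℤ, P k ↔ P (k + p * q) := by
    intro q
    induction q with
    | zero => simp
    | succ q ih => intro k; rw [ih k, hP (k + p * q)]; ring_nf
    | pred q ih => intro k; rw [ih k, hP (k + p * (-q - 1))]; ring_nf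
  rw [← Int.emod_add_mul_ediv k p, ← key]
  exact h _ (Int.emod_nonneg _ hp.ne') (Int.emod_lt_of_pos _ hp)

/-- Every edge of a walk is the image by a symmetry of an edge of a maximal segment of it. -/
theorem IsMaxSegment.covered {half : Prop} {z : ℤ → ℝ × ℝ} {n : ℤ} (h : A.IsMaxSegment half z n)
    (k : ℤ) : Covered T half z n k := by
  have hz := h.1
  have hseg := h.2.1
  have hn := hseg.1
  have hbase : ∀ k, 0 ≤ k → k < n → Covered T half z n k := fun k h0 hk =>
    ⟨k, h0, hk, id, isSym_id half, Or.inl ⟨rfl, rfl⟩⟩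
  have hshift : ∀ g, IsSym T half g → (∀ m, g (z m) = z (n + m)) → Covered T half z n k := by
    intro g hg hs
    obtain ⟨g', hg', hinv⟩ := hg.exists_inv
    refine covered_of_periodic hn (fun k => ⟨fun hk => hk.map hg (Or.inl ⟨?_, ?_⟩),
      fun hk => hk.map hg' (Or.inl ⟨?_, ?_⟩)⟩) hbase k
    · rw [hs, add_comm]
    · rw [hs]; ring_nf
    · rw [add_comm, ← hs, hinv]
    · rw [show k + n + 1 = n + (k + 1) by ring, ← hs, hinv]
  -- An exchange that reflects the segment onto itself fixes its middle point, which is forbidden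
  -- inside a segment, or flips its middle edge.
  have hrefl : ∀ g, Nontriv T half 0 n g → ¬ ∀ m, g (z (0 - m)) = z (n + m) := by
    intro g hg hs
    rcases hg with ⟨⟨a, b, rfl⟩, -⟩ | hg
    · exact hz.not_lat_reverse hs
    · obtain ⟨c, hc | hc⟩ := Int.even_or_odd' n
      · have e : g (z c) = z c := by
          have := hs (-c)
          rwa [show 0 - -c = c by ring, show n + -c = c by linarith] at this
        have := hseg.2 c c (by omega) (by omega) (by omega) (by omega) g (Or.inr hg) e
        omega
      · refine (hz.adj c).not_flip (g := g) (Or.inr hg) ⟨?_, ?_⟩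
        · have := hs (-c)
          rwa [show 0 - -c = c by ring, show n + -c = c + 1 by linarith] at this
        · have := hs (-(c + 1))
          rwa [show 0 - -(c + 1) = c + 1 by ring, show n + -(c + 1) = c by linarith] at this
  obtain ⟨i, g, hi, hg, e⟩ := h.exists_last
  obtain ⟨i', g', hi', hg', e'⟩ := h.reverse.exists_last
  rw [sub_self] at e'
  by_cases hi0 : i = 0
  · subst hi0
    rcases (hz.map hg.isSym).eq_shift_or_eq_reverse hz e with hs | hs
    · exact hshift g hg.isSym fun m => by simpa using hs m
    · exact absurd hs (hrefl g hg)
  by_cases hi0' : i' = 0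
  · subst hi0'
    obtain ⟨g'', hg'', hinv⟩ := hg'.exists_inv
    have e'' : g'' (z 0) = z n := by
      rw [← e', hinv, sub_zero]
    have hg3 : Nontriv T half 0 n g'' := hg''.imp (fun h => ⟨h.1, hn.ne⟩) id
    rcases (hz.map hg3.isSym).eq_shift_or_eq_reverse hz e'' with hs | hs
    · exact hshift g'' hg3.isSym fun m => by simpa using hs m
    · exact absurd hs (hrefl g'' hg3)
  obtain rfl : i = n := hi.resolve_left hi0
  obtain rfl : i' = i := hi'.resolve_left hi0'
  rw [sub_self] at e'
  -- In the remaining case each end point is fixed by an exchange. An exchange that also preserved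
  -- the direction of the walk would fix both ends of an edge, so it reflects the walk at that end
  -- point.
  have hfix : ∀ g j, Nontriv T half i' i' g → g (z j) = z j → ∀ m, g (z (j - m)) = z (j + m) := by
    intro g j hg e
    rcases hg with ⟨-, hne⟩ | ⟨hf, a, b, rfl⟩
    · exact absurd rfl hne
    rcases (hz.map (half := half) (Or.inr ⟨hf, a, b, rfl⟩)).eq_shift_or_eq_reverse hz e with hs | hs
    · exact absurd ⟨e, hs 1⟩ (hz.adj j).not_fixed
    · exact hs
  have r1 := hfix g i' hg e
  have r0 := hfix g' 0 hg' e'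
  -- The reflection of the vertices in `i'` takes the edge from `k` to `k + 1` to the one that
  -- starts at `2 i' - 1 - k`; the reflection in `0` takes it to the one at `-1 - k`. Their
  -- composition shifts by `2 i'`.
  have c1 : ∀ k, Covered T half z i' k → Covered T half z i' (2 * i' - 1 - k) := fun k hk =>
    hk.map hg.isSym (Or.inr ⟨by
      have := r1 (i' - k)
      rw [sub_sub_cancel] at this
      rw [this]; ring_nf, by
      have := r1 (i' - (k + 1))
      rw [sub_sub_cancel] at this
      rw [this]; ring_nf⟩)
  have c0 : ∀ k, Covered T half z i' k → Covered T half z i' (-1 - k) := fun k hk =>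
    hk.map hg'.isSym (Or.inr ⟨by
      have := r0 (-k)
      rw [zero_sub, neg_neg] at this
      rw [this]; ring_nf, by
      have := r0 (-(k + 1))
      rw [zero_sub, neg_neg] at this
      rw [this]; ring_nf⟩)
  refine covered_of_periodic (p := 2 * i') (by omega) (fun k => ⟨fun hk => ?_, fun hk => ?_⟩) ?_ k
  · have := c1 _ (c0 _ hk)
    rwa [show 2 * i' - 1 - (-1 - k) = k + 2 * i' by ring] at this
  · have := c0 _ (c1 _ hk)
    rwa [show -1 - (2 * i' - 1 - (k + 2 * i')) = k by ring] at this
  · intro k h0 hk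
    by_cases hki : k < i'
    · exact hbase k h0 hki
    · have := c1 _ (hbase (2 * i' - 1 - k) (by omega) (by omega))
      rwa [show 2 * i' - 1 - (2 * i' - 1 - k) = k by ring] at this

end AngleFunction

namespace AngleFunction

variable {T : ℝ} {A : AngleFunction T}

/-! ### The carrier of a walk -/

variable (A) in
/-- The set of all edges. -/
def edges : Set (Set (AddCircle T × AddCircle T)) := {E | ∃ z w, A.Adj z w ∧ E = A.edge z w}

theorem exists_lat_mem_Icc (A : AngleFunction T) (z : ℝ × ℝ) :
    ∃ m n : ℤ, (lat T m n z).1 ∈ Set.Icc 0 T ∧ (lat T m n z).2 ∈ Set.Icc 0 T := by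
  obtain ⟨m, hm⟩ := A.exists_int_add_mem z.1
  obtain ⟨n, hn⟩ := A.exists_int_add_mem z.2
  exact ⟨m, n, hm, hn⟩

theorem finite_edges : A.edges.Finite := by
  -- An edge can be translated to begin in `[0, T]²`; arcs are no longer than `T`, so it then ends
  -- in `[-T, 2T]²`.
  have hf := A.finite_points (-T) (2 * T)
  refine (((hf.prod hf).prod (hf.prod hf)).image fun q => A.edge q.1 q.2).subset ?_
  rintro _ ⟨z, w, h, rfl⟩
  obtain ⟨m, n, h1, h2⟩ := A.exists_lat_mem_Icc z
  have hT := A.T_pos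
  have hadj := h.translate m n
  have l1 := abs_le.1 (hadj.1.abs_sub_le hT A.points_add)
  have l2 := abs_le.1 (hadj.2.1.abs_sub_le hT A.points_add)
  refine ⟨(lat T m n z, lat T m n w), ⟨⟨⟨hadj.1.1, ?_⟩, hadj.2.1.1, ?_⟩,
    ⟨hadj.1.2.1, ?_⟩, hadj.2.1.2.1, ?_⟩, edge_lat _ _ _ _⟩
  all_goals constructor <;> linarith [h1.1, h1.2, h2.1, h2.2, l1.1, l1.2, l2.1, l2.2]

theorem isClosed_sUnion_edges {s : Set (Set (AddCircle T × AddCircle T))} (hs : s ⊆ A.edges) :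
    IsClosed (⋃₀ s) := by
  rw [Set.sUnion_eq_biUnion]
  refine (finite_edges.subset hs).isClosed_biUnion fun E hE => ?_
  obtain ⟨z, w, -, rfl⟩ := hs hE
  exact isClosed_edge z w

theorem closedPairs_eq : A.closedPairs = ⋃₀ A.edges := by
  refine subset_antisymm (closure_minimal ?_ (isClosed_sUnion_edges subset_rfl)) ?_
  · rintro _ ⟨p, hp, rfl⟩
    obtain ⟨z, w, h, hx⟩ := exists_adj_of_mem_pairs hp
    exact ⟨_, ⟨z, w, h, rfl⟩, hx⟩
  · rintro x ⟨_, ⟨z, w, -, rfl⟩, hx⟩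
    exact edge_subset_closedPairs z w hx

variable (A) in
/-- The union of the edges of a walk. -/
def walkCarrier (z : ℤ → ℝ × ℝ) : Set (AddCircle T × AddCircle T) := ⋃ k, A.edge (z k) (z (k + 1))

theorem edge_subset_walkCarrier (z : ℤ → ℝ × ℝ) (k : ℤ) :
    A.edge (z k) (z (k + 1)) ⊆ A.walkCarrier z :=
  Set.subset_iUnion (fun k => A.edge (z k) (z (k + 1))) k

theorem segmentCarrier_subset_walkCarrier (z : ℤ → ℝ × ℝ) (n : ℤ) :
    A.segmentCarrier z n ⊆ A.walkCarrier z :=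
  Set.iUnion₂_subset fun k _ => edge_subset_walkCarrier z k

namespace IsWalk

variable {z : ℤ → ℝ × ℝ}

theorem walkCarrier_subset (_ : A.IsWalk z) : A.walkCarrier z ⊆ A.closedPairs :=
  Set.iUnion_subset fun _ => edge_subset_closedPairs _ _

theorem isPreconnected_walkCarrier (h : A.IsWalk z) : IsPreconnected (A.walkCarrier z) :=
  IsPreconnected.iUnion_of_chain (fun k => (h.adj k).isPreconnected_edge) fun k =>
    ⟨torus T (z (k + 1)), (h.adj k).right_mem_edge, (h.adj (k + 1)).left_mem_edge⟩

/-- The walk already uses both edges at each of its vertices. -/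
theorem edge_subset_of_lat_eq (h : A.IsWalk z) {v w : ℝ × ℝ} (hvw : A.Adj v w) {m n k : ℤ}
    (e : lat T m n v = z k) : A.edge v w ⊆ A.walkCarrier z := by
  have ha := hvw.translate m n
  rw [← edge_lat v w m n]
  rw [e] at ha ⊢
  rcases h.eq_or_eq ha with e' | e'
  · rw [e']
    exact edge_subset_walkCarrier z k
  · rw [e', edge_comm]
    have := edge_subset_walkCarrier (A := A) z (k - 1)
    rwa [sub_add_cancel] at this

/-- An edge that meets the carrier of a walk is contained in it. -/
theorem edge_subset_of_mem (h : A.IsWalk z) {v w : ℝ × ℝ} (hvw : A.Adj v w)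
    {x : AddCircle T × AddCircle T} (hx : x ∈ A.edge v w) (hxz : x ∈ A.walkCarrier z) :
    A.edge v w ⊆ A.walkCarrier z := by
  obtain ⟨k, hk⟩ := Set.mem_iUnion.1 hxz
  have vert : ∀ {v w}, A.Adj v w → x = torus T v → A.edge v w ⊆ A.walkCarrier z := by
    intro v w hvw e
    rcases (h.adj k).mem_edge hk with e' | e' | ⟨p, hp, e'⟩
    · obtain ⟨m, n, hmn⟩ := torus_eq_iff.1 (e.symm.trans e')
      exact h.edge_subset_of_lat_eq hvw hmn.symm
    · obtain ⟨m, n, hmn⟩ := torus_eq_iff.1 (e.symm.trans e')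
      exact h.edge_subset_of_lat_eq hvw hmn.symm
    · obtain ⟨m, n, rfl⟩ := torus_eq_iff.1 (e.symm.trans e')
      exact absurd ((A.points_add_int m _).2 hvw.1.1) (inner_fst_notMem (h.adj k) hp)
  rcases hvw.mem_edge hx with e | e | ⟨p, hp, rfl⟩
  · exact vert hvw e
  · rw [edge_comm]
    exact vert hvw.symm e
  · obtain ⟨m, n, h1 | h1⟩ := hvw.eq_of_mem_edge (h.adj k) hp hk
    · exact h.edge_subset_of_lat_eq hvw h1.1
    · exact h.edge_subset_of_lat_eq hvw h1.1

/-- The carrier of a walk is a connected component of the closure of the parallel pairs. -/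
theorem subset_walkCarrier (h : A.IsWalk z) {Y : Set (AddCircle T × AddCircle T)}
    (hY : IsPreconnected Y) (hsub : Y ⊆ A.closedPairs) (hne : (Y ∩ A.walkCarrier z).Nonempty) :
    Y ⊆ A.walkCarrier z := by
  have c1 : IsClosed (A.walkCarrier z) := by
    have : A.walkCarrier z = ⋃₀ Set.range fun k => A.edge (z k) (z (k + 1)) := by
      rw [Set.sUnion_range]; rfl
    rw [this]
    refine isClosed_sUnion_edges (A := A) ?_
    rintro _ ⟨k, rfl⟩
    exact ⟨_, _, h.adj k, rfl⟩
  -- Every edge is contained in the carrier or disjoint from it. Since there are finitely many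
  -- edges, this separates `𝒫` into two disjoint closed sets.
  have c2 : IsClosed (⋃₀ {E ∈ A.edges | Disjoint E (A.walkCarrier z)}) :=
    isClosed_sUnion_edges fun E hE => hE.1
  have hd : Disjoint (A.walkCarrier z) (⋃₀ {E ∈ A.edges | Disjoint E (A.walkCarrier z)}) :=
    Set.disjoint_sUnion_right.2 fun E hE => hE.2.symm
  have hcov : Y ⊆ A.walkCarrier z ∪ ⋃₀ {E ∈ A.edges | Disjoint E (A.walkCarrier z)} := by
    intro y hy
    have hy' := hsub hy
    rw [closedPairs_eq] at hy'
    obtain ⟨E, ⟨v, w, hvw, rfl⟩, hyE⟩ := hy'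
    by_cases hdis : Disjoint (A.edge v w) (A.walkCarrier z)
    · exact Or.inr ⟨_, ⟨⟨v, w, hvw, rfl⟩, hdis⟩, hyE⟩
    · obtain ⟨x, hx, hxz⟩ := Set.not_disjoint_iff.1 hdis
      exact Or.inl (h.edge_subset_of_mem hvw hx hxz hyE)
  rcases isPreconnected_iff_subset_of_disjoint_closed.1 hY _ _ c1 c2 hcov
    (by rw [hd.inter_eq, Set.inter_empty]) with h1 | h1
  · exact h1
  · obtain ⟨y, hy, hyz⟩ := hne
    exact absurd (h1 hy) (Set.disjoint_left.1 hd hyz)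

end IsWalk

theorem exists_walk_of_mem_closedPairs {x : AddCircle T × AddCircle T} (hx : x ∈ A.closedPairs) :
    ∃ z, A.IsWalk z ∧ x ∈ A.walkCarrier z := by
  rw [closedPairs_eq] at hx
  obtain ⟨_, ⟨v, w, h, rfl⟩, hx⟩ := hx
  obtain ⟨z, hz, h0, h1⟩ := h.exists_walk
  refine ⟨z, hz, edge_subset_walkCarrier z 0 ?_⟩
  rwa [zero_add, h0, h1]

end AngleFunction

namespace AngleFunction

variable {T : ℝ} {A : AngleFunction T}

/-! ### A defining function of the closure of the parallel pairs -/

variable (A) in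
theorem exists_defining : ∃ Φ : ℝ × ℝ → ℝ, ContDiff ℝ ∞ Φ ∧ ∀ s t,
    Real.sin (A.θ s - A.θ t) = Real.sin (Real.pi * (s - t) / T) * Φ (s, t) := by
  have h1 : ContDiff ℝ ∞ fun p : ℝ × ℝ => Real.sin (A.θ (p.2 + p.1) - A.θ p.2) :=
    Real.contDiff_sin.comp ((A.smooth.comp (by fun_prop)).sub (A.smooth.comp (by fun_prop)))
  -- Since `rot` is even, the sine is periodic without a change of sign.
  have h2 : ∀ t, Function.Periodic (fun x => Real.sin (A.θ (t + x) - A.θ t)) T := by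
    intro t x
    have h1 := A.shift (t + x)
    have h2 := Real.sin_add_int_mul_pi (A.θ (t + x) - A.θ t) A.rot
    rw [A.even_rot.neg_one_zpow, one_mul] at h2
    simp only
    rw [← add_assoc, h1, ← h2]
    ring_nf
  obtain ⟨Q, hQ, h⟩ := exists_contDiff_eq_sin_mul A.T_pos h1 (by simp) h2
  refine ⟨fun p => Q (p.1 - p.2, p.2), hQ.comp (by fun_prop), fun s t => ?_⟩
  rw [← h]
  simp

variable (A) in
/-- A smooth function on the plane that vanishes exactly on the lifts of the closure of the set of
parallel pairs. -/
noncomputable def defining : ℝ × ℝ → ℝ := A.exists_defining.choose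

theorem contDiff_defining : ContDiff ℝ ∞ A.defining := A.exists_defining.choose_spec.1

theorem sin_sub_eq (s t : ℝ) :
    Real.sin (A.θ s - A.θ t) = Real.sin (Real.pi * (s - t) / T) * A.defining (s, t) :=
  A.exists_defining.choose_spec.2 s t

theorem same_iff_sin_eq_zero (A : AngleFunction T) {s t : ℝ} :
    Same T s t ↔ Real.sin (Real.pi * (s - t) / T) = 0 := by
  have hT := A.T_pos
  have hpi := Real.pi_pos
  rw [Real.sin_eq_zero_iff]
  constructor
  · rintro ⟨n, rfl⟩
    exact ⟨-n, by push_cast; field_simp; ring⟩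
  · rintro ⟨n, hn⟩
    refine ⟨-n, ?_⟩
    field_simp at hn
    push_cast
    linarith

theorem par_iff_sin_eq_zero {z : ℝ × ℝ} : A.Par z ↔ Real.sin (A.θ z.1 - A.θ z.2) = 0 := by
  rw [Real.sin_eq_zero_iff]
  constructor
  · rintro ⟨k, hk⟩
    exact ⟨-k, by push_cast; linarith⟩
  · rintro ⟨k, hk⟩
    exact ⟨-k, by push_cast; linarith⟩

theorem dense_sin_ne_zero (A : AngleFunction T) :
    Dense {p : ℝ × ℝ | Real.sin (Real.pi * (p.1 - p.2) / T) ≠ 0} := by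
  have hT := A.T_pos
  have hpi := Real.pi_pos
  have h1 : {x : ℝ | Real.sin (Real.pi * x / T) = 0}.Countable := by
    refine (Set.countable_range fun n : ℤ => (n : ℝ) * T).mono ?_
    intro x hx
    obtain ⟨n, hn⟩ := Real.sin_eq_zero_iff.1 hx
    exact ⟨n, by field_simp at hn; simp only; linarith⟩
  have h2 : Dense {x : ℝ | Real.sin (Real.pi * x / T) = 0}ᶜ := h1.dense_compl ℝ
  have h3 : IsOpenMap fun p : ℝ × ℝ => p.1 - p.2 := by
    let L : ℝ × ℝ →L[ℝ] ℝ := ContinuousLinearMap.fst ℝ ℝ ℝ - ContinuousLinearMap.snd ℝ ℝ ℝ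
    exact L.isOpenMap fun x => ⟨(x, 0), by simp [L]⟩
  exact h2.preimage h3

/-- The sign is that of `sin (π (s - t) / T)` under the translation. Off the diagonals the defining
function is a quotient, and the identity extends by density. -/
theorem exists_defining_lat (A : AngleFunction T) (m n : ℤ) :
    ∃ ε : ℝ, (ε = 1 ∨ ε = -1) ∧ ∀ p, A.defining (lat T m n p) = ε * A.defining p := by
  have hT := A.T_pos
  refine ⟨(-1) ^ (m - n), ?_, fun p => ?_⟩
  · rcases Int.even_or_odd (m - n) with h | h
    · exact Or.inl h.neg_one_zpow
    · exact Or.inr h.neg_one_zpow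
  have hc := (contDiff_defining (A := A)).continuous
  have key : Set.EqOn (fun p => A.defining (lat T m n p)) (fun p => (-1) ^ (m - n) * A.defining p)
      {p : ℝ × ℝ | Real.sin (Real.pi * (p.1 - p.2) / T) ≠ 0} := by
    intro p hp
    have h1 := sin_sub_eq (A := A) (p.1 + m * T) (p.2 + n * T)
    have h2 : Real.pi * (p.1 + m * T - (p.2 + n * T)) / T =
        Real.pi * (p.1 - p.2) / T + (m - n : ℤ) * Real.pi := by
      push_cast; field_simp; ring
    have h3 : A.θ (p.1 + m * T) - A.θ (p.2 + n * T) =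
        A.θ p.1 - A.θ p.2 + ((m - n) * A.rot : ℤ) * Real.pi := by
      rw [shift_int, shift_int]; push_cast; ring
    rw [h2, h3, Real.sin_add_int_mul_pi, Real.sin_add_int_mul_pi, sin_sub_eq,
      (A.even_rot.mul_left _).neg_one_zpow, one_mul] at h1
    have hp' : Real.sin (Real.pi * (p.1 - p.2) / T) ≠ 0 := hp
    have h4 : A.defining p = (-1) ^ (m - n) * A.defining (lat T m n p) := by
      apply mul_left_cancel₀ hp'
      rw [h1]
      simp only [lat]
      ring
    simp only
    rw [h4, ← mul_assoc, ← mul_zpow]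
    simp
  exact congrFun (Continuous.ext_on A.dense_sin_ne_zero
    (hc.comp (by unfold lat; fun_prop)) (by fun_prop) key) p

theorem isOpenMap_torus : IsOpenMap (torus T) :=
  QuotientAddGroup.isOpenMap_coe.prodMap QuotientAddGroup.isOpenMap_coe

theorem cos_ne_zero_of_par {z : ℝ × ℝ} (h : A.Par z) : Real.cos (A.θ z.1 - A.θ z.2) ≠ 0 := by
  intro hc
  have := Real.sin_sq_add_cos_sq (A.θ z.1 - A.θ z.2)
  rw [par_iff_sin_eq_zero.1 h, hc] at this
  norm_num at this

theorem hasDerivAt_defining_fst (s t : ℝ) : HasDerivAt (fun s => A.defining (s, t))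
    (fderiv ℝ A.defining (s, t) (1, 0)) s :=
  (contDiff_defining.differentiable (by simp) (s, t)).hasFDerivAt.comp_hasDerivAt s
    ((hasDerivAt_id s).prodMk (hasDerivAt_const s t))

theorem hasDerivAt_defining_snd (s t : ℝ) : HasDerivAt (fun t => A.defining (s, t))
    (fderiv ℝ A.defining (s, t) (0, 1)) t :=
  (contDiff_defining.differentiable (by simp) (s, t)).hasFDerivAt.comp_hasDerivAt t
    ((hasDerivAt_const t s).prodMk (hasDerivAt_id t))

theorem hasDerivAt_sin_fst (s t : ℝ) : HasDerivAt (fun s => Real.sin (A.θ s - A.θ t))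
    (Real.cos (A.θ s - A.θ t) * deriv A.θ s) s :=
  ((A.differentiable s).hasDerivAt.sub_const _).sin

theorem hasDerivAt_sin_pi_mul (s t : ℝ) : HasDerivAt (fun s => Real.sin (Real.pi * (s - t) / T))
    (Real.cos (Real.pi * (s - t) / T) * (Real.pi / T)) s := by
  have : HasDerivAt (fun s : ℝ => Real.pi * (s - t) / T) (Real.pi / T) s := by
    simpa using (((hasDerivAt_id s).sub_const t).const_mul Real.pi).div_const T
  exact this.sin

/-- The derivative in the first variable of the equation that relates the defining function to the
angle function. -/
theorem cos_mul_deriv_eq (s t : ℝ) : Real.cos (A.θ s - A.θ t) * deriv A.θ s =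
    Real.cos (Real.pi * (s - t) / T) * (Real.pi / T) * A.defining (s, t) +
      Real.sin (Real.pi * (s - t) / T) * fderiv ℝ A.defining (s, t) (1, 0) := by
  have h1 := hasDerivAt_sin_fst (A := A) s t
  have h2 := (hasDerivAt_sin_pi_mul (T := T) s t).mul (hasDerivAt_defining_fst (A := A) s t)
  have : (fun s => Real.sin (A.θ s - A.θ t)) =
    (fun s => Real.sin (Real.pi * (s - t) / T)) * fun s => A.defining (s, t) :=
    funext fun s => sin_sub_eq s t
  rw [this] at h1
  exact h1.unique h2

/-- On the diagonal the defining function is a nonzero multiple of `θ'`: differentiate the defining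
equation once. -/
theorem deriv_eq_zero_of_defining {z : ℝ × ℝ} (h : A.defining z = 0) (hs : Same T z.1 z.2) :
    deriv A.θ z.1 = 0 := by
  have h1 := cos_mul_deriv_eq (A := A) z.1 z.2
  rw [Prod.mk.eta, h, A.same_iff_sin_eq_zero.1 hs] at h1
  simp only [mul_zero, zero_mul, add_zero] at h1
  refine (mul_eq_zero.1 h1).resolve_left (cos_ne_zero_of_par (z := z) ?_)
  rw [par_iff_sin_eq_zero, sin_sub_eq, Prod.mk.eta, h, mul_zero]

theorem par_of_defining {z : ℝ × ℝ} (h : A.defining z = 0) : A.Par z := by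
  rw [par_iff_sin_eq_zero, sin_sub_eq, Prod.mk.eta, h, mul_zero]

/-- Off the diagonal the zeros are the parallel pairs. Zeros on the diagonal are critical points,
hence vertices, which are limits of parallel pairs along an edge. Conversely the zero set is closed
and invariant under the lattice. -/
theorem torus_mem_closedPairs_iff {z : ℝ × ℝ} : torus T z ∈ A.closedPairs ↔ A.defining z = 0 := by
  constructor
  · intro h
    by_contra h0
    have hopen : IsOpen (torus T '' {p | A.defining p ≠ 0}) :=
      isOpenMap_torus _ (isOpen_ne_fun contDiff_defining.continuous continuous_const)
    obtain ⟨_, ⟨p, hp, rfl⟩, q, ⟨hq, hq'⟩, e⟩ := mem_closure_iff.1 h _ hopen ⟨z, h0, rfl⟩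
    obtain ⟨m, n, rfl⟩ := torus_eq_iff.1 e
    obtain ⟨ε, -, hε⟩ := A.exists_defining_lat m n
    have h1 := sin_sub_eq (A := A) q.1 q.2
    rw [par_iff_sin_eq_zero.1 hq] at h1
    have h2 := (mul_eq_zero.1 h1.symm).resolve_left fun e => hq' (A.same_iff_sin_eq_zero.2 e)
    apply hp
    rw [hε, show A.defining q = 0 from h2, mul_zero]
  · intro h
    by_cases hs : Same T z.1 z.2
    · have h0 := deriv_eq_zero_of_defining h hs
      have hv : A.Vertex z := ⟨A.mem_points_of_deriv_eq_zero h0, par_of_defining h, fun _ => h0⟩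
      obtain ⟨w, _, _, hw⟩ := hv.exists_neighbours
      exact edge_subset_closedPairs _ _ ((hw w).2 (Or.inl rfl)).left_mem_edge
    · exact subset_closure ⟨z, ⟨par_of_defining h, hs⟩, rfl⟩

/-! ### The vector field -/

variable (A) in
/-- The Hamiltonian vector field of the defining function. -/
noncomputable def field (p : ℝ × ℝ) : ℝ × ℝ :=
  (fderiv ℝ A.defining p (0, 1), -fderiv ℝ A.defining p (1, 0))

theorem contDiff_field : ContDiff ℝ ∞ A.field := by
  have h : ContDiff ℝ ∞ (fderiv ℝ A.defining) := contDiff_defining.fderiv_right (m := ∞) (by simp)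
  exact (h.clm_apply contDiff_const).prodMk (h.clm_apply contDiff_const).neg

/-- Off the diagonal, a vanishing gradient makes both points critical, so equal modulo the period.
On the diagonal, where `θ' = 0`, differentiating the defining equation twice in the first variable
would give `θ'' = 0`. -/
theorem field_ne_zero {z : ℝ × ℝ} (h : A.defining z = 0) : A.field z ≠ 0 := by
  obtain ⟨s, t⟩ := z
  intro h0
  have hs0 : fderiv ℝ A.defining (s, t) (1, 0) = 0 := neg_eq_zero.1 (congrArg Prod.snd h0)
  have ht0 : fderiv ℝ A.defining (s, t) (0, 1) = 0 := congrArg Prod.fst h0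
  have hcos := cos_ne_zero_of_par (par_of_defining h)
  by_cases hsame : Same T s t
  · have hd := deriv_eq_zero_of_defining h hsame
    have hsin := A.same_iff_sin_eq_zero.1 hsame
    simp only at hd hcos
    have hΦ' : ContDiff ℝ ∞ fun s => fderiv ℝ A.defining (s, t) (1, 0) :=
      ((contDiff_defining.fderiv_right (m := ∞) (by simp)).clm_apply contDiff_const).comp
        (contDiff_id.prodMk contDiff_const)
    have e1 : HasDerivAt (fun s => Real.cos (A.θ s - A.θ t) * deriv A.θ s) _ s :=
      (((A.differentiable s).hasDerivAt.sub_const (A.θ t)).cos).mul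
        (A.smooth_deriv.differentiable (by simp) s).hasDerivAt
    have hcosd : DifferentiableAt ℝ
        (fun s : ℝ => Real.cos (Real.pi * (s - t) / T) * (Real.pi / T)) s := by fun_prop
    have e2 := (hcosd.hasDerivAt.mul (hasDerivAt_defining_fst (A := A) s t)).add
      ((hasDerivAt_sin_pi_mul (T := T) s t).mul (hΦ'.differentiable (by simp) s).hasDerivAt)
    have heq : (fun s => Real.cos (A.θ s - A.θ t) * deriv A.θ s) =
      ((fun s : ℝ => Real.cos (Real.pi * (s - t) / T) * (Real.pi / T)) *
        fun s => A.defining (s, t)) + (fun s => Real.sin (Real.pi * (s - t) / T)) *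
        fun s => fderiv ℝ A.defining (s, t) (1, 0) := funext fun s => cos_mul_deriv_eq s t
    rw [heq] at e1
    have := e1.unique e2
    rw [hs0, hd, hsin, h] at this
    simp only [mul_zero, zero_mul, add_zero, zero_add] at this
    exact (mul_ne_zero hcos (A.morse s hd)) this
  · have hne : Real.sin (Real.pi * (s - t) / T) ≠ 0 := fun e => hsame (A.same_iff_sin_eq_zero.2 e)
    have h1 := cos_mul_deriv_eq (A := A) s t
    rw [h, hs0, mul_zero, mul_zero, add_zero] at h1
    have h1' := (mul_eq_zero.1 h1).resolve_left hcos
    have e1 : HasDerivAt (fun t => Real.sin (A.θ s - A.θ t)) _ t :=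
      ((A.differentiable t).hasDerivAt.const_sub (A.θ s)).sin
    have hd : DifferentiableAt ℝ (fun t : ℝ => Real.sin (Real.pi * (s - t) / T)) t := by fun_prop
    have e2 := hd.hasDerivAt.mul (hasDerivAt_defining_snd (A := A) s t)
    have heq : (fun t => Real.sin (A.θ s - A.θ t)) =
      (fun t : ℝ => Real.sin (Real.pi * (s - t) / T)) * fun t => A.defining (s, t) :=
      funext fun t => sin_sub_eq s t
    rw [heq] at e1
    have h2 := e1.unique e2
    rw [h, ht0, mul_zero, mul_zero, add_zero] at h2
    have h2' := neg_eq_zero.1 ((mul_eq_zero.1 h2).resolve_left hcos)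
    exact hsame (same_of_crit h1' h2' (par_of_defining h))

theorem lat_eq_add (m n : ℤ) (p : ℝ × ℝ) : lat T m n p = p + (m * T, n * T) := rfl

theorem exists_field_lat (A : AngleFunction T) (m n : ℤ) :
    ∃ ε : ℝ, (ε = 1 ∨ ε = -1) ∧ ∀ p, A.field (lat T m n p) = ε • A.field p := by
  obtain ⟨ε, hε, h⟩ := A.exists_defining_lat m n
  refine ⟨ε, hε, fun p => ?_⟩
  have key : fderiv ℝ A.defining (lat T m n p) = ε • fderiv ℝ A.defining p := by
    rw [lat_eq_add, ← fderiv_comp_add_right]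
    have : (fun p => A.defining (p + (m * T, n * T))) = fun p => ε • A.defining p := funext h
    rw [this, fderiv_fun_const_smul (contDiff_defining.differentiable (by simp) p)]
  unfold field
  rw [key]
  simp

theorem exists_bound {E : Type*} [NormedAddCommGroup E] (A : AngleFunction T) {f : ℝ × ℝ → E}
    (hf : Continuous f) (hper : ∀ m n p, ‖f (lat T m n p)‖ = ‖f p‖) :
    ∃ C : NNReal, ∀ p, ‖f p‖ ≤ C := by
  obtain ⟨C, hC⟩ := ((isCompact_Icc (a := (0 : ℝ)) (b := T)).prod
    (isCompact_Icc (a := (0 : ℝ)) (b := T))).exists_bound_of_continuousOn hf.continuousOn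
  refine ⟨C.toNNReal, fun p => ?_⟩
  obtain ⟨m, n, h1, h2⟩ := A.exists_lat_mem_Icc p
  rw [← hper m n]
  exact (hC _ ⟨h1, h2⟩).trans (Real.le_coe_toNNReal C)

/-- Up to sign the field is periodic for the lattice, so compactness of one cell bounds it and its
derivative; its integral curves exist for all times. -/
theorem exists_bounded_lipschitz (A : AngleFunction T) :
    ∃ K L : NNReal, LipschitzWith K A.field ∧ ∀ p, ‖A.field p‖ ≤ L := by
  have hone : ∀ {ε : ℝ}, (ε = 1 ∨ ε = -1) → ‖ε‖ = 1 := by rintro ε (rfl | rfl) <;> simp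
  obtain ⟨L, hL⟩ := A.exists_bound contDiff_field.continuous fun m n p => by
    obtain ⟨ε, hε, h⟩ := A.exists_field_lat m n
    rw [h, norm_smul, hone hε, one_mul]
  obtain ⟨K, hK⟩ := A.exists_bound (contDiff_field.continuous_fderiv (by simp)) fun m n p => by
    obtain ⟨ε, hε, h⟩ := A.exists_field_lat m n
    have key : fderiv ℝ A.field (lat T m n p) = ε • fderiv ℝ A.field p := by
      rw [lat_eq_add, ← fderiv_comp_add_right]
      have : (fun p => A.field (p + (m * T, n * T))) = fun p => ε • A.field p := funext h
      rw [this, fderiv_fun_const_smul (contDiff_field.differentiable (by simp) p)]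
    rw [key, norm_smul, hone hε, one_mul]
  exact ⟨K, L, lipschitzWith_of_nnnorm_fderiv_le (contDiff_field.differentiable (by simp)) hK, hL⟩

/-! ### Orbits as immersed parameterizations of the components -/

variable (A) in
/-- `γ` is an integral curve of the vector field in the zero set of the defining function. -/
def IsOrbit (γ : ℝ → ℝ × ℝ) : Prop :=
  A.defining (γ 0) = 0 ∧ ∀ u, HasDerivAt γ (A.field (γ u)) u

theorem exists_isOrbit {p : ℝ × ℝ} (hp : A.defining p = 0) : ∃ γ, A.IsOrbit γ ∧ γ 0 = p := by
  obtain ⟨K, L, hK, hL⟩ := A.exists_bounded_lipschitz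
  obtain ⟨γ, h0, hγ⟩ := exists_forall_hasDerivAt_of_bounded_lipschitz hK hL p
  exact ⟨γ, ⟨by rw [h0]; exact hp, hγ⟩, h0⟩

theorem fderiv_defining_apply (p v : ℝ × ℝ) : fderiv ℝ A.defining p v =
    -(A.field p).2 * v.1 + (A.field p).1 * v.2 := by
  have : v = v.1 • ((1 : ℝ), (0 : ℝ)) + v.2 • ((0 : ℝ), (1 : ℝ)) := by ext <;> simp
  conv_lhs => rw [this]
  rw [map_add, map_smul, map_smul]
  simp only [field, smul_eq_mul]
  ring

namespace IsOrbit

variable {γ γ' : ℝ → ℝ × ℝ}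

theorem defining_eq_zero (h : A.IsOrbit γ) (u : ℝ) : A.defining (γ u) = 0 := by
  have hd : ∀ u, HasDerivAt (fun u => A.defining (γ u)) 0 u := fun u => by
    have := ((contDiff_defining (A := A)).differentiable (by simp)
      (γ u)).hasFDerivAt.comp_hasDerivAt u (h.2 u)
    rwa [fderiv_defining_apply, neg_mul, mul_comm, neg_add_cancel] at this
  have := is_const_of_deriv_eq_zero (fun u => (hd u).differentiableAt) (fun u => (hd u).deriv) u 0
  exact this.trans h.1

theorem mem_closedPairs (h : A.IsOrbit γ) (u : ℝ) : torus T (γ u) ∈ A.closedPairs :=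
  torus_mem_closedPairs_iff.2 (h.defining_eq_zero u)

theorem shift (h : A.IsOrbit γ) (a : ℝ) : A.IsOrbit fun u => γ (a + u) :=
  ⟨h.defining_eq_zero _, fun u => (h.2 (a + u)).comp_const_add a u⟩

/-- Two orbits through the same point of the torus have the same image. -/
theorem exists_torus_eq (h : A.IsOrbit γ) (h' : A.IsOrbit γ') (e : torus T (γ 0) = torus T (γ' 0))
    (u : ℝ) : ∃ v, torus T (γ v) = torus T (γ' u) := by
  obtain ⟨m, n, hmn⟩ := torus_eq_iff.1 e
  obtain ⟨ε, hε, hf⟩ := A.exists_field_lat m n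
  obtain ⟨K, -, hK, -⟩ := A.exists_bounded_lipschitz
  have hεε : ε * ε = 1 := by rcases hε with rfl | rfl <;> norm_num
  -- The translation may reverse the field; running time backwards compensates for this.
  have hcurve : ∀ u, HasDerivAt (fun u => lat T m n (γ (ε * u)))
      (A.field (lat T m n (γ (ε * u)))) u := by
    intro u
    have h1 : HasDerivAt (fun u : ℝ => ε * u) ε u := by
      simpa using (hasDerivAt_id u).const_mul ε
    have h2 := ((h.2 (ε * u)).scomp u h1).add_const ((m * T, n * T) : ℝ × ℝ)
    rw [hf]
    exact h2
  have := ODE_solution_unique_univ (v := fun _ => A.field) (s := fun _ => Set.univ) (t₀ := 0)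
    (fun _ => hK.lipschitzOnWith) (fun u => ⟨hcurve u, Set.mem_univ _⟩)
    (fun u => ⟨h'.2 u, Set.mem_univ _⟩) (by simp [hmn])
  exact ⟨ε * u, by rw [← this, torus_lat]⟩

/-- Near an orbit the zero set of the defining function contains nothing but the orbit. -/
theorem eventually_mem_range (h : A.IsOrbit γ) :
    ∀ᶠ q in nhds (γ 0), A.defining q = 0 → ∃ u, γ u = q := by
  set p := γ 0 with hp
  set a := (A.field p).1 with ha
  set b := (A.field p).2 with hb
  have hD : a ^ 2 + b ^ 2 ≠ 0 := by
    intro h0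
    apply field_ne_zero h.1
    have h1 : a = 0 := by nlinarith [sq_nonneg a, sq_nonneg b]
    have h2 : b = 0 := by nlinarith [sq_nonneg a, sq_nonneg b]
    exact Prod.ext h1 h2
  let l : ℝ × ℝ →L[ℝ] ℝ :=
    a • ContinuousLinearMap.fst ℝ ℝ ℝ + b • ContinuousLinearMap.snd ℝ ℝ ℝ
  let l' : ℝ × ℝ →L[ℝ] ℝ :=
    -b • ContinuousLinearMap.fst ℝ ℝ ℝ + a • ContinuousLinearMap.snd ℝ ℝ ℝ
  let i₁ : ℝ × ℝ →L[ℝ] ℝ := (a ^ 2 + b ^ 2)⁻¹ •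
    (a • ContinuousLinearMap.fst ℝ ℝ ℝ - b • ContinuousLinearMap.snd ℝ ℝ ℝ)
  let i₂ : ℝ × ℝ →L[ℝ] ℝ := (a ^ 2 + b ^ 2)⁻¹ •
    (b • ContinuousLinearMap.fst ℝ ℝ ℝ + a • ContinuousLinearMap.snd ℝ ℝ ℝ)
  let e : (ℝ × ℝ) ≃L[ℝ] (ℝ × ℝ) := ContinuousLinearEquiv.equivOfInverse (l.prod l') (i₁.prod i₂)
    (fun x => by simp [l, l', i₁, i₂]; ext <;> simp <;> field_simp <;> ring)
    (fun x => by simp [l, l', i₁, i₂]; ext <;> simp <;> field_simp <;> ring)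
  -- With `l` the component along the field, `(l, Φ)` is a local chart. The function `l ∘ γ` has
  -- nonzero derivative at `0`, so the orbit takes all values of `l` near `l p` while `Φ = 0`, and
  -- it fills the zero set near `p`.
  have hF : HasStrictFDerivAt (fun q => (l q, A.defining q)) (e : ℝ × ℝ →L[ℝ] ℝ × ℝ) p := by
    have h1 := l.hasStrictFDerivAt (x := p) |>.prodMk
      ((contDiff_defining (A := A)).contDiffAt (x := p) |>.hasStrictFDerivAt (by simp))
    have he : (e : ℝ × ℝ →L[ℝ] ℝ × ℝ) = l.prod (fderiv ℝ A.defining p) := by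
      refine ContinuousLinearMap.ext fun v => Prod.ext rfl ?_
      rw [ContinuousLinearMap.prod_apply, fderiv_defining_apply]
      simp [e, l', ← ha, ← hb]
    rw [he]
    exact h1
  have hinj := hF.eventually_left_inverse
  have hγ : HasStrictDerivAt (fun u => l (γ u)) (a ^ 2 + b ^ 2) 0 := by
    have hsm := contDiff_of_forall_hasDerivAt contDiff_field h.2
    have h1 : ContDiff ℝ ∞ fun u => l (γ u) := l.contDiff.comp hsm
    have h2 : HasDerivAt (fun u => l (γ u)) (a ^ 2 + b ^ 2) 0 := by
      have hl : l (A.field (γ 0)) = a ^ 2 + b ^ 2 := by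
        simp [l, ha, hb, hp, sq]
      rw [← hl]
      exact l.hasFDerivAt.comp_hasDerivAt 0 (h.2 0)
    exact h1.contDiffAt.hasStrictDerivAt' h2 (by simp)
  have hmap : Filter.map (fun u => l (γ u)) (nhds 0) = nhds (l p) := hγ.map_nhds_eq hD
  have hev : ∀ᶠ u in nhds (0 : ℝ), hF.localInverse _ _ _ (l (γ u), A.defining (γ u)) = γ u :=
    (h.2 0).continuousAt.eventually hinj
  have himg : ∀ᶠ y in nhds (l p), ∃ u, hF.localInverse _ _ _ (l (γ u), A.defining (γ u)) = γ u ∧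
      l (γ u) = y := by
    rw [← hmap, Filter.eventually_map]
    filter_upwards [hev] with u hu
    exact ⟨u, hu, rfl⟩
  filter_upwards [hinj, l.continuous.continuousAt.eventually himg] with q hq hy h0
  obtain ⟨u, hu, hlu⟩ := hy
  refine ⟨u, ?_⟩
  rw [← hu, hlu, h.defining_eq_zero u, ← h0]
  exact hq

end IsOrbit

/-- The carrier of a walk is traced out by an immersed curve. -/
theorem IsWalk.exists_trace {z : ℤ → ℝ × ℝ} (h : A.IsWalk z) :
    ∃ γ : ℝ → ℝ × ℝ, ContDiff ℝ ∞ γ ∧ (∀ u, deriv γ u ≠ 0) ∧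
      (∀ u, torus T (γ u) ∈ A.closedPairs) ∧ A.walkCarrier z = Set.range fun u => torus T (γ u) := by
  have hx : torus T (z 0) ∈ A.walkCarrier z := edge_subset_walkCarrier z 0 (h.adj 0).left_mem_edge
  obtain ⟨γ, hγ, h0⟩ := exists_isOrbit
    (torus_mem_closedPairs_iff.1 (h.walkCarrier_subset hx))
  have hsm := contDiff_of_forall_hasDerivAt contDiff_field hγ.2
  refine ⟨γ, hsm, fun u => ?_, hγ.mem_closedPairs, subset_antisymm ?_ ?_⟩
  · rw [(hγ.2 u).deriv]
    exact field_ne_zero (hγ.defining_eq_zero u)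
  · intro y hy
    -- Lying on a common orbit is symmetric, transitive and holds for nearby points of the carrier,
    -- so by connectedness it holds for all.
    have key := h.isPreconnected_walkCarrier.induction₂ (fun x y => ∃ γ, A.IsOrbit γ ∧
      torus T (γ 0) = x ∧ ∃ u, torus T (γ u) = y) ?_ ?_ ?_ hx hy
    · obtain ⟨γ', hγ', h0', u, hu⟩ := key
      obtain ⟨v, hv⟩ := hγ.exists_torus_eq hγ' (by rw [h0, h0']) u
      exact ⟨v, hv.trans hu⟩
    · rintro x hxW
      obtain ⟨p, rfl⟩ : ∃ p, torus T p = x := by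
        obtain ⟨⟨s, hs⟩, t, ht⟩ := And.intro (QuotientAddGroup.mk_surjective x.1)
          (QuotientAddGroup.mk_surjective x.2)
        exact ⟨(s, t), Prod.ext hs ht⟩
      obtain ⟨γ', hγ', h0'⟩ := exists_isOrbit
        (torus_mem_closedPairs_iff.1 (h.walkCarrier_subset hxW))
      have hnear := hγ'.eventually_mem_range
      rw [h0'] at hnear
      have himg := isOpenMap_torus (T := T) |>.image_mem_nhds hnear
      filter_upwards [nhdsWithin_le_nhds himg, self_mem_nhdsWithin] with y hy hyW
      obtain ⟨q, hq, rfl⟩ := hy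
      obtain ⟨u, hu⟩ := hq (torus_mem_closedPairs_iff.1 (h.walkCarrier_subset hyW))
      exact ⟨γ', hγ', by rw [h0'], u, by rw [hu]⟩
    · rintro x y w - - - ⟨γ₁, h₁, e₁, u₁, rfl⟩ ⟨γ₂, h₂, e₂, u₂, rfl⟩
      obtain ⟨v, hv⟩ := (h₁.shift u₁).exists_torus_eq h₂ (by simp [e₂]) u₂
      exact ⟨γ₁, h₁, e₁, u₁ + v, hv⟩
    · rintro x y - - ⟨γ', h', rfl, u, rfl⟩
      exact ⟨fun v => γ' (u + v), h'.shift u, by simp, -u, by simp⟩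
  · refine h.subset_walkCarrier (isPreconnected_range (continuous_torus.comp hsm.continuous)) ?_
      ⟨torus T (z 0), ⟨0, by simp [h0]⟩, hx⟩
    rintro _ ⟨u, rfl⟩
    exact hγ.mem_closedPairs u

end AngleFunction

/-! ### The angle function of a generic curve -/

namespace AngleFunction

variable {T : ℝ} {A : AngleFunction T}

/-- A critical value of the angle function is never the only one modulo `π`. -/
theorem exists_other_crit {s : ℝ} (hs : deriv A.θ s = 0) :
    ∃ t, deriv A.θ t = 0 ∧ ¬ ∃ k : ℤ, A.θ t = A.θ s + k * Real.pi := by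
  by_contra! hall
  have hT := A.T_pos
  have hzero : ∀ t, deriv A.θ t = 0 → ∃ n : ℤ, t = s + n * T := fun t ht =>
    A.inj s t hs ht (hall t ht)
  have hcont : Continuous (deriv A.θ) := A.smooth_deriv.continuous
  have hne : ∀ t ∈ Set.Ioo s (s + T), deriv A.θ t ≠ 0 := by
    rintro t ⟨h1, h2⟩ ht
    obtain ⟨n, rfl⟩ := hzero t ht
    have h3 : (0 : ℝ) < n := by
      by_contra! h
      nlinarith
    have h4 : (n : ℝ) < 1 := by
      by_contra! h
      nlinarith
    have : (0 : ℤ) < n ∧ n < 1 := ⟨by exact_mod_cast h3, by exact_mod_cast h4⟩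
    omega
  have hred : ∀ x, ∃ y ∈ Set.Ico s (s + T), deriv A.θ x = deriv A.θ y := by
    intro x
    obtain ⟨n, hn, -⟩ := existsUnique_add_zsmul_mem_Ico hT x s
    rw [zsmul_eq_mul] at hn
    exact ⟨_, hn, (A.deriv_shift n x).symm⟩
  -- With one zero per period, `θ'` cannot change sign, so the zero is an extremum of `θ'` and `θ''
  -- = 0` there.
  have hsign : (∀ x, 0 ≤ deriv A.θ x) ∨ ∀ x, deriv A.θ x ≤ 0 := by
    by_contra! h
    obtain ⟨⟨x, hx⟩, y, hy⟩ := h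
    obtain ⟨x', hx', ex⟩ := hred x
    obtain ⟨y', hy', ey⟩ := hred y
    rw [ex] at hx
    rw [ey] at hy
    have hx'' : x' ∈ Set.Ioo s (s + T) := ⟨lt_of_le_of_ne hx'.1 fun e => by
      rw [← e, hs] at hx; exact lt_irrefl _ hx, hx'.2⟩
    have hy'' : y' ∈ Set.Ioo s (s + T) := ⟨lt_of_le_of_ne hy'.1 fun e => by
      rw [← e, hs] at hy; exact lt_irrefl _ hy, hy'.2⟩
    obtain ⟨t, ht, h0⟩ := isPreconnected_Ioo.intermediate_value hx'' hy'' hcont.continuousOn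
      ⟨hx.le, hy.le⟩
    exact hne t ht h0
  apply A.morse s hs
  rcases hsign with h | h
  · exact IsLocalMin.deriv_eq_zero (Filter.Eventually.of_forall fun x => by rw [hs]; exact h x)
  · exact IsLocalMax.deriv_eq_zero (Filter.Eventually.of_forall fun x => by rw [hs]; exact h x)

/-- A gap of length `π` would leave only one mark modulo `π`, but there are always at least two
critical values. Strictness ensures that the ends of an arc have different directions and that its
image is a proper interval of `ℝ / πℤ`. -/
theorem Arc.abs_sub_lt {u v : ℝ} (h : A.Arc u v) (hc : A.critValues.Nonempty) :
    |A.θ v - A.θ u| < Real.pi := by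
  have hgap := h.isGap
  have hle := hgap.abs_sub_le Real.pi_pos A.marks_add
  refine lt_of_le_of_ne hle fun he => ?_
  have hmarks : A.marks = A.critValues := if_pos hc
  obtain ⟨c, hcu⟩ : ∃ c, ∀ x, x ∈ A.marks → ∃ k : ℤ, x = c + k * Real.pi := by
    rcases lt_or_gt_of_ne h.ne with hlt | hlt
    all_goals
      refine ⟨min (A.θ u) (A.θ v), fun x hx => ?_⟩
      obtain ⟨n, hn, -⟩ := existsUnique_add_zsmul_mem_Ico Real.pi_pos x (min (A.θ u) (A.θ v))
      rw [zsmul_eq_mul] at hn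
      have hmem := (A.marks_add_int n x).2 hx
      rcases eq_or_lt_of_le hn.1 with e | e
      · exact ⟨-n, by push_cast; linarith⟩
      · refine absurd hmem (hgap.2.2.2 _ ⟨e, lt_of_lt_of_eq hn.2 ?_⟩)
        first
        | rw [min_eq_left hlt.le, max_eq_right hlt.le]
          rw [abs_of_pos (sub_pos.2 hlt)] at he
          linarith
        | rw [min_eq_right (le_of_lt hlt), max_eq_left (le_of_lt hlt)]
          rw [abs_of_neg (sub_neg.2 hlt)] at he
          linarith
  obtain ⟨x, s, k, hs, -⟩ := hc
  obtain ⟨t, ht, hst⟩ := A.exists_other_crit hs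
  have hcrit : ∀ r, deriv A.θ r = 0 → A.θ r ∈ A.marks := fun r hr => by
    rw [hmarks]
    exact ⟨r, 0, hr, by simp⟩
  obtain ⟨k₁, h₁⟩ := hcu _ (hcrit s hs)
  obtain ⟨k₂, h₂⟩ := hcu _ (hcrit t ht)
  exact hst ⟨k₂ - k₁, by push_cast; linarith⟩

end AngleFunction

/-- The projection of a short interval to the circle is an open arc. -/
theorem AddCircle.image_coe_Ioo {p : ℝ} [hp : Fact (0 < p)] {x y : ℝ} (hxy : x < y)
    (hyx : y < x + p) :
    ((↑) : ℝ → AddCircle p) '' Set.Ioo x y = Set.cIoo (x : AddCircle p) (y : AddCircle p) := by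
  have key : ∀ c : ℝ, sbtw (x : AddCircle p) (c : AddCircle p) (y : AddCircle p) ↔
      toIocMod hp.out x c < y := by
    intro c
    rw [sbtw_iff_not_btw, btw_cyclic, QuotientAddGroup.btw_coe_iff, not_le,
      (toIcoMod_eq_self hp.out).2 ⟨hxy.le, hyx⟩]
  ext c
  constructor
  · rintro ⟨c, hc, rfl⟩
    refine (key c).2 ?_
    rw [(toIocMod_eq_self hp.out).2 ⟨hc.1, (hc.2.trans hyx).le⟩]
    exact hc.2
  · obtain ⟨c, rfl⟩ := QuotientAddGroup.mk_surjective c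
    intro hc
    refine ⟨toIocMod hp.out x c, ⟨(toIocMod_mem_Ioc hp.out x c).1, (key c).1 hc⟩, ?_⟩
    rw [AngleFunction.coe_eq_coe_iff]
    exact ⟨toIocDiv hp.out x c, by rw [← zsmul_eq_mul, toIocMod_add_toIocDiv_zsmul]⟩

/-! ### The turning angle of a closed curve -/

namespace RegularClosedCurve

variable {M : RegularClosedCurve}

theorem contDiff_deriv (M : RegularClosedCurve) : ContDiff ℝ ∞ (deriv M.toFun) :=
  (contDiff_infty_iff_deriv.1 M.contDiff).2

theorem contDiff_deriv_deriv (M : RegularClosedCurve) : ContDiff ℝ ∞ (deriv (deriv M.toFun)) :=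
  (contDiff_infty_iff_deriv.1 M.contDiff_deriv).2

variable (M) in
/-- The logarithmic derivative of the velocity. -/
noncomputable def logRate (s : ℝ) : ℂ := deriv (deriv M.toFun) s / deriv M.toFun s

theorem contDiff_logRate : ContDiff ℝ ∞ M.logRate := by
  rw [show M.logRate = fun s => deriv (deriv M.toFun) s * (deriv M.toFun s)⁻¹ from
    funext fun s => div_eq_mul_inv _ _]
  exact M.contDiff_deriv_deriv.mul (M.contDiff_deriv.inv M.regular)

variable (M) in
/-- A smooth logarithm of the velocity relative to the velocity at `0`. -/
noncomputable def logVelocity (s : ℝ) : ℂ := ∫ u in (0 : ℝ)..s, M.logRate u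

theorem hasDerivAt_logVelocity (s : ℝ) : HasDerivAt M.logVelocity (M.logRate s) s :=
  (contDiff_logRate.continuous.integral_hasStrictDerivAt 0 s).hasDerivAt

theorem contDiff_logVelocity : ContDiff ℝ ∞ M.logVelocity := by
  rw [contDiff_infty_iff_deriv]
  refine ⟨fun s => (hasDerivAt_logVelocity s).differentiableAt, ?_⟩
  rw [show deriv M.logVelocity = M.logRate from funext fun s => (hasDerivAt_logVelocity s).deriv]
  exact contDiff_logRate

theorem deriv_eq_mul_exp (s : ℝ) :
    deriv M.toFun s = deriv M.toFun 0 * Complex.exp (M.logVelocity s) := by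
  have hd : ∀ s, HasDerivAt (fun s => deriv M.toFun s * Complex.exp (-M.logVelocity s)) 0 s := by
    intro s
    have h1 := (M.contDiff_deriv.differentiable (by simp) s).hasDerivAt.mul
      (hasDerivAt_logVelocity (M := M) s).fun_neg.cexp
    have h2 : deriv (deriv M.toFun) s * Complex.exp (-M.logVelocity s) +
        deriv M.toFun s * (Complex.exp (-M.logVelocity s) * -M.logRate s) = 0 := by
      have := M.regular s
      unfold logRate
      field_simp
      ring
    rwa [h2] at h1
  have := is_const_of_deriv_eq_zero (fun s => (hd s).differentiableAt) (fun s => (hd s).deriv) s 0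
  have h0 : M.logVelocity 0 = 0 := intervalIntegral.integral_same
  simp only [h0, neg_zero, Complex.exp_zero, mul_one] at this
  rw [← this, mul_assoc, ← Complex.exp_add, neg_add_cancel, Complex.exp_zero, mul_one]

theorem deriv_div_deriv (s t : ℝ) :
    deriv M.toFun t / deriv M.toFun s = Complex.exp (M.logVelocity t - M.logVelocity s) := by
  rw [div_eq_iff (M.regular s), deriv_eq_mul_exp s, deriv_eq_mul_exp t, mul_left_comm,
    ← Complex.exp_add, sub_add_cancel]

variable (M) in
/-- A smooth lift of the angle function to the real line. -/
noncomputable def turning (s : ℝ) : ℝ := (M.logVelocity s).im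

theorem contDiff_turning : ContDiff ℝ ∞ M.turning :=
  Complex.imCLM.contDiff.comp contDiff_logVelocity

theorem deriv_turning (s : ℝ) : deriv M.turning s = (M.logRate s).im :=
  (Complex.imCLM.hasFDerivAt.comp_hasDerivAt s (hasDerivAt_logVelocity s)).deriv

theorem periodic_deriv : Function.Periodic (deriv M.toFun) M.period := fun s => by
  rw [← deriv_comp_add_const]
  exact congrArg (fun g => deriv g s) (funext M.periodic)

theorem logVelocity_add (s : ℝ) :
    M.logVelocity (s + M.period) = M.logVelocity s + M.logVelocity M.period := by
  have hper : Function.Periodic M.logRate M.period := fun s => by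
    have h2 : Function.Periodic (deriv (deriv M.toFun)) M.period := fun s => by
      rw [← deriv_comp_add_const]
      exact congrArg (fun g => deriv g s) (funext periodic_deriv)
    simp only [logRate, h2 s, periodic_deriv s]
  have hi : ∀ a b, IntervalIntegrable M.logRate MeasureTheory.volume a b := fun a b =>
    contDiff_logRate.continuous.intervalIntegrable a b
  have h := hper.intervalIntegral_add_eq s 0
  rw [zero_add] at h
  unfold logVelocity
  rw [← h, intervalIntegral.integral_add_adjacent_intervals (hi _ _) (hi _ _)]

/-- The velocity itself returns after a period, not only its line, so the total turning is a
multiple of `2π`. -/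
theorem exists_turning_add : ∃ n : ℤ, ∀ s,
    M.turning (s + M.period) = M.turning s + (2 * n : ℤ) * Real.pi := by
  have h1 : Complex.exp (M.logVelocity M.period) = 1 := by
    have := deriv_eq_mul_exp (M := M) M.period
    have hp : deriv M.toFun M.period = deriv M.toFun 0 := by
      simpa using periodic_deriv (M := M) 0
    rw [hp] at this
    exact mul_left_cancel₀ (M.regular 0) (by rw [← this, mul_one])
  obtain ⟨n, hn⟩ := Complex.exp_eq_one_iff.1 h1
  refine ⟨n, fun s => ?_⟩
  rw [turning, logVelocity_add, hn, Complex.add_im, turning]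
  simp
  ring

theorem angle_eq (s : ℝ) : M.angle s = (M.turning s : AddCircle Real.pi) := by
  rw [angle, deriv_div_deriv, show M.logVelocity 0 = 0 from intervalIntegral.integral_same, sub_zero,
    AngleFunction.coe_eq_coe_iff]
  obtain ⟨n, hn⟩ := Complex.exp_eq_exp_iff_exists_int.1
    (Complex.exp_log (Complex.exp_ne_zero (M.logVelocity s)))
  refine ⟨-(2 * n), ?_⟩
  have := congrArg Complex.im hn
  rw [Complex.log_im, Complex.add_im] at this
  rw [this, turning]
  simp
  ring

theorem angle_eq_iff {s t : ℝ} :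
    M.angle s = M.angle t ↔ ∃ k : ℤ, M.turning t = M.turning s + k * Real.pi := by
  rw [angle_eq, angle_eq, AngleFunction.coe_eq_coe_iff]

/-- By continuity the difference stays in `(-π, π)` near `s`, where the principal argument has no
jump. -/
theorem angleLift_eventuallyEq (s : ℝ) :
    M.angleLift s =ᶠ[nhds s] fun u => M.turning u - M.turning s := by
  have hc : ContinuousAt (fun u => M.turning u - M.turning s) s :=
    (contDiff_turning.continuous.sub continuous_const).continuousAt
  have := hc.eventually (Ioo_mem_nhds (a := -Real.pi) (b := Real.pi)
    (by simp [Real.pi_pos]) (by simp [Real.pi_pos]))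
  filter_upwards [this] with u hu
  rw [angleLift, deriv_div_deriv, ← Complex.log_im, Complex.log_exp]
  · simp [turning]
  · simpa [turning] using hu.1
  · simpa [turning] using hu.2.le

theorem deriv_angleLift (s : ℝ) : deriv (M.angleLift s) s = deriv M.turning s := by
  rw [(angleLift_eventuallyEq s).deriv_eq, deriv_sub_const]

theorem iteratedDeriv_angleLift (s : ℝ) :
    iteratedDeriv 2 (M.angleLift s) s = deriv (deriv M.turning) s := by
  rw [iteratedDeriv_succ, iteratedDeriv_one, (angleLift_eventuallyEq s).deriv.deriv_eq]
  congr 1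
  funext u
  rw [deriv_sub_const]

theorem curvature_eq : M.curvature = fun s => deriv M.turning s * ‖deriv M.toFun s‖⁻¹ := by
  funext s
  have h0 := M.regular s
  have hn : ‖deriv M.toFun s‖ ≠ 0 := norm_ne_zero_iff.2 h0
  have h1 : starRingEnd ℂ (deriv M.toFun s) * deriv (deriv M.toFun) s =
      ((‖deriv M.toFun s‖ ^ 2 : ℝ) : ℂ) * M.logRate s := by
    rw [logRate, Complex.ofReal_pow, ← Complex.conj_mul']
    field_simp
  rw [curvature, h1, Complex.im_ofReal_mul, deriv_turning]
  field_simp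

theorem curvature_eq_zero_iff {s : ℝ} : M.curvature s = 0 ↔ deriv M.turning s = 0 := by
  rw [curvature_eq]
  simp [M.regular s]

theorem deriv_curvature {s : ℝ} (h : deriv M.turning s = 0) :
    deriv M.curvature s = deriv (deriv M.turning) s * ‖deriv M.toFun s‖⁻¹ := by
  have h1 : DifferentiableAt ℝ (deriv M.turning) s :=
    (contDiff_infty_iff_deriv.1 contDiff_turning).2.differentiable (by simp) s
  have h2 : DifferentiableAt ℝ (fun s => ‖deriv M.toFun s‖⁻¹) s :=
    ((M.contDiff_deriv.differentiable (by simp) s).norm ℝ (M.regular s)).inv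
      (norm_ne_zero_iff.2 (M.regular s))
  rw [curvature_eq, deriv_fun_mul h1 h2, h, zero_mul, add_zero]

/-- The lines are parallel iff the quotient of the velocities is real, that is, iff the sine of the
difference of turning angles is zero. -/
theorem parallel_iff {s t : ℝ} : M.tangentLine s ∥ M.tangentLine t ↔
    ∃ k : ℤ, M.turning t = M.turning s + k * Real.pi := by
  have hexp := deriv_div_deriv (M := M) s t
  have him : (M.logVelocity t - M.logVelocity s).im = M.turning t - M.turning s := by simp [turning]
  have hne : ∀ r, M.tangentLine r ≠ ⊥ := fun r h =>
    (AffineSubspace.nonempty_iff_ne_bot _).1 ⟨_, AffineSubspace.self_mem_mk' _ _⟩ h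
  rw [AffineSubspace.parallel_iff_direction_eq_and_eq_bot_iff_eq_bot,
    eq_false (hne s), eq_false (hne t), iff_self, and_true, tangentLine, tangentLine,
    AffineSubspace.direction_mk', AffineSubspace.direction_mk',
    Submodule.span_singleton_eq_span_singleton]
  have hsin : (∃ k : ℤ, M.turning t = M.turning s + k * Real.pi) ↔
      Real.sin (M.turning t - M.turning s) = 0 := by
    rw [Real.sin_eq_zero_iff]
    exact exists_congr fun k => ⟨fun h => by linarith, fun h => by linarith⟩
  have him2 : (deriv M.toFun t / deriv M.toFun s).im = 0 ↔
      Real.sin (M.turning t - M.turning s) = 0 := by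
    rw [hexp, Complex.exp_im, him, mul_eq_zero, or_iff_right (Real.exp_ne_zero _)]
  rw [hsin, ← him2]
  constructor
  · rintro ⟨c, hc⟩
    rw [← hc, Units.smul_def, Complex.real_smul, mul_div_assoc, div_self (M.regular s), mul_one,
      Complex.ofReal_im]
  · intro h
    have hreal : deriv M.toFun t / deriv M.toFun s =
        ((deriv M.toFun t / deriv M.toFun s).re : ℂ) := Complex.ext rfl (by simpa using h)
    have hre : (deriv M.toFun t / deriv M.toFun s).re ≠ 0 := fun h0 => by
      rw [h0, Complex.ofReal_zero, div_eq_zero_iff] at hreal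
      exact hreal.elim (M.regular t) (M.regular s)
    refine ⟨Units.mk0 _ hre, ?_⟩
    rw [Units.smul_def, Complex.real_smul, Units.val_mk0, ← hreal, div_mul_cancel₀ _ (M.regular s)]

/-- The angle function of a generic curve. -/
noncomputable def angleFunction (hM : M.IsGeneric) : AngleFunction M.period where
  θ := M.turning
  rot := 2 * M.exists_turning_add.choose
  even_rot := even_two_mul _
  T_pos := M.period_pos
  smooth := contDiff_turning
  shift := M.exists_turning_add.choose_spec
  morse s hs h := hM.ordinary s (curvature_eq_zero_iff.2 hs) (by
    rw [deriv_curvature hs, h, zero_mul])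
  inj s t hs ht hst := by
    rw [← AngleFunction.coe_eq_coe_iff]
    by_contra hne
    exact hM.inflexions s t hne (curvature_eq_zero_iff.2 hs) (curvature_eq_zero_iff.2 ht)
      (parallel_iff.2 hst)

end RegularClosedCurve

/-! ### Translation to the angle function -/

namespace RegularClosedCurve

open AngleFunction

variable {M : RegularClosedCurve} (hM : M.IsGeneric)

theorem toFun_eq_of_same {s t : ℝ} (h : Same M.period s t) : M.toFun t = M.toFun s := by
  obtain ⟨n, rfl⟩ := h
  rw [← zsmul_eq_mul]
  exact M.periodic.zsmul n s

/-- Transversality is used here: different parameters with parallel tangents cannot be a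
self-intersection, so `f s ≠ f t` just means different points of the circle. -/
theorem parallelPair_iff {s t : ℝ} : M.ParallelPair s t ↔ (s, t) ∈ (angleFunction hM).pairs := by
  constructor
  · rintro ⟨hne, hpar⟩
    exact ⟨parallel_iff.1 hpar, fun h => hne (toFun_eq_of_same h).symm⟩
  · rintro ⟨hpar, hne⟩
    refine ⟨fun h => hM.transverse s t (fun e => hne (coe_eq_coe_iff.1 e)) h (parallel_iff.2 hpar),
      parallel_iff.2 hpar⟩

theorem pairSet_eq : M.pairSet = (angleFunction hM).closedPairs := by
  unfold pairSet closedPairs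
  congr 1
  ext p
  constructor
  · rintro ⟨s, t, h, rfl⟩
    exact ⟨(s, t), (parallelPair_iff hM).1 h, rfl⟩
  · rintro ⟨⟨s, t⟩, h, rfl⟩
    exact ⟨s, t, (parallelPair_iff hM).2 h, rfl⟩

theorem glueArc_eq (u v u' v' : ℝ) :
    M.glueArc u v u' v' = (angleFunction hM).edge (u, u') (v, v') := by
  unfold glueArc edge
  congr 1
  ext p
  constructor
  · rintro ⟨s, hs, t, ht, h, rfl⟩
    exact ⟨(s, t), ⟨(parallelPair_iff hM).1 h, hs, ht⟩, rfl⟩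
  · rintro ⟨⟨s, t⟩, ⟨h, hs, ht⟩, rfl⟩
    exact ⟨s, hs, t, ht, (parallelPair_iff hM).2 h, rfl⟩

theorem coe_mem_localExtrema_iff {x : ℝ} :
    (x : AddCircle Real.pi) ∈ M.localExtrema ↔ x ∈ (angleFunction hM).critValues := by
  constructor
  · rintro ⟨s, hs, h0, -⟩
    rw [angle_eq, coe_eq_coe_iff] at hs
    obtain ⟨k, hk⟩ := hs
    exact ⟨s, k, (deriv_angleLift s).symm.trans h0, hk⟩
  · rintro ⟨s, k, h0, rfl⟩
    refine ⟨s, by rw [angle_eq, coe_eq_coe_iff]; exact ⟨k, rfl⟩, (deriv_angleLift s).trans h0, ?_⟩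
    rw [iteratedDeriv_angleLift]
    exact (angleFunction hM).morse s h0

theorem localExtrema_nonempty_iff :
    M.localExtrema.Nonempty ↔ (angleFunction hM).critValues.Nonempty := by
  constructor
  · rintro ⟨c, hc⟩
    obtain ⟨x, rfl⟩ := QuotientAddGroup.mk_surjective c
    exact ⟨x, (coe_mem_localExtrema_iff hM).1 hc⟩
  · rintro ⟨x, hx⟩
    exact ⟨x, (coe_mem_localExtrema_iff hM).2 hx⟩

theorem parallelPoints_eq : M.parallelPoints = (angleFunction hM).points := by
  unfold parallelPoints points marks
  by_cases h : M.localExtrema.Nonempty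
  · rw [if_pos h, if_pos ((localExtrema_nonempty_iff hM).1 h)]
    ext s
    change M.angle s ∈ M.localExtrema ↔ M.turning s ∈ (angleFunction hM).critValues
    rw [angle_eq]
    exact coe_mem_localExtrema_iff hM
  · rw [if_neg h, if_neg (mt (localExtrema_nonempty_iff hM).2 h)]
    ext s
    exact eq_comm.trans angle_eq_iff

theorem consecutive_or_iff {u v : ℝ} :
    M.Consecutive u v ∨ M.Consecutive v u ↔ (angleFunction hM).Arc u v := by
  unfold Consecutive Arc IsGap
  rw [parallelPoints_eq hM]
  constructor
  · rintro (⟨h, hu, hv, hw⟩ | ⟨h, hv, hu, hw⟩)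
    · exact ⟨hu, hv, h.ne, by rwa [Set.uIoo_of_lt h]⟩
    · exact ⟨hu, hv, h.ne', by rwa [Set.uIoo_of_gt h]⟩
  · rintro ⟨hu, hv, hne, hw⟩
    rcases lt_or_gt_of_ne hne with h | h
    · exact Or.inl ⟨h, hu, hv, by rwa [Set.uIoo_of_lt h] at hw⟩
    · exact Or.inr ⟨h, hv, hu, by rwa [Set.uIoo_of_gt h] at hw⟩

theorem consecutive_iff {u v : ℝ} :
    M.Consecutive u v ↔ u < v ∧ (angleFunction hM).Arc u v := by
  constructor
  · intro h
    exact ⟨h.1, (consecutive_or_iff hM).1 (Or.inl h)⟩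
  · rintro ⟨h, ha⟩
    exact ((consecutive_or_iff hM).2 ha).resolve_right fun h' => lt_asymm h h'.1

theorem angle_image (s : Set ℝ) :
    M.angle '' s = ((↑) : ℝ → AddCircle Real.pi) '' (M.turning '' s) := by
  rw [Set.image_image]
  exact Set.image_congr fun x _ => angle_eq x

theorem angle_image_of_lt (hne : M.localExtrema.Nonempty) {u v : ℝ}
    (h : (angleFunction hM).Arc u v) (hlt : M.turning u < M.turning v) :
    M.angle '' Set.uIoo u v = Set.cIoo (M.angle u) (M.angle v) := by
  have hpi := h.abs_sub_lt ((localExtrema_nonempty_iff hM).1 hne)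
  have himg : M.turning '' Set.uIoo u v = Set.Ioo (M.turning u) (M.turning v) :=
    h.image_uIoo.trans (Set.uIoo_of_lt hlt)
  rw [angle_image, himg, angle_eq, angle_eq]
  refine AddCircle.image_coe_Ioo hlt ?_
  have := (le_abs_self _).trans_lt hpi
  change M.turning v - M.turning u < _ at this
  linarith

/-- The image being `(α, β)` rather than the complementary `(β, α)` fixes the direction of the arc
to be that of increasing angle. -/
theorem mem_parallelArcs_iff (hne : M.localExtrema.Nonempty) {u v : ℝ} {α β : AddCircle Real.pi} :
    (u, v) ∈ M.parallelArcs α β ↔ (angleFunction hM).Arc u v ∧ M.angle u = α ∧ M.angle v = β ∧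
      M.turning u < M.turning v := by
  change _ ∧ _ ∧ _ ∧ _ ↔ _
  rw [consecutive_or_iff hM]
  refine and_congr_right fun ha => and_congr_right fun hα => and_congr_right fun hβ => ?_
  subst hα hβ
  refine ⟨fun himg => ?_, angle_image_of_lt hM hne ha⟩
  by_contra hnlt
  have hgt : M.turning v < M.turning u := lt_of_le_of_ne (not_lt.1 hnlt) ha.ne.symm
  have h2 := angle_image_of_lt hM hne ha.symm hgt
  have himg' : M.angle '' Set.uIoo u v = _ := himg
  obtain ⟨s, hs⟩ : (Set.uIoo u v).Nonempty := by
    rcases lt_or_gt_of_ne ha.2.2.1 with h | h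
    · rw [Set.uIoo_of_lt h]; exact Set.nonempty_Ioo.2 h
    · rw [Set.uIoo_of_gt h]; exact Set.nonempty_Ioo.2 h
  rw [Set.uIoo_comm, himg'] at h2
  have hm : M.angle s ∈ Set.cIoo (M.angle u) (M.angle v) := himg' ▸ Set.mem_image_of_mem _ hs
  have hm' : M.angle s ∈ Set.cIoo (M.angle v) (M.angle u) := h2 ▸ hm
  exact SBtw.sbtw.not_sbtw (show sbtw (M.angle u) (M.angle s) (M.angle v) from hm) hm'

theorem exists_mem_parallelArcs_iff (hne : M.localExtrema.Nonempty) {u v u' v' : ℝ} :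
    (∃ Φ ∈ M.parallelArcSets, (u, v) ∈ Φ ∧ (u', v') ∈ Φ) ↔
      (angleFunction hM).Arc u v ∧ (angleFunction hM).Arc u' v' ∧ M.angle u = M.angle u' ∧
        M.angle v = M.angle v' ∧ M.turning u < M.turning v ∧ M.turning u' < M.turning v' := by
  unfold parallelArcSets
  rw [if_pos hne]
  constructor
  · rintro ⟨_, ⟨α, -, β, -, -, -, rfl⟩, h, h'⟩
    rw [mem_parallelArcs_iff hM hne] at h h'
    exact ⟨h.1, h'.1, h.2.1.trans h'.2.1.symm, h.2.2.1.trans h'.2.2.1.symm, h.2.2.2, h'.2.2.2⟩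
  · rintro ⟨ha, ha', hu, hv, hlt, hlt'⟩
    refine ⟨_, ⟨M.angle u, ?_, M.angle v, ?_, ?_, ?_, rfl⟩,
      (mem_parallelArcs_iff hM hne).2 ⟨ha, rfl, rfl, hlt⟩,
      (mem_parallelArcs_iff hM hne).2 ⟨ha', hu.symm, hv.symm, hlt'⟩⟩
    · have := ha.1
      rw [← parallelPoints_eq hM, parallelPoints, if_pos hne] at this
      exact this
    · have := ha.2.1
      rw [← parallelPoints_eq hM, parallelPoints, if_pos hne] at this
      exact this
    · rw [Ne, angle_eq_iff]
      rintro ⟨k, hk⟩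
      have hpi := ha.abs_sub_lt ((localExtrema_nonempty_iff hM).1 hne)
      change |M.turning v - M.turning u| < _ at hpi
      rw [hk, add_sub_cancel_left, abs_mul, abs_of_pos Real.pi_pos] at hpi
      have h1 : |(k : ℝ)| < 1 := by
        by_contra! h
        nlinarith [Real.pi_pos]
      have h2 : k = 0 := Int.abs_lt_one_iff.1 (by exact_mod_cast h1)
      rw [h2] at hk
      simp at hk
      exact hlt.ne hk.symm
    · rw [← angle_image_of_lt hM hne ha hlt, Set.eq_empty_iff_forall_notMem]
      rintro _ ⟨⟨s, hs, rfl⟩, hm⟩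
      have := ha.2.2.2 s hs
      rw [← parallelPoints_eq hM, parallelPoints, if_pos hne] at this
      exact this hm

include hM in
theorem strictMono_or_strictAnti_turning (hne : ¬ M.localExtrema.Nonempty) :
    StrictMono M.turning ∨ StrictAnti M.turning := by
  have h0 : ∀ s, deriv M.turning s ≠ 0 := fun s hs =>
    hne ((localExtrema_nonempty_iff hM).2 ⟨_, s, 0, hs, rfl⟩)
  have hc : Continuous (deriv M.turning) := (angleFunction hM).smooth_deriv.continuous
  have key : (∀ s, 0 < deriv M.turning s) ∨ ∀ s, deriv M.turning s < 0 := by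
    by_contra! hcon
    obtain ⟨⟨s, h1⟩, t, h2⟩ := hcon
    obtain ⟨x, -, hx⟩ := isPreconnected_univ.intermediate_value (Set.mem_univ s) (Set.mem_univ t)
      hc.continuousOn ⟨h1, h2⟩
    exact h0 x hx
  exact key.imp strictMono_of_deriv_pos strictAnti_of_deriv_neg

/-- Belonging to one set of parallel arcs, or doing so after reversing both, means that the angle
runs in the same direction along both from equal directions. Without extrema the angle is monotone,
so the direction of the curve serves instead. -/
theorem glueable_iff {u v u' v' : ℝ} :
    M.Glueable u v u' v' ↔ (angleFunction hM).Adj (u, u') (v, v') := by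
  by_cases hne : M.localExtrema.Nonempty
  · simp only [Glueable, and_or_left, exists_or, exists_mem_parallelArcs_iff hM hne]
    constructor
    · rintro ⟨⟨h1, h2, hu, -, hlt, hlt'⟩ | ⟨h1, h2, -, hu, hlt, hlt'⟩, hs⟩
      · exact (Adj.iff_of_par (z := (u, u')) (w := (v, v')) h1 h2 (angle_eq_iff.1 hu)).2 ⟨iff_of_true hlt hlt', hs⟩
      · exact (Adj.iff_of_par (z := (u, u')) (w := (v, v')) h1.symm h2.symm
          (angle_eq_iff.1 hu)).2
          ⟨iff_of_false hlt.not_gt hlt'.not_gt, hs⟩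
    · intro h
      have hiff := ((Adj.iff_of_par h.1 h.2.1
        (h.2.2.1.imp fun _ => And.left)).1 h).1
      obtain ⟨h1, h2, ⟨k, hk, hk'⟩, hs⟩ := h
      have hu : M.angle u = M.angle u' := angle_eq_iff.2 ⟨k, hk⟩
      have hv : M.angle v = M.angle v' := angle_eq_iff.2 ⟨k, hk'⟩
      refine ⟨?_, hs⟩
      by_cases hlt : M.turning u < M.turning v
      · exact Or.inl ⟨h1, h2, hu, hv, hlt, hiff.1 hlt⟩
      · exact Or.inr ⟨h1.symm, h2.symm, hv, hu, h1.lt_iff_not_lt.1 hlt,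
          h2.lt_iff_not_lt.1 (mt hiff.2 hlt)⟩
  · have hset : M.parallelArcSets = {{p | M.Consecutive p.1 p.2}} := if_neg hne
    have hpar : ∀ {s t}, s ∈ (angleFunction hM).points → t ∈ (angleFunction hM).points →
        (angleFunction hM).Par (s, t) := by
      intro s t hs ht
      rw [← parallelPoints_eq hM, parallelPoints, if_neg hne] at hs ht
      exact angle_eq_iff.1 (Eq.trans hs (Eq.symm ht))
    have hdir : ∀ {a b a' b' : ℝ}, a ≠ b → a' ≠ b' →
        ((M.turning a < M.turning b ↔ M.turning a' < M.turning b') ↔ (a < b ↔ a' < b')) := by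
      intro a b a' b' hab hab'
      rcases strictMono_or_strictAnti_turning hM hne with h | h
      · rw [h.lt_iff_lt, h.lt_iff_lt]
      · rw [h.lt_iff_gt, h.lt_iff_gt, ← not_le, ← not_le, hab.le_iff_lt, hab'.le_iff_lt,
          not_iff_not]
    simp only [Glueable, hset, Set.mem_singleton_iff, exists_eq_left, Set.mem_ofPred_eq,
      consecutive_iff hM]
    constructor
    · rintro ⟨⟨⟨h, h1⟩, h', h2⟩ | ⟨⟨h, h1⟩, h', h2⟩, hs⟩
      · exact (Adj.iff_of_par (z := (u, u')) (w := (v, v')) h1 h2 (hpar h1.1 h2.1)).2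
          ⟨(hdir h.ne h'.ne).2 (iff_of_true h h'), hs⟩
      · exact (Adj.iff_of_par (z := (u, u')) (w := (v, v')) h1.symm h2.symm
          (hpar h1.2.1 h2.2.1)).2
          ⟨(hdir h.ne' h'.ne').2 (iff_of_false h.not_gt h'.not_gt), hs⟩
    · intro h
      have hiff := ((Adj.iff_of_par h.1 h.2.1
        (h.2.2.1.imp fun _ => And.left)).1 h).1
      obtain ⟨h1, h2, -, hs⟩ := h
      have hd := (hdir h1.2.2.1 h2.2.2.1).1 hiff
      refine ⟨?_, hs⟩
      rcases lt_or_gt_of_ne h1.2.2.1 with hlt | hlt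
      · exact Or.inl ⟨⟨hlt, h1⟩, hd.1 hlt, h2⟩
      · exact Or.inr ⟨⟨hlt, h1.symm⟩, lt_of_le_of_ne (not_lt.1 (mt hd.2 hlt.not_gt))
          h2.2.2.1.symm, h2.symm⟩

end RegularClosedCurve

/-! ### Glueing schemes and smooth branches -/

namespace AngleFunction

variable {T : ℝ} {A : AngleFunction T}

theorem isSegment_one (half : Prop) (z : ℤ → ℝ × ℝ) : IsSegment T half z 1 :=
  ⟨one_pos, fun i j _ _ _ _ _ _ _ => ⟨by omega, by omega⟩⟩

theorem segmentCarrier_one (z : ℤ → ℝ × ℝ) : A.segmentCarrier z 1 = A.edge (z 0) (z 1) := by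
  unfold segmentCarrier
  rw [show Set.Ico (0 : ℤ) 1 = {0} from by ext; simp; omega]
  simp

/-- A finite path is an initial part of a walk, unless it turns back. -/
theorem exists_walk_of_path {n : ℕ} {v : ℕ → ℝ × ℝ} (hn : 0 < n)
    (hadj : ∀ i < n, A.Adj (v i) (v (i + 1))) (hback : ∀ i, i + 2 ≤ n → v (i + 2) ≠ v i) :
    ∃ z, A.IsWalk z ∧ ∀ i ≤ n, z i = v i := by
  obtain ⟨z, hz, h0, h1⟩ := (hadj 0 hn).exists_walk
  refine ⟨z, hz, ?_⟩
  have key : ∀ i : ℕ, i + 1 ≤ n → z i = v i ∧ z (i + 1) = v (i + 1) := by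
    intro i
    induction i with
    | zero => exact fun _ => ⟨by simpa using h0, by simpa using h1⟩
    | succ i ih =>
      intro hi
      obtain ⟨e0, e1⟩ := ih (by omega)
      refine ⟨by push_cast; exact e1, ?_⟩
      have ha := hadj (i + 1) (by omega)
      rw [← e1] at ha
      rcases hz.eq_or_eq ha with h | h
      · push_cast
        exact h.symm
      · rw [add_sub_cancel_right, e0] at h
        exact absurd h (hback i (by omega))
  intro i hi
  rcases Nat.lt_or_ge i n with h | h
  · exact (key i h).1
  · obtain rfl : i = n := le_antisymm hi h
    obtain ⟨m, rfl⟩ := Nat.exists_eq_succ_of_ne_zero hn.ne'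
    have := (key m le_rfl).2
    push_cast
    exact this

theorem segmentCarrier_natCast (z : ℤ → ℝ × ℝ) (n : ℕ) :
    A.segmentCarrier z n = ⋃ i : Fin n, A.edge (z (i : ℕ)) (z ((i : ℕ) + 1)) := by
  ext x
  simp only [segmentCarrier, Set.mem_iUnion, Set.mem_Ico, exists_prop]
  constructor
  · rintro ⟨i, ⟨h0, hn⟩, hx⟩
    lift i to ℕ using h0
    exact ⟨⟨i, by omega⟩, hx⟩
  · rintro ⟨i, hx⟩
    exact ⟨(i : ℕ), ⟨by omega, by omega⟩, hx⟩

/-- For finiteness: carriers of segments are unions of subsets of a finite set. -/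
theorem IsWalk.segmentCarrier_mem {z : ℤ → ℝ × ℝ} (h : A.IsWalk z) (n : ℤ) :
    A.segmentCarrier z n ∈ Set.sUnion '' 𝒫 A.edges := by
  refine ⟨(fun i => A.edge (z i) (z (i + 1))) '' Set.Ico 0 n, ?_, ?_⟩
  · rintro _ ⟨i, -, rfl⟩
    exact ⟨_, _, h.adj i, rfl⟩
  · rw [Set.sUnion_image]
    rfl

theorem IsWalk.walkCarrier_eq {z z' : ℤ → ℝ × ℝ} (h : A.IsWalk z) (h' : A.IsWalk z')
    (hne : (A.walkCarrier z ∩ A.walkCarrier z').Nonempty) : A.walkCarrier z = A.walkCarrier z' :=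
  subset_antisymm (h'.subset_walkCarrier h.isPreconnected_walkCarrier h.walkCarrier_subset hne)
    (h.subset_walkCarrier h'.isPreconnected_walkCarrier h'.walkCarrier_subset
      (Set.inter_comm _ _ ▸ hne))

/-- A map that respects the symmetries has the same image on a maximal segment as on the walk. -/
theorem IsMaxSegment.image_eq {half : Prop} {z : ℤ → ℝ × ℝ} {n : ℤ} (h : A.IsMaxSegment half z n)
    {α : Type*} {f : AddCircle T × AddCircle T → α} (hf : half → ∀ p, f p.swap = f p) :
    f '' A.segmentCarrier z n = f '' A.walkCarrier z := by
  refine subset_antisymm (Set.image_mono (segmentCarrier_subset_walkCarrier z n)) ?_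
  unfold walkCarrier
  rw [Set.image_iUnion]
  refine Set.iUnion_subset fun k => ?_
  obtain ⟨i, h0, hn, g, hg, hgk⟩ := h.covered k
  have himg : f '' A.edge (g (z i)) (g (z (i + 1))) = f '' A.edge (z i) (z (i + 1)) := by
    rcases hg with ⟨a, b, rfl⟩ | ⟨hh, a, b, rfl⟩
    · rw [edge_lat]
    · rw [edge_swp, Set.image_image]
      exact Set.image_congr fun p _ => hf hh p
  have : f '' A.edge (z k) (z (k + 1)) = f '' A.edge (z i) (z (i + 1)) := by
    rw [← himg]
    rcases hgk with ⟨h1, h2⟩ | ⟨h1, h2⟩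
    · rw [h1, h2]
    · rw [h1, h2, edge_comm]
  rw [this]
  exact Set.image_mono (edge_subset_segmentCarrier h0 hn)

end AngleFunction

namespace RegularClosedCurve

open AngleFunction

variable {M : RegularClosedCurve} {lam : ℝ} (hM : M.IsGeneric)

/-! ### Glueing schemes as segments of walks -/

namespace GlueingScheme

variable (S : M.GlueingScheme lam)

/-- The pairs of parallel points of a glueing scheme. -/
def vertex (i : ℕ) : ℝ × ℝ :=
  (S.upper (Fin.ofNat (S.length + 1) i), S.lower (Fin.ofNat (S.length + 1) i))

theorem vertex_val (i : Fin (S.length + 1)) : S.vertex i = (S.upper i, S.lower i) := by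
  simp [vertex]

theorem vertex_castSucc (i : Fin S.length) :
    S.vertex i = (S.upper i.castSucc, S.lower i.castSucc) := S.vertex_val i.castSucc

theorem vertex_succ (i : Fin S.length) :
    S.vertex (i + 1) = (S.upper i.succ, S.lower i.succ) := by
  rw [← S.vertex_val, Fin.val_succ]

theorem adj (i : ℕ) (hi : i < S.length) :
    (angleFunction hM).Adj (S.vertex i) (S.vertex (i + 1)) := by
  have := (glueable_iff hM).1 (S.step ⟨i, hi⟩)
  rwa [← S.vertex_castSucc, ← S.vertex_succ] at this

theorem carrier_eq : S.carrier =
    ⋃ i : Fin S.length, (angleFunction hM).edge (S.vertex i) (S.vertex (i + 1)) := by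
  unfold carrier
  refine Set.iUnion_congr fun i => ?_
  rw [glueArc_eq hM, S.vertex_castSucc, S.vertex_succ]

theorem vertex_eq {i j : ℕ} (hi : i ≤ S.length) (hj : j ≤ S.length) (hij : i ≠ j)
    (h : torus M.period (S.vertex i) = torus M.period (S.vertex j)) :
    (i = 0 ∨ i = S.length) ∧ (j = 0 ∨ j = S.length) := by
  have hi' := S.vertex_val ⟨i, by omega⟩
  have hj' := S.vertex_val ⟨j, by omega⟩
  rw [Fin.val_mk] at hi' hj'
  rw [hi', hj'] at h
  have := S.no_repeat ⟨i, by omega⟩ ⟨j, by omega⟩ (by simpa using hij) h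
  simpa [Fin.ext_iff] using this

theorem vertex_swap {i j : ℕ} (hi : i ≤ S.length) (hj : j ≤ S.length) (hlam : lam = 1 / 2)
    (h : torus M.period (S.vertex i) = (torus M.period (S.vertex j)).swap) :
    (i = 0 ∨ i = S.length) ∧ (j = 0 ∨ j = S.length) := by
  have hi' := S.vertex_val ⟨i, by omega⟩
  have hj' := S.vertex_val ⟨j, by omega⟩
  rw [Fin.val_mk] at hi' hj'
  rw [hi', hj'] at h
  have := S.no_swap hlam ⟨i, by omega⟩ ⟨j, by omega⟩ h
  simpa [Fin.ext_iff] using this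

theorem exists_segment : ∃ z n, (angleFunction hM).IsWalk z ∧
    IsSegment M.period (lam = 1 / 2) z n ∧ S.carrier = (angleFunction hM).segmentCarrier z n := by
  by_cases hback : ∀ i, i + 2 ≤ S.length → S.vertex (i + 2) ≠ S.vertex i
  · obtain ⟨z, hz, hzv⟩ := exists_walk_of_path S.length_pos (S.adj hM) hback
    refine ⟨z, S.length, hz, ⟨by exact_mod_cast S.length_pos, ?_⟩, ?_⟩
    · intro i j hi hi' hj hj' g hg hgz
      lift i to ℕ using hi
      lift j to ℕ using hj
      norm_cast at hi' hj' ⊢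
      rw [hzv i hi', hzv j hj'] at hgz
      rcases hg with ⟨⟨a, b, rfl⟩, hij⟩ | ⟨hlam, a, b, rfl⟩
      · refine S.vertex_eq hi' hj' (by exact_mod_cast hij) ?_
        rw [← hgz, torus_lat]
      · refine S.vertex_swap hi' hj' hlam ?_
        rw [← hgz, torus_swp, Prod.swap_swap]
    · rw [segmentCarrier_natCast, S.carrier_eq hM]
      refine Set.iUnion_congr fun i => ?_
      rw [hzv i i.2.le, ← hzv (i + 1) i.2]
      push_cast
      rfl
  · push Not at hback
    obtain ⟨i, hi, e⟩ := hback
    -- A scheme may turn back only if this makes its beginning and end coincide: it then goes to and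
    -- fro along one edge, and a segment of length one has the same carrier.
    have h2 := S.vertex_eq hi (by omega) (by omega) (congrArg (torus M.period) e)
    obtain ⟨rfl, hlen⟩ : i = 0 ∧ S.length = 2 := by omega
    obtain ⟨z, hz, h0, h1⟩ := (S.adj hM 0 (by omega)).exists_walk
    refine ⟨z, 1, hz, isSegment_one _ z, ?_⟩
    rw [segmentCarrier_one, S.carrier_eq hM, h0, h1]
    have he : (angleFunction hM).edge (S.vertex 1) (S.vertex 2) =
        (angleFunction hM).edge (S.vertex 0) (S.vertex 1) := by
      rw [show S.vertex 2 = S.vertex 0 from e, edge_comm]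
    refine subset_antisymm (Set.iUnion_subset fun i => ?_)
      (Set.subset_iUnion (fun i : Fin S.length => (angleFunction hM).edge (S.vertex i)
        (S.vertex (i + 1))) ⟨0, by omega⟩)
    obtain ⟨i, hi'⟩ := i
    obtain rfl | rfl : i = 0 ∨ i = 1 := by omega
    · exact subset_rfl
    · exact he.subset

end GlueingScheme

theorem exists_glueingScheme {z : ℤ → ℝ × ℝ} {n : ℤ} (hz : (angleFunction hM).IsWalk z)
    (hn : IsSegment M.period (lam = 1 / 2) z n) :
    ∃ S : M.GlueingScheme lam, S.carrier = (angleFunction hM).segmentCarrier z n := by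
  obtain ⟨hpos, hn⟩ := hn
  lift n to ℕ using hpos.le
  refine ⟨⟨n, by exact_mod_cast hpos, fun i => (z (i : ℕ)).1, fun i => (z (i : ℕ)).2, ?_, ?_, ?_⟩,
    ?_⟩
  · intro i
    rw [glueable_iff hM]
    simpa using hz.adj (i : ℕ)
  · intro i j hij h
    obtain ⟨a, b, hab⟩ := torus_eq_iff.1 (show torus M.period (z (i : ℕ)) = torus M.period
      (z (j : ℕ)) from h)
    have := hn (i : ℕ) (j : ℕ) (by omega) (by omega) (by omega) (by omega) (lat M.period a b)
      (Or.inl ⟨⟨a, b, rfl⟩, by simpa [Fin.ext_iff] using hij⟩) hab.symm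
    simp only [Fin.ext_iff, Fin.val_zero, Fin.val_last]
    omega
  · intro hlam i j h
    obtain ⟨a, b, hab⟩ := torus_eq_iff.1 (show torus M.period (z (i : ℕ)) = torus M.period
      (z (j : ℕ)).swap from h)
    have := hn (i : ℕ) (j : ℕ) (by omega) (by omega) (by omega) (by omega) (swp M.period b a)
      (Or.inr ⟨hlam, b, a, rfl⟩) (by
        have := congrArg Prod.swap hab
        rw [Prod.swap_swap] at this
        rw [this]
        rfl)
    simp only [Fin.ext_iff, Fin.val_zero, Fin.val_last]
    omega
  · rw [segmentCarrier_natCast]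
    refine Set.iUnion_congr fun i => ?_
    rw [glueArc_eq hM]
    simp

theorem exists_glueingScheme_iff {X : Set (M.Param × M.Param)} :
    (∃ S : M.GlueingScheme lam, X = S.carrier) ↔ ∃ z n, (angleFunction hM).IsWalk z ∧
      IsSegment M.period (lam = 1 / 2) z n ∧ X = (angleFunction hM).segmentCarrier z n := by
  constructor
  · rintro ⟨S, rfl⟩
    exact S.exists_segment hM
  · rintro ⟨z, n, hz, hn, rfl⟩
    obtain ⟨S, hS⟩ := exists_glueingScheme hM hz hn
    exact ⟨S, hS.symm⟩

theorem pointMap_swap (h : lam = 1 / 2) (p : M.Param × M.Param) :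
    M.pointMap lam p.swap = M.pointMap lam p := by
  subst h
  simp only [pointMap, Prod.fst_swap, Prod.snd_swap]
  push_cast
  ring

/-- For `λ = 1/2` the set `G` may be a proper part of the walk carrier; only the images under
`pointMap` need to agree. -/
theorem IsMaximalGlueingScheme.exists_walk {G : Set (M.Param × M.Param)}
    (h : M.IsMaximalGlueingScheme lam G) : ∃ z, (angleFunction hM).IsWalk z ∧
      G ⊆ (angleFunction hM).walkCarrier z ∧ G.Nonempty ∧
      M.pointMap lam '' G = M.pointMap lam '' (angleFunction hM).walkCarrier z := by
  obtain ⟨z, n, hz, hn, rfl⟩ := (exists_glueingScheme_iff hM).1 h.1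
  have hmax : (angleFunction hM).IsMaxSegment (lam = 1 / 2) z n := ⟨hz, hn, fun z' n' hz' hn' hle =>
    h.2 ((exists_glueingScheme_iff hM).2 ⟨z', n', hz', hn', rfl⟩) hle⟩
  exact ⟨z, hz, segmentCarrier_subset_walkCarrier z n,
    ⟨_, edge_subset_segmentCarrier le_rfl hn.1 (hz.adj 0).left_mem_edge⟩,
    hmax.image_eq pointMap_swap⟩

include hM in
theorem exists_isMaximalGlueingScheme (S : M.GlueingScheme lam) :
    ∃ G, S.carrier ⊆ G ∧ M.IsMaximalGlueingScheme lam G := by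
  have hfin : {X | ∃ S : M.GlueingScheme lam, X = S.carrier}.Finite := by
    refine ((angleFunction hM).finite_edges.finite_subsets.image Set.sUnion).subset fun X hX => ?_
    obtain ⟨z, n, hz, -, rfl⟩ := (exists_glueingScheme_iff hM).1 hX
    exact hz.segmentCarrier_mem n
  obtain ⟨G, hle, hG⟩ := hfin.exists_le_maximal (a := S.carrier) ⟨S, rfl⟩
  exact ⟨G, hle, hG⟩

/-! ### Smooth branches as images of walks -/

theorem isPairTrace_walkCarrier {z : ℤ → ℝ × ℝ} (hz : (angleFunction hM).IsWalk z) :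
    M.IsPairTrace ((angleFunction hM).walkCarrier z) := by
  obtain ⟨γ, hγ, hd, hmem, hrange⟩ := hz.exists_trace
  have h1 : ContDiff ℝ ∞ fun u => (γ u).1 := contDiff_fst.comp hγ
  have h2 : ContDiff ℝ ∞ fun u => (γ u).2 := contDiff_snd.comp hγ
  refine ⟨fun u => (γ u).1, fun u => (γ u).2, h1, h2, fun u h => hd u ?_, fun u => ?_, hrange⟩
  · refine Eq.trans ?_ h
    exact ((h1.differentiable (by simp) u).hasDerivAt.prodMk
      (h2.differentiable (by simp) u).hasDerivAt).deriv
  · rw [pairSet_eq hM]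
    exact hmem u

theorem IsPairTrace.isPreconnected {X : Set (M.Param × M.Param)} (h : M.IsPairTrace X) :
    IsPreconnected X := by
  obtain ⟨σ, τ, hσ, hτ, -, -, rfl⟩ := h
  exact isPreconnected_range (continuous_torus.comp (hσ.continuous.prodMk hτ.continuous))

theorem IsPairTrace.subset {X : Set (M.Param × M.Param)} (h : M.IsPairTrace X) :
    X ⊆ M.pairSet := by
  obtain ⟨σ, τ, -, -, -, hm, rfl⟩ := h
  exact Set.range_subset_iff.2 hm

theorem IsPairTrace.nonempty {X : Set (M.Param × M.Param)} (h : M.IsPairTrace X) :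
    X.Nonempty := by
  obtain ⟨σ, τ, -, -, -, -, rfl⟩ := h
  exact Set.range_nonempty _

theorem IsPairTrace.subset_walkCarrier {X : Set (M.Param × M.Param)} (h : M.IsPairTrace X)
    {z : ℤ → ℝ × ℝ} (hz : (angleFunction hM).IsWalk z)
    (hne : (X ∩ (angleFunction hM).walkCarrier z).Nonempty) :
    X ⊆ (angleFunction hM).walkCarrier z :=
  hz.subset_walkCarrier h.isPreconnected (pairSet_eq hM ▸ h.subset) hne

/-- A trace is connected, so it stays in one component of `𝒫`, and each component is itself a trace.
-/
theorem maximal_isPairTrace_iff {X : Set (M.Param × M.Param)} :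
    Maximal M.IsPairTrace X ↔
      ∃ z, (angleFunction hM).IsWalk z ∧ X = (angleFunction hM).walkCarrier z := by
  constructor
  · intro h
    obtain ⟨x, hx⟩ := h.1.nonempty
    obtain ⟨z, hz, hxz⟩ := exists_walk_of_mem_closedPairs (pairSet_eq hM ▸ h.1.subset hx)
    have hsub := h.1.subset_walkCarrier hM hz ⟨x, hx, hxz⟩
    exact ⟨z, hz, subset_antisymm hsub (h.2 (isPairTrace_walkCarrier hM hz) hsub)⟩
  · rintro ⟨z, hz, rfl⟩
    refine ⟨isPairTrace_walkCarrier hM hz, fun Y hY hle => hY.subset_walkCarrier hM hz ?_⟩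
    obtain ⟨x, hx⟩ := (isPairTrace_walkCarrier hM hz).nonempty
    exact ⟨x, hle hx, hx⟩

theorem isSmoothBranch_iff {C : Set ℂ} : M.IsSmoothBranch lam C ↔
    ∃ z, (angleFunction hM).IsWalk z ∧ C = M.pointMap lam '' (angleFunction hM).walkCarrier z := by
  unfold IsSmoothBranch
  simp only [maximal_isPairTrace_iff hM]
  constructor
  · rintro ⟨_, ⟨z, hz, rfl⟩, rfl⟩
    exact ⟨z, hz, rfl⟩
  · rintro ⟨z, hz, rfl⟩
    exact ⟨_, ⟨z, hz, rfl⟩, rfl⟩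

theorem continuous_onCircle : Continuous M.onCircle :=
  (QuotientAddGroup.isQuotientMap_mk (N := AddSubgroup.zmultiples M.period)).continuous_iff.2
    M.contDiff.continuous

theorem continuous_pointMap : Continuous (M.pointMap lam) :=
  (continuous_const.mul (continuous_onCircle.comp continuous_fst)).add
    (continuous_const.mul (continuous_onCircle.comp continuous_snd))

/-- On the compact torus, a continuous map takes closures to closures. -/
theorem equidistant_eq : M.equidistant lam = M.pointMap lam '' M.pairSet := by
  have : Fact (0 < M.period) := ⟨M.period_pos⟩
  unfold equidistant pairSet
  rw [image_closure_of_isCompact isClosed_closure.isCompact continuous_pointMap.continuousOn]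
  congr 1
  ext z
  constructor
  · rintro ⟨s, t, h, rfl⟩
    exact ⟨_, ⟨s, t, h, rfl⟩, rfl⟩
  · rintro ⟨_, ⟨s, t, h, rfl⟩, rfl⟩
    exact ⟨s, t, h, rfl⟩

end RegularClosedCurve

theorem theorem4p17 (M : RegularClosedCurve) (hM : M.IsGeneric) (lam : ℝ)
    (h0 : lam ≠ 0) (h1 : lam ≠ 1) :
    (∀ G : Set (M.Param × M.Param), M.IsMaximalGlueingScheme lam G →
      M.IsSmoothBranch lam (M.pointMap lam '' G)) ∧
    (∀ C : Set ℂ, M.IsSmoothBranch lam C →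
      ∃ G : Set (M.Param × M.Param), M.IsMaximalGlueingScheme lam G ∧
        C = M.pointMap lam '' G) ∧
    M.equidistant lam = ⋃₀ {C : Set ℂ | M.IsSmoothBranch lam C} := by
  refine ⟨fun G hG => ?_, fun C hC => ?_, ?_⟩
  · obtain ⟨z, hz, -, -, h⟩ := hG.exists_walk hM
    exact (RegularClosedCurve.isSmoothBranch_iff hM).2 ⟨z, hz, h⟩
  · obtain ⟨z, hz, rfl⟩ := (RegularClosedCurve.isSmoothBranch_iff hM).1 hC
    -- One edge of the walk is a scheme. A maximal scheme above it lies on a walk that meets the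
    -- given one, so both walks have the same carrier.
    obtain ⟨S, hS⟩ := RegularClosedCurve.exists_glueingScheme (lam := lam) hM hz (AngleFunction.isSegment_one _ z)
    obtain ⟨G, hSG, hG⟩ := RegularClosedCurve.exists_isMaximalGlueingScheme hM S
    obtain ⟨z', hz', hsub, -, h⟩ := hG.exists_walk hM
    refine ⟨G, hG, ?_⟩
    rw [h]
    have hx : AngleFunction.torus M.period (z 0) ∈ (RegularClosedCurve.angleFunction hM).edge (z 0) (z 1) :=
      (hz.adj 0).left_mem_edge
    rw [hz.walkCarrier_eq hz' ⟨AngleFunction.torus M.period (z 0), AngleFunction.edge_subset_walkCarrier z 0 hx,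
      hsub (hSG (by rw [hS, AngleFunction.segmentCarrier_one]; exact hx))⟩]
  · rw [RegularClosedCurve.equidistant_eq, RegularClosedCurve.pairSet_eq hM]
    refine subset_antisymm ?_ (Set.sUnion_subset fun C hC => ?_)
    · rintro _ ⟨x, hx, rfl⟩
      obtain ⟨z, hz, hxz⟩ := AngleFunction.exists_walk_of_mem_closedPairs hx
      exact ⟨_, (RegularClosedCurve.isSmoothBranch_iff hM).2 ⟨z, hz, rfl⟩, x, hxz, rfl⟩
    · obtain ⟨z, hz, rfl⟩ := (RegularClosedCurve.isSmoothBranch_iff hM).1 hC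
      exact Set.image_mono hz.walkCarrier_subset
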